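/- **Theorem (Extended Hamilton variation principle).** Let $N\ge 0$, $\hbar>0$, let $z=(x,p)\in\mathbb R^{2N}$ be the phase-space coordinates, $\tilde z=(p,-x)$, $\partial/\partial\tilde z=(\partial/\partial p,-\partial/\partial x)$, and $\langle f\rangle=\int_{\mathbb R^{2N}} f\,dx\,dp$. Fix widths $w_{x_n},w_{p_n}>0$ with $w_{x_n}w_{p_n}=\hbar/2$ and put $$\Lambda=\overleftarrow{\partial_x}\cdot\overrightarrow{\partial_p}-\overleftarrow{\partial_p}\cdot\overrightarrow{\partial_x},\qquad \star=e^{i\frac{\hbar}{2}\Lambda},\qquad \odot=\exp\Big(\sum_n\big(w_{x_n}^2\overleftarrow{\partial_{x_n}}\overrightarrow{\partial_{x_n}}+w_{p_n}^2\overleftarrow{\partial_{p_n}}\overrightarrow{\partial_{p_n}}\big)\Big),\qquad \star_H=\star\,\odot .$$ Let $J\subseteq\mathbb R$ be an open set of times, $H\in C^\infty(\mathbb R^{2N},\mathbb R)$ the Husimi symbol of the Hamiltonian, and $G=H$ (classical mechanics) or $G=H\,\mathrm{sinc}(\tfrac\hbar2\Lambda)$, $\mathrm{sinc}\,s=\tfrac{\sin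 s}{s}$ (quantum mechanics), the Hamilton generator; $\partial G$ is the same expression with $H$ replaced by $\partial H$. Let $Q(z,t)$, $t\in J$, be real, smooth in $z$ with all $z$-derivatives jointly continuous, and with a jointly continuous time derivative. Assume that the series in powers of the above bidifferential operations applied to $H$ and $Q$ and to their derivatives (up to order $2$ in $H$ and $1$ in $Q$) converge absolutely and locally uniformly, also after a small translation of $H$ relative to $Q$ (with the coefficients of $\odot$ in the classical case, and the moduli of the coefficients of $\star_H$ in the quantum case; this is automatic for polynomial $H$). Let $A(z,t)$ and $\Gamma_{ij}(z,t)=-\Gamma_{ji}(z,t)$, $i,j=1,\dots,2N$, be arbitrary real functions that are twice differentiable in all their arguments, and $\mathcal L_i=\sum_{j}\partial\Gamma_{ij}/\partial z_j$. For a velocity field $v=\dot z=(\dot x,\dot p)$ consider the continuity equation $\partial_tQ=-\sum_i\partial_{z_i}(v_iQ)$ and the extended action $$S=\int_{t_i}^{t_f}dt\,\Big(\langle L\,(p\cdot\dot x)\,Q\rangle-\langle L\,(G\odot Q)\rangle+\langle L\,(A+\tilde z\cdot\mathcal L)\rangle\Big).$$ Here $L(z,t)$ is a Lagrangian label on $[t_i,t_f]$: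 a $C^1$ function with $\partial_tL=-\sum_i v_i\,\partial_{z_i}L$, supported in a compact set of $z$ uniformly in $t$. An admissible variation is a $C^1$ time-dependent parallel translation $z\mapsto z+\varepsilon\,\delta z(t)$ of all fluid parcels with $\delta z(t_i)=\delta z(t_f)=0$; it carries $Q$, $L$, $\Gamma_{ij}$ along, turns $v(z,t)$ into $v(z-\varepsilon\delta z,t)+\varepsilon\,\dot{\delta z}$, and leaves $H$ and $A$ fixed as functions of the phase-space point. The *variation principle* holds for $(Q,v)$ if for all $[t_i,t_f]\subset J$ with $t_i<t_f$, all labels and all admissible variations $\frac{d}{d\varepsilon}S\big|_{\varepsilon=0}$ exists and equals $0$. Then: 1. Let $v$ be jointly continuous and differentiable in $z$, and let $(Q,v)$ satisfy the continuity equation. If the extended Hamilton equations $$\dot z\,Q=\frac{\partial G}{\partial\tilde z}\odot Q-\frac{\partial A}{\partial\tilde z}-\mathcal L\qquad\text{on }J\times\mathbb R^{2N}$$ hold, then the variation principle holds. Conversely, if also $\partial v/\partial z$ is jointly continuous, then the variation principle implies the extended Hamilton equations. 2. For every $v$ that satisfies the extended Hamilton equations, the gauge terms cancel in the continuity equation: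 it is equivalent to the Liouville equation in the Husimi representation, $$\partial_tQ=H\,\Lambda\odot Q\ \text{ (classical)},\qquad \partial_tQ=-\tfrac i\hbar\,(H\star_HQ-Q\star_HH)\ \text{ (quantum)}.$$ 3. If $Q>0$ obeys this Husimi–Liouville equation, then there is a velocity field $v$, jointly continuous and differentiable in $z$, for which the continuity equation, the extended Hamilton equations and the variation principle all hold. 4. Suppose that $H=K*H_0$ and $Q(\cdot,t)=K*P(\cdot,t)$ for all $t\in J$, where $K$ is the Gaussian kernel with widths $w$, $H_0$ and $P(\cdot,t)$ are smooth of temperate growth, $\partial_tP$ exists, is continuous in $z$ and is of polynomial growth locally uniformly in $t$, and in the quantum case for every $t\in J$ there are $r\in\mathbb N$ and a summable sequence $(b_k)$ with $\frac{(\hbar/2)^k}{k!}\,|H_0\Lambda^kP(\cdot,t)|\le b_k(1+|z|)^r$ for all $k,z$. Then the Husimi–Liouville equation for $Q$ is equivalent to the Liouville equation $$\partial_tP=H_0\,\Lambda\,P\ \text{ (classical)},\qquad \partial_tP=-\tfrac i\hbar\,(H_0\star P-P\star H_0)\ \text{ (quantum)}.$$ -/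

import Mathlib

open scoped ContDiff

noncomputable section

namespace SkodjeGauge

/-- Indices of the `2N` phase-space coordinates: `Sum.inl n` is the position `x n`,
`Sum.inr n` is the momentum `p n`, so that `z = (x, p)`. -/
abbrev PhaseIdx (N : ℕ) : Type := Fin N ⊕ Fin N

/-- The `2N`-dimensional phase space. -/
abbrev Phase (N : ℕ) : Type := PhaseIdx N → ℝ

/-- The two theories covered jointly. -/
inductive Mechanics : Type
  | classical
  | quantum

variable {N : ℕ}

/-- The partial derivative `∂f/∂z_i`. -/
def pd (i : PhaseIdx N) (f : Phase N → ℝ) : Phase N → ℝ :=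
  fun z => fderiv ℝ f z (Pi.single i 1)

/-- Iterated partial derivatives along a list of coordinates. -/
def pdList (α : List (PhaseIdx N)) (f : Phase N → ℝ) : Phase N → ℝ :=
  α.foldr pd f

/-- The conjugate vector `z̃ = Ω z = (p, -x)`. -/
def zTilde (z : Phase N) : Phase N
  | Sum.inl n => z (Sum.inr n)
  | Sum.inr n => -z (Sum.inl n)

/-- The derivatives `∂/∂z̃ = (∂/∂p, -∂/∂x)`. -/
def pdTilde (i : PhaseIdx N) (f : Phase N → ℝ) : Phase N → ℝ :=
  match i with
  | Sum.inl n => pd (Sum.inr n) f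
  | Sum.inr n => fun z => -pd (Sum.inl n) f z

/-! ### Bidifferential operations -/

/-- Bidifferential operations on pairs of phase-space functions. -/
abbrev BiOp (N : ℕ) : Type := (Phase N → ℝ) → (Phase N → ℝ) → Phase N → ℝ

/-- Insert one factor of the Poisson operation `∂⃖_x·∂⃗_p - ∂⃖_p·∂⃗_x`. -/
def poissonStep (B : BiOp N) : BiOp N := fun f g z =>
  ∑ n : Fin N, (B (pd (Sum.inl n) f) (pd (Sum.inr n) g) z
    - B (pd (Sum.inr n) f) (pd (Sum.inl n) g) z)

/-- Insert one factor of `∑ n, (w_{x n}² ∂⃖_{x n} ∂⃗_{x n} + w_{p n}² ∂⃖_{p n} ∂⃗_{p n})`. -/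
def husimiStep (w : PhaseIdx N → ℝ) (B : BiOp N) : BiOp N := fun f g z =>
  ∑ i : PhaseIdx N, w i ^ 2 * B (pd i f) (pd i g) z

/-- The `k`-th power of the Poisson operation times the `m`-th power of the exponent of the
Husimi scalar product, applied to `f` (on the left) and `g` (on the right). -/
def biTerm (w : PhaseIdx N → ℝ) (k m : ℕ) : BiOp N :=
  (poissonStep^[k]) ((husimiStep w)^[m] (fun f g z => f z * g z))

/-- The `k`-th power of the Poisson operation. -/
def poissonPow (k : ℕ) : BiOp N :=
  (poissonStep^[k]) (fun f g z => f z * g z)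

/-- The Moyal product `f ⋆ g`, with `⋆ = exp (i ħ/2 · Poisson)`. -/
def moyal (ħ : ℝ) (f g : Phase N → ℝ) (z : Phase N) : ℂ :=
  ∑' k : ℕ, (Complex.I * (ħ / 2 : ℝ)) ^ k / (k.factorial : ℂ) * (poissonPow k f g z : ℂ)

/-- The Husimi star product: the Moyal product composed with the Husimi scalar product. -/
def husimiStar (ħ : ℝ) (w : PhaseIdx N → ℝ) (f g : Phase N → ℝ) (z : Phase N) : ℂ :=
  ∑' km : ℕ × ℕ, (Complex.I * (ħ / 2 : ℝ)) ^ km.1 / (km.1.factorial : ℂ)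
    * (1 / (km.2.factorial : ℂ)) * (biTerm w km.1 km.2 f g z : ℂ)

/-- Taylor coefficients, in powers of the Poisson operation, of the factor of the Hamilton
generator: `1` in classical mechanics, `sinc (ħ/2 · Poisson)` in quantum mechanics. -/
def genCoeff (M : Mechanics) (ħ : ℝ) (k : ℕ) : ℝ :=
  match M with
  | Mechanics.classical => if k = 0 then 1 else 0
  | Mechanics.quantum =>
      if Even k then (-1) ^ (k / 2) * (ħ / 2) ^ k / ((k + 1).factorial : ℝ) else 0

/-- `G ⊙ Q`, where `G` is the Hamilton generator with Hamiltonian symbol `H` and `⊙` is the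
Husimi scalar product. With `H` replaced by `∂H` it is `∂G ⊙ Q`. -/
def hamGen (M : Mechanics) (ħ : ℝ) (w : PhaseIdx N → ℝ) (H Q : Phase N → ℝ)
    (z : Phase N) : ℝ :=
  ∑' km : ℕ × ℕ, genCoeff M ħ km.1 / (km.2.factorial : ℝ) * biTerm w km.1 km.2 H Q z

/-! ### Regularity of the data (for times in a set `J`) -/

/-- Taylor coefficients of the full Poisson factor used for convergence: that of `1` in
classical mechanics, the moduli of those of `exp (i ħ/2 · Poisson)` in quantum mechanics. -/
def majCoeff (M : Mechanics) (ħ : ℝ) (k : ℕ) : ℝ :=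
  match M with
  | Mechanics.classical => if k = 0 then 1 else 0
  | Mechanics.quantum => (ħ / 2) ^ k / (k.factorial : ℝ)

/-- The series defining the Hamilton generator and the Husimi products of `H` and `Q`, and
those of their lower-order derivatives, converge absolutely and locally uniformly, also after
a small parallel translation of one factor relative to the other. (This always holds if `H` is
a polynomial, since then all the series terminate.) -/
def SeriesConverge (M : Mechanics) (ħ : ℝ) (w : PhaseIdx N → ℝ) (J : Set ℝ)
    (H : Phase N → ℝ) (Q : ℝ → Phase N → ℝ) : Prop :=
  ∀ α β : List (PhaseIdx N), α.length ≤ 2 → β.length ≤ 1 →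
    ∀ C : Set (ℝ × Phase N), IsCompact C → C ⊆ J ×ˢ Set.univ →
      ∃ ρ : ℝ, 0 < ρ ∧ ∃ b : ℕ × ℕ → ℝ, Summable b ∧
        ∀ t z, (t, z) ∈ C → ∀ u : Phase N, ‖u‖ ≤ ρ → ∀ k m : ℕ,
          majCoeff M ħ k / (m.factorial : ℝ)
            * |biTerm w k m (pdList α (fun y => H (y + u))) (pdList β (Q t)) z| ≤ b (k, m)

/-- A time-dependent state: smooth on phase space, with derivatives that are jointly continuous
in time and phase-space point, and continuously differentiable in time. -/
def IsState (J : Set ℝ) (Q : ℝ → Phase N → ℝ) : Prop :=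
  (∀ t ∈ J, ContDiff ℝ ∞ (Q t)) ∧
  (∀ n : ℕ, ContinuousOn (fun q : ℝ × Phase N => iteratedFDeriv ℝ n (Q q.1) q.2)
    (J ×ˢ Set.univ)) ∧
  (∀ t ∈ J, ∀ z, DifferentiableAt ℝ (fun s => Q s z) t) ∧
  ContinuousOn (fun q : ℝ × Phase N => deriv (fun s => Q s q.2) q.1) (J ×ˢ Set.univ)

/-- Twice differentiable as a function of all its arguments `(t, z)`. -/
def TwiceDifferentiable (J : Set ℝ) (F : ℝ → Phase N → ℝ) : Prop :=
  DifferentiableOn ℝ (fun q : ℝ × Phase N => F q.1 q.2) (J ×ˢ Set.univ) ∧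
  DifferentiableOn ℝ (fderiv ℝ (fun q : ℝ × Phase N => F q.1 q.2)) (J ×ˢ Set.univ)

/-- A velocity field `v = ż` on phase space. -/
def IsVelocity (J : Set ℝ) (v : ℝ → Phase N → Phase N) : Prop :=
  ContinuousOn (fun q : ℝ × Phase N => v q.1 q.2) (J ×ˢ Set.univ) ∧
  ∀ t ∈ J, Differentiable ℝ (v t)

/-- The phase-space derivative of the velocity field is jointly continuous, so that the parcels
have well-defined trajectories. -/
def IsRegularVelocity (J : Set ℝ) (v : ℝ → Phase N → Phase N) : Prop :=
  IsVelocity J v ∧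
  ContinuousOn (fun q : ℝ × Phase N => fderiv ℝ (v q.1) q.2) (J ×ˢ Set.univ)

/-! ### Fluid flow, labels, action, admissible variations -/

/-- The continuity equation `∂Q/∂t = -∑ i, ∂(ż_i Q)/∂z_i`. -/
def ContinuityEq (J : Set ℝ) (Q : ℝ → Phase N → ℝ) (v : ℝ → Phase N → Phase N) : Prop :=
  ∀ t ∈ J, ∀ z, deriv (fun s => Q s z) t = -∑ i, pd i (fun y => v t y i * Q t y) z

/-- A Lagrangian label on the time interval `[ti, tf]`: a continuously differentiable function
that moves with the fluid, `∂L/∂t = -∑ i, ż_i ∂L/∂z_i`. It vanishes outside a bounded part of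
the phase space, so that every phase-space integral in the action converges. -/
def IsLabel (v : ℝ → Phase N → Phase N) (ti tf : ℝ) (L : ℝ → Phase N → ℝ) : Prop :=
  ContDiffOn ℝ 1 (fun q : ℝ × Phase N => L q.1 q.2) (Set.Icc ti tf ×ˢ Set.univ) ∧
  (∃ K : Set (Phase N), IsCompact K ∧ ∀ t ∈ Set.Icc ti tf, ∀ z, z ∉ K → L t z = 0) ∧
  ∀ t ∈ Set.Ioo ti tf, ∀ z, deriv (fun s => L s z) t = -∑ i, v t z i * pd i (L t) z

/-- The vector gauge `𝓛_i = ∑ j, ∂Γ_{ij}/∂z_j`. -/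
def vecGauge (Γ : PhaseIdx N → PhaseIdx N → ℝ → Phase N → ℝ) (t : ℝ) (z : Phase N) : Phase N :=
  fun i => ∑ j, pd j (Γ i j t) z

/-- The extended action
`∫ dt (⟨L (p·ẋ) Q⟩ - ⟨L (G ⊙ Q)⟩ + ⟨L (A + z̃·𝓛)⟩)`. -/
def extAction (M : Mechanics) (ħ : ℝ) (w : PhaseIdx N → ℝ) (H : Phase N → ℝ)
    (A : ℝ → Phase N → ℝ) (ti tf : ℝ) (Q : ℝ → Phase N → ℝ) (v : ℝ → Phase N → Phase N)
    (L : ℝ → Phase N → ℝ) (Γ : PhaseIdx N → PhaseIdx N → ℝ → Phase N → ℝ) : ℝ :=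
  ∫ t in ti..tf,
    ((∫ z : Phase N, L t z * (∑ n : Fin N, z (Sum.inr n) * v t z (Sum.inl n)) * Q t z)
      - (∫ z : Phase N, L t z * hamGen M ħ w H (Q t) z)
      + ∫ z : Phase N, L t z * (A t z + ∑ i, zTilde z i * vecGauge Γ t z i))

/-- A function attached to the fluid parcels, after the parallel translation
`z ↦ z + ε δz(t)` of all parcels. -/
def shiftBy (ε : ℝ) (δz : ℝ → Phase N) (f : ℝ → Phase N → ℝ) : ℝ → Phase N → ℝ :=
  fun t z => f t (z - ε • δz t)

/-- The velocities of the parcels after the translation `z ↦ z + ε δz(t)`. -/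
def shiftVelocity (ε : ℝ) (δz : ℝ → Phase N) (v : ℝ → Phase N → Phase N) :
    ℝ → Phase N → Phase N :=
  fun t z => v t (z - ε • δz t) + ε • deriv δz t

/-- The variation principle `δS = 0`: on every time interval `[ti, tf]` in `J`, for every
Lagrangian label and every admissible variation (a time-dependent parallel translation of all
fluid parcels) that vanishes at `ti` and `tf`, the first variation of the extended action
exists and is zero. The state, the labels and the features `Γ` are carried along with the
parcels; `H` and `A` are fixed functions of the phase-space point. -/
def VariationPrinciple (M : Mechanics) (ħ : ℝ) (w : PhaseIdx N → ℝ) (J : Set ℝ)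
    (H : Phase N → ℝ) (A : ℝ → Phase N → ℝ) (Γ : PhaseIdx N → PhaseIdx N → ℝ → Phase N → ℝ)
    (Q : ℝ → Phase N → ℝ) (v : ℝ → Phase N → Phase N) : Prop :=
  ∀ ti tf : ℝ, ti < tf → Set.Icc ti tf ⊆ J →
    ∀ L : ℝ → Phase N → ℝ, IsLabel v ti tf L →
      ∀ δz : ℝ → Phase N, ContDiff ℝ 1 δz → δz ti = 0 → δz tf = 0 →
        HasDerivAt (fun ε : ℝ => extAction M ħ w H A ti tf (shiftBy ε δz Q)
          (shiftVelocity ε δz v) (shiftBy ε δz L) (fun i j => shiftBy ε δz (Γ i j))) 0 0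

/-! ### Equations of motion -/

/-- The extended Hamilton equations `ż Q = ∂G/∂z̃ ⊙ Q - ∂A/∂z̃ - 𝓛`. -/
def ExtHamiltonEq (M : Mechanics) (ħ : ℝ) (w : PhaseIdx N → ℝ) (J : Set ℝ)
    (H : Phase N → ℝ) (A : ℝ → Phase N → ℝ) (Γ : PhaseIdx N → PhaseIdx N → ℝ → Phase N → ℝ)
    (Q : ℝ → Phase N → ℝ) (v : ℝ → Phase N → Phase N) : Prop :=
  ∀ t ∈ J, ∀ z, ∀ i,
    v t z i * Q t z
      = hamGen M ħ w (pdTilde i H) (Q t) z - pdTilde i (A t) z - vecGauge Γ t z i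

/-- The Liouville equation in the Husimi representation: `∂Q/∂t` is the Poisson operation
composed with the Husimi scalar product in classical mechanics, and the Husimi star commutator
in quantum mechanics. -/
def HusimiLiouville (M : Mechanics) (ħ : ℝ) (w : PhaseIdx N → ℝ) (J : Set ℝ)
    (H : Phase N → ℝ) (Q : ℝ → Phase N → ℝ) : Prop :=
  match M with
  | Mechanics.classical => ∀ t ∈ J, ∀ z,
      deriv (fun s => Q s z) t = ∑' m : ℕ, 1 / (m.factorial : ℝ) * biTerm w 1 m H (Q t) z
  | Mechanics.quantum => ∀ t ∈ J, ∀ z,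
      ((deriv (fun s => Q s z) t : ℝ) : ℂ)
        = -(Complex.I / (ħ : ℂ)) * (husimiStar ħ w H (Q t) z - husimiStar ħ w (Q t) H z)

/-- The classical Liouville equation for a phase-space distribution, and the quantum Liouville
equation for a Wigner function. -/
def Liouville (M : Mechanics) (ħ : ℝ) (J : Set ℝ) (H : Phase N → ℝ)
    (P : ℝ → Phase N → ℝ) : Prop :=
  match M with
  | Mechanics.classical => ∀ t ∈ J, ∀ z,
      deriv (fun s => P s z) t = poissonPow 1 H (P t) z
  | Mechanics.quantum => ∀ t ∈ J, ∀ z,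
      ((deriv (fun s => P s z) t : ℝ) : ℂ)
        = -(Complex.I / (ħ : ℂ)) * (moyal ħ H (P t) z - moyal ħ (P t) H z)

/-! ### The Husimi transform -/

/-- The Gaussian kernel with widths `w`. -/
def husimiKernel (w : PhaseIdx N → ℝ) (u : Phase N) : ℝ :=
  ∏ n : Fin N, 1 / (2 * Real.pi * w (Sum.inr n) * w (Sum.inl n))
    * Real.exp (-(u (Sum.inr n)) ^ 2 / (2 * w (Sum.inr n) ^ 2)
        - (u (Sum.inl n)) ^ 2 / (2 * w (Sum.inl n) ^ 2))

/-- The Husimi transform: convolution with the Gaussian kernel. -/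
def husimi (w : PhaseIdx N → ℝ) (f : Phase N → ℝ) (z : Phase N) : ℝ :=
  ∫ y : Phase N, f y * husimiKernel w (z - y)

/-- A time-dependent distribution or Wigner function: a smooth function of temperate growth at
each time, with a continuous time derivative of polynomial growth, locally uniformly in time. -/
def IsTemperateState (J : Set ℝ) (P : ℝ → Phase N → ℝ) : Prop :=
  (∀ t ∈ J, (P t).HasTemperateGrowth) ∧
  (∀ t ∈ J, ∀ z, DifferentiableAt ℝ (fun s => P s z) t) ∧
  (∀ t ∈ J, Continuous (fun z => deriv (fun s => P s z) t)) ∧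
  ∀ T : Set ℝ, IsCompact T → T ⊆ J →
    ∃ (C : ℝ) (r : ℕ), ∀ t ∈ T, ∀ z, |deriv (fun s => P s z) t| ≤ C * (1 + ‖z‖) ^ r

/-- The Moyal series of `H` and `P t` converges absolutely, uniformly up to a polynomial weight
(no condition in classical mechanics, where only its zeroth term is present). -/
def MoyalConverge (M : Mechanics) (ħ : ℝ) (J : Set ℝ) (H : Phase N → ℝ)
    (P : ℝ → Phase N → ℝ) : Prop :=
  ∀ t ∈ J, ∃ (r : ℕ) (b : ℕ → ℝ), Summable b ∧
    ∀ k z, majCoeff M ħ k * |poissonPow k H (P t) z| ≤ b k * (1 + ‖z‖) ^ r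

end SkodjeGauge

end

noncomputable section

namespace SkodjeGauge

open Set Filter Topology MeasureTheory

variable {N : ℕ}

/-! ### Partial derivatives -/

section PartialDerivatives

/-! The bidifferential operations have constant coefficients, so they commute with translations and
obey the Leibniz rule; the convergence hypothesis allows their series to be differentiated term by
term. Four arguments build on this.

First variation. By translation invariance of Lebesgue measure the varied action can be written in
coordinates that travel with the parcels (`extAction_shift`). There `Q`, `L` and `Γ` stay put, `v`
gains `ε` times the derivative of `δz`, and `p`, `z̃`, `H`, `A` are displaced. Differentiate at `ε =
0` and split `δp·ẋ = (δp·ẋ - δx·ṗ) + δx·ṗ`. What remains is the conjugate of `δz` paired with the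
labelled mean of the residual of the extended Hamilton equations, plus the time derivative of `δx·⟨L
p Q⟩`; indeed `⟨L z_i Q⟩` changes at the rate `⟨L v_i Q⟩`, by the continuity equation and the
transport of the label. The second part integrates to zero. The outcome is
`IsLabel.hasDerivAt_extAction`, from which the equations imply the principle.

Converse. If the residual is nonzero at a point, it keeps its sign nearby, and a nonnegative label
concentrated there gives a nonzero first variation. Such a label is a bump function composed with a
local first integral of the flow. The field is only continuous in time and `C¹` in space, and the
first integral must be jointly `C¹`; it comes from the implicit function theorem in the Banach space
of curves, applied to the integral equation of the trajectory (`exists_local_first_integral`).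

Liouville equation. The gauge fluxes are divergence-free by antisymmetry and by symmetry of second
derivatives. In the divergence of the remaining flux the second derivatives of `H` cancel, and one
Poisson factor acting on the sinc series is left. This is the star commutator: exchanging the
arguments multiplies the `k`-th Poisson power by `(-1)^k`, so that only the sine part of the
exponential survives. For `Q > 0` the velocity is the flux divided by `Q`.

Husimi transform. The operation `⊙` on Husimi transforms reproduces the Husimi transform of the
ordinary product. At the origin this is an expansion of the inner product of `L²` of the Gaussian
measure into bounded positive forms. It is checked on exponentials, where it is the exponential
series, and extended by density (`hasSum_inner_of_dense_span`). Hence the Husimi transform carries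
the Liouville field to its Husimi counterpart, and injectivity of the transform yields the
equivalence. -/

lemma pd_shift (i : PhaseIdx N) (f : Phase N → ℝ) (u : Phase N) :
    pd i (fun y => f (y + u)) = fun z => pd i f (z + u) := by
  funext z
  simp only [pd]
  rw [fderiv_comp_add_right]

lemma pdList_nil (f : Phase N → ℝ) : pdList [] f = f := rfl

lemma pdList_cons (i : PhaseIdx N) (α : List (PhaseIdx N)) (f : Phase N → ℝ) :
    pdList (i :: α) f = pd i (pdList α f) := rfl

lemma pdList_singleton (i : PhaseIdx N) (f : Phase N → ℝ) : pdList [i] f = pd i f := rfl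

lemma pdList_append (α β : List (PhaseIdx N)) (f : Phase N → ℝ) :
    pdList (α ++ β) f = pdList α (pdList β f) := by
  simp [pdList, List.foldr_append]

lemma pdList_shift (α : List (PhaseIdx N)) (f : Phase N → ℝ) (u : Phase N) :
    pdList α (fun y => f (y + u)) = fun z => pdList α f (z + u) := by
  induction α with
  | nil => rfl
  | cons i α ih => rw [pdList_cons, ih, pd_shift, pdList_cons]

lemma contDiff_pd {f : Phase N → ℝ} (hf : ContDiff ℝ ∞ f) (i : PhaseIdx N) :
    ContDiff ℝ ∞ (pd i f) := by
  have h : ContDiff ℝ ∞ (fderiv ℝ f) := hf.fderiv_right (by simp)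
  exact h.clm_apply contDiff_const

lemma contDiff_pdList {f : Phase N → ℝ} (hf : ContDiff ℝ ∞ f) (α : List (PhaseIdx N)) :
    ContDiff ℝ ∞ (pdList α f) := by
  induction α with
  | nil => exact hf
  | cons i α ih => exact contDiff_pd ih i

/-- Second derivatives commute where the function is twice differentiable. -/
lemma pd_comm_of_twice {f : Phase N → ℝ} {z : Phase N}
    (hf : Differentiable ℝ f) (hf' : DifferentiableAt ℝ (fderiv ℝ f) z) (i j : PhaseIdx N) :
    pd i (pd j f) z = pd j (pd i f) z := by
  have key := second_derivative_symmetric (f := f) (f' := fderiv ℝ f)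
    (f'' := fderiv ℝ (fderiv ℝ f) z) (x := z) (fun y => (hf y).hasFDerivAt) hf'.hasFDerivAt
  have h : ∀ i j : PhaseIdx N, pd i (pd j f) z
      = fderiv ℝ (fderiv ℝ f) z (Pi.single i 1) (Pi.single j 1) := by
    intro i j
    have : HasFDerivAt (pd j f)
        ((ContinuousLinearMap.apply ℝ ℝ (Pi.single j (1 : ℝ) : Phase N)).comp
          (fderiv ℝ (fderiv ℝ f) z)) z :=
      (ContinuousLinearMap.apply ℝ ℝ (Pi.single j (1 : ℝ) : Phase N)).hasFDerivAt.comp z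
        hf'.hasFDerivAt
    change fderiv ℝ (pd j f) z (Pi.single i 1) = _
    rw [this.fderiv]
    rfl
  rw [h, h, key]

lemma pd_comm {f : Phase N → ℝ} (hf : ContDiff ℝ ∞ f) (i j : PhaseIdx N) :
    pd i (pd j f) = pd j (pd i f) := by
  funext z
  exact pd_comm_of_twice (hf.differentiable (by simp))
    ((hf.fderiv_right (m := ∞) (by simp)).differentiable (by simp) z) i j

lemma pd_pdList {f : Phase N → ℝ} (hf : ContDiff ℝ ∞ f) (i : PhaseIdx N)
    (α : List (PhaseIdx N)) : pd i (pdList α f) = pdList α (pd i f) := by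
  induction α with
  | nil => rfl
  | cons j α ih => rw [pdList_cons, pd_comm (contDiff_pdList hf α), ih, pdList_cons]

lemma pd_neg (i : PhaseIdx N) (f : Phase N → ℝ) : pd i (fun y => -f y) = fun z => -pd i f z := by
  funext z
  simp [pd, fderiv_fun_neg]

lemma pd_mul {f g : Phase N → ℝ} {z : Phase N} (hf : DifferentiableAt ℝ f z)
    (hg : DifferentiableAt ℝ g z) (i : PhaseIdx N) :
    pd i (fun y => f y * g y) z = pd i f z * g z + f z * pd i g z := by
  simp [pd, fderiv_fun_mul hf hg]
  ring

lemma pd_add {f g : Phase N → ℝ} {z : Phase N} (hf : DifferentiableAt ℝ f z)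
    (hg : DifferentiableAt ℝ g z) (i : PhaseIdx N) :
    pd i (fun y => f y + g y) z = pd i f z + pd i g z := by
  simp [pd, fderiv_fun_add hf hg]

lemma pd_sub {f g : Phase N → ℝ} {z : Phase N} (hf : DifferentiableAt ℝ f z)
    (hg : DifferentiableAt ℝ g z) (i : PhaseIdx N) :
    pd i (fun y => f y - g y) z = pd i f z - pd i g z := by
  simp [pd, fderiv_fun_sub hf hg]

lemma pd_sum {ι : Type*} (s : Finset ι) {f : ι → Phase N → ℝ} {z : Phase N}
    (hf : ∀ k ∈ s, DifferentiableAt ℝ (f k) z) (i : PhaseIdx N) :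
    pd i (fun y => ∑ k ∈ s, f k y) z = ∑ k ∈ s, pd i (f k) z := by
  simp [pd, fderiv_fun_sum hf]

lemma pd_const_mul {f : Phase N → ℝ} {z : Phase N} (hf : DifferentiableAt ℝ f z) (c : ℝ)
    (i : PhaseIdx N) : pd i (fun y => c * f y) z = c * pd i f z := by
  simp [pd, fderiv_const_mul hf]

lemma sum_smul_single (x : Phase N) : ∑ i, x i • (Pi.single i 1 : Phase N) = x := by
  funext j
  simp [Finset.sum_apply, Pi.single_apply]

lemma fderiv_eq_sum_pd (f : Phase N → ℝ) (z δ : Phase N) :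
    fderiv ℝ f z δ = ∑ i, δ i * pd i f z := by
  conv_lhs => rw [← sum_smul_single δ]
  simp [map_sum, pd]

lemma fderiv_eq_sum_proj (f : Phase N → ℝ) (z : Phase N) :
    fderiv ℝ f z
      = ∑ i, pd i f z • (ContinuousLinearMap.proj i : Phase N →L[ℝ] ℝ) := by
  ext1 δ
  rw [fderiv_eq_sum_pd]
  simp [mul_comm]

lemma hasDerivAt_line {f : Phase N → ℝ} {z δ : Phase N} {ε : ℝ}
    (hf : DifferentiableAt ℝ f (z + ε • δ)) :
    HasDerivAt (fun e : ℝ => f (z + e • δ)) (∑ i, δ i * pd i f (z + ε • δ)) ε := by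
  rw [← fderiv_eq_sum_pd]
  have h1 : HasDerivAt (fun e : ℝ => z + e • δ) δ ε := by
    simpa using ((hasDerivAt_id ε).smul_const δ).const_add z
  exact hf.hasFDerivAt.comp_hasDerivAt ε h1

/-- Iterated partial derivatives are components of the iterated derivative. -/
lemma pdList_eq_iteratedFDeriv {f : Phase N → ℝ} (hf : ContDiff ℝ ∞ f)
    (α : List (PhaseIdx N)) (z : Phase N) :
    pdList α f z = iteratedFDeriv ℝ α.length f z
      (fun k => Pi.single (α.get k) 1) := by
  induction α generalizing z with
  | nil => simp [pdList_nil]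
  | cons i α ih =>
    rw [pdList_cons]
    have h : pdList α f = fun z => iteratedFDeriv ℝ α.length f z
      (fun k => Pi.single (α.get k) 1) := funext ih
    have hd : DifferentiableAt ℝ (iteratedFDeriv ℝ α.length f) z :=
      (hf.differentiable_iteratedFDeriv (by exact_mod_cast WithTop.coe_lt_top _)) z
    have h2 : HasFDerivAt (fun z => iteratedFDeriv ℝ α.length f z
        (fun k => (Pi.single (α.get k) 1 : Phase N)))
        ((ContinuousMultilinearMap.apply ℝ (fun _ : Fin α.length => Phase N) ℝ
          (fun k => (Pi.single (α.get k) 1 : Phase N))).comp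
            (fderiv ℝ (iteratedFDeriv ℝ α.length f) z)) z :=
      (ContinuousMultilinearMap.apply ℝ (fun _ : Fin α.length => Phase N) ℝ
          (fun k => (Pi.single (α.get k) 1 : Phase N))).hasFDerivAt.comp z hd.hasFDerivAt
    unfold pd
    rw [h, h2.fderiv]
    change _ = iteratedFDeriv ℝ (α.length + 1) f z _
    rw [iteratedFDeriv_succ_apply_left]
    rfl

/-- The scalar form of the joint continuity of the derivatives. With the empty list it is the joint
continuity of `Q` itself. -/
lemma IsState.continuousOn_pdList {J : Set ℝ} {Q : ℝ → Phase N → ℝ} (hQ : IsState J Q)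
    (α : List (PhaseIdx N)) :
    ContinuousOn (fun q : ℝ × Phase N => pdList α (Q q.1) q.2) (J ×ˢ univ) := by
  have h := (ContinuousMultilinearMap.apply ℝ (fun _ : Fin α.length => Phase N) ℝ
      (fun k => (Pi.single (α.get k) 1 : Phase N))).continuous.comp_continuousOn (hQ.2.1 α.length)
  refine h.congr ?_
  rintro ⟨t, z⟩ ⟨ht, -⟩
  exact pdList_eq_iteratedFDeriv (hQ.1 t ht) α z

end PartialDerivatives

/-! ### Bidifferential operations as finite sums -/

/-- A bidifferential operation that is a finite sum of products of iterated partial derivatives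
with constant coefficients. -/
def IsBidiff (B : BiOp N) : Prop :=
  ∃ (σ : Type) (_ : Fintype σ) (c : σ → ℝ) (α β : σ → List (PhaseIdx N)),
    ∀ f g z, B f g z = ∑ s, c s * (pdList (α s) f z * pdList (β s) g z)

namespace IsBidiff

variable {B B' : BiOp N}

lemma mul : IsBidiff (fun f g z => f z * g z : BiOp N) :=
  ⟨Unit, inferInstance, fun _ => 1, fun _ => [], fun _ => [], by simp [pdList_nil]⟩

lemma comp_pd (h : IsBidiff B) (i j : PhaseIdx N) : IsBidiff (fun f g => B (pd i f) (pd j g)) := by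
  obtain ⟨σ, _, c, α, β, h⟩ := h
  -- The derivative applied first stands at the end of the list, so a derivative of the argument is
  -- appended on the right.
  exact ⟨σ, inferInstance, c, fun s => α s ++ [i], fun s => β s ++ [j], by
    simp [pdList_append, pdList_singleton, h]⟩

lemma const_mul (h : IsBidiff B) (a : ℝ) : IsBidiff (fun f g z => a * B f g z) := by
  obtain ⟨σ, _, c, α, β, h⟩ := h
  exact ⟨σ, inferInstance, fun s => a * c s, α, β, by
    intro f g z; simp only [h, Finset.mul_sum, mul_assoc]⟩

lemma sum {ι : Type} [Fintype ι] {B : ι → BiOp N} (h : ∀ i, IsBidiff (B i)) :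
    IsBidiff (fun f g z => ∑ i, B i f g z) := by
  choose σ hσ c α β h using h
  refine ⟨Σ i, σ i, inferInstance, fun s => c s.1 s.2, fun s => α s.1 s.2, fun s => β s.1 s.2, ?_⟩
  intro f g z
  rw [Fintype.sum_sigma]
  exact Finset.sum_congr rfl fun i _ => h i f g z

lemma add (h : IsBidiff B) (h' : IsBidiff B') : IsBidiff (fun f g z => B f g z + B' f g z) := by
  have := sum (ι := Bool) (B := fun b => if b then B else B') (by rintro (_ | _) <;> simpa)
  simpa using this

lemma sub (h : IsBidiff B) (h' : IsBidiff B') : IsBidiff (fun f g z => B f g z - B' f g z) := by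
  simpa [sub_eq_add_neg] using h.add (h'.const_mul (-1))

lemma poissonStep (h : IsBidiff B) : IsBidiff (poissonStep B) :=
  sum fun n => (h.comp_pd (Sum.inl n) (Sum.inr n)).sub (h.comp_pd (Sum.inr n) (Sum.inl n))

lemma husimiStep (h : IsBidiff B) (w : PhaseIdx N → ℝ) : IsBidiff (husimiStep w B) :=
  sum fun i => (h.comp_pd i i).const_mul (w i ^ 2)

/-- Constant coefficients make the operation translation invariant. This is what moves a translation
of `Q` to the opposite translation of `H`. -/
lemma shift (h : IsBidiff B) (f g : Phase N → ℝ) (u z : Phase N) :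
    B f g (z + u) = B (fun y => f (y + u)) (fun y => g (y + u)) z := by
  obtain ⟨σ, _, c, α, β, h⟩ := h
  simp [h, pdList_shift]

lemma contDiff (h : IsBidiff B) {f g : Phase N → ℝ} (hf : ContDiff ℝ ∞ f) (hg : ContDiff ℝ ∞ g) :
    ContDiff ℝ ∞ (B f g) := by
  obtain ⟨σ, _, c, α, β, h⟩ := h
  have : B f g = fun z => ∑ s, c s * (pdList (α s) f z * pdList (β s) g z) := funext (h f g)
  rw [this]
  exact ContDiff.sum fun s _ =>
    contDiff_const.mul ((contDiff_pdList hf _).mul (contDiff_pdList hg _))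

/-- The Leibniz rule; since partial derivatives commute, the new derivative can be absorbed into the
arguments. -/
lemma pd_apply (h : IsBidiff B) {f g : Phase N → ℝ} (hf : ContDiff ℝ ∞ f)
    (hg : ContDiff ℝ ∞ g) (i : PhaseIdx N) (z : Phase N) :
    pd i (B f g) z = B (pd i f) g z + B f (pd i g) z := by
  obtain ⟨σ, _, c, α, β, h⟩ := h
  have : B f g = fun z => ∑ s, c s * (pdList (α s) f z * pdList (β s) g z) := funext (h f g)
  have df : ∀ s, DifferentiableAt ℝ (pdList (α s) f) z := fun s =>
    (contDiff_pdList hf _).differentiable (by simp) z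
  have dg : ∀ s, DifferentiableAt ℝ (pdList (β s) g) z := fun s =>
    (contDiff_pdList hg _).differentiable (by simp) z
  rw [this, pd_sum Finset.univ (f := fun s y => c s * (pdList (α s) f y * pdList (β s) g y))
    (fun s _ => ((df s).mul (dg s)).const_mul _), h, h, ← Finset.sum_add_distrib]
  refine Finset.sum_congr rfl fun s _ => ?_
  rw [pd_const_mul (f := fun y => pdList (α s) f y * pdList (β s) g y) ((df s).mul (dg s)),
    pd_mul (df s) (dg s), pd_pdList hf, pd_pdList hg]
  ring

/-- Only the left argument moves, so the derivative never falls on `g`. In the variation this is the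
reason for `∂G ⊙ Q` and not the full derivative of `G ⊙ Q`. -/
lemma hasDerivAt_shift (h : IsBidiff B) {f : Phase N → ℝ} (hf : ContDiff ℝ ∞ f)
    (g : Phase N → ℝ) (z δ : Phase N) (ε : ℝ) :
    HasDerivAt (fun e : ℝ => B (fun y => f (y + e • δ)) g z)
      (∑ i, δ i * B (fun y => pd i f (y + ε • δ)) g z) ε := by
  obtain ⟨σ, _, c, α, β, h⟩ := h
  simp only [h, pdList_shift]
  have : ∀ s ∈ Finset.univ, HasDerivAt (fun e : ℝ => c s * (pdList (α s) f (z + e • δ)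
      * pdList (β s) g z)) (c s * ((∑ i, δ i * pd i (pdList (α s) f) (z + ε • δ))
      * pdList (β s) g z)) ε := fun s _ =>
    ((hasDerivAt_line ((contDiff_pdList hf _).differentiable (by simp) _)).mul_const _).const_mul _
  convert! HasDerivAt.fun_sum this using 1
  simp only [pd_pdList hf, Finset.mul_sum, Finset.sum_mul]
  rw [Finset.sum_comm]
  refine Finset.sum_congr rfl fun s _ => Finset.sum_congr rfl fun i _ => ?_
  ring

lemma continuousOn (h : IsBidiff B) {f : Phase N → ℝ} (hf : ContDiff ℝ ∞ f) {J : Set ℝ}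
    {Q : ℝ → Phase N → ℝ} (hQ : IsState J Q) (β : List (PhaseIdx N)) :
    ContinuousOn (fun q : Phase N × ℝ × Phase N =>
      B (fun y => f (y + q.1)) (pdList β (Q q.2.1)) q.2.2) (univ ×ˢ J ×ˢ univ) := by
  obtain ⟨σ, _, c, α, β', h⟩ := h
  simp only [h, pdList_shift, ← pdList_append]
  refine continuousOn_finsetSum _ fun s _ => continuousOn_const.mul (ContinuousOn.mul ?_ ?_)
  · have := (contDiff_pdList hf (α s)).continuous
    exact Continuous.continuousOn (by fun_prop)
  · exact (hQ.continuousOn_pdList (β' s ++ β)).comp (by fun_prop) (fun q hq => hq.2)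

lemma neg_left (h : IsBidiff B) (f g : Phase N → ℝ) (z : Phase N) :
    B (fun y => -f y) g z = -B f g z := by
  have hn : ∀ α : List (PhaseIdx N), pdList α (fun y => -f y) = fun z => -pdList α f z := by
    intro α
    induction α with
    | nil => rfl
    | cons i α ih => rw [pdList_cons, ih, pd_neg, pdList_cons]
  obtain ⟨σ, _, c, α, β, h⟩ := h
  simp [h, hn]

end IsBidiff

lemma isBidiff_husimiPow (w : PhaseIdx N → ℝ) (m : ℕ) :
    IsBidiff ((husimiStep w)^[m] (fun f g z => f z * g z)) := by
  induction m with
  | zero => exact IsBidiff.mul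
  | succ m ih => rw [Function.iterate_succ_apply']; exact ih.husimiStep w

lemma isBidiff_biTerm (w : PhaseIdx N → ℝ) (k m : ℕ) : IsBidiff (biTerm w k m) := by
  induction k with
  | zero => exact isBidiff_husimiPow w m
  | succ k ih =>
    unfold biTerm at *
    rw [Function.iterate_succ_apply']; exact ih.poissonStep

lemma biTerm_succ (w : PhaseIdx N → ℝ) (k m : ℕ) :
    biTerm w (k + 1) m = poissonStep (biTerm w k m) := by
  simp only [biTerm, Function.iterate_succ_apply']

lemma poissonPow_succ (k : ℕ) : (poissonPow (k + 1) : BiOp N) = poissonStep (poissonPow k) := by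
  simp only [poissonPow, Function.iterate_succ_apply']

lemma husimiPow_symm (w : PhaseIdx N → ℝ) (m : ℕ) (f g : Phase N → ℝ) (z : Phase N) :
    (husimiStep w)^[m] (fun f g z => f z * g z) f g z
      = (husimiStep w)^[m] (fun f g z => f z * g z) g f z := by
  induction m generalizing f g with
  | zero => exact mul_comm _ _
  | succ m ih =>
    simp only [Function.iterate_succ_apply']
    exact Finset.sum_congr rfl fun i _ => by rw [ih]

/-- Every Poisson factor is antisymmetric and every Husimi factor symmetric. This parity singles out
the odd part in star commutators. -/
lemma biTerm_swap (w : PhaseIdx N → ℝ) (k m : ℕ) (f g : Phase N → ℝ) (z : Phase N) :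
    biTerm w k m g f z = (-1) ^ k * biTerm w k m f g z := by
  induction k generalizing f g with
  | zero => simpa [biTerm] using husimiPow_symm w m g f z
  | succ k ih =>
    simp only [biTerm_succ, poissonStep, Finset.mul_sum]
    refine Finset.sum_congr rfl fun n _ => ?_
    rw [ih (pd (Sum.inr n) f), ih (pd (Sum.inl n) f)]
    ring

lemma poissonPow_eq_biTerm (w : PhaseIdx N → ℝ) (k : ℕ) :
    (poissonPow k : BiOp N) = biTerm w k 0 := rfl

/-! ### The series defining the Hamilton generator -/

section Series

/-- In the quantum case this is `1 / (k + 1)! ≤ 1 / k!`; it lets the majorants of the exponential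
series control the sinc series. -/
lemma abs_genCoeff_le (M : Mechanics) {ħ : ℝ} (hħ : 0 < ħ) (k : ℕ) :
    |genCoeff M ħ k| ≤ majCoeff M ħ k := by
  cases M with
  | classical => simp only [genCoeff, majCoeff]; split_ifs <;> simp
  | quantum =>
    simp only [genCoeff, majCoeff]
    split_ifs
    · rw [abs_div, abs_mul, abs_pow, abs_neg, abs_one, one_pow, one_mul, Nat.abs_cast,
        abs_of_nonneg (by positivity)]
      gcongr
      omega
    · simp; positivity

variable {M : Mechanics} {ħ : ℝ} {w : PhaseIdx N → ℝ} {J : Set ℝ} {H : Phase N → ℝ}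
  {Q : ℝ → Phase N → ℝ}

/-- The terms of the series for `hamGen`. -/
def genTerm (M : Mechanics) (ħ : ℝ) (w : PhaseIdx N → ℝ) (f g : Phase N → ℝ) (z : Phase N)
    (km : ℕ × ℕ) : ℝ :=
  genCoeff M ħ km.1 / (km.2.factorial : ℝ) * biTerm w km.1 km.2 f g z

lemma hamGen_eq_tsum (f g : Phase N → ℝ) (z : Phase N) :
    hamGen M ħ w f g z = ∑' km, genTerm M ħ w f g z km := rfl

lemma hamGen_shift (f g : Phase N → ℝ) (u z : Phase N) :
    hamGen M ħ w f g (z + u) = hamGen M ħ w (fun y => f (y + u)) (fun y => g (y + u)) z := by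
  simp only [hamGen, (isBidiff_biTerm w _ _).shift]

lemma hamGen_neg_left (f g : Phase N → ℝ) (z : Phase N) :
    hamGen M ħ w (fun y => -f y) g z = -hamGen M ħ w f g z := by
  simp only [hamGen, (isBidiff_biTerm w _ _).neg_left, mul_neg, tsum_neg]

lemma SeriesConverge.exists_bound (hħ : 0 < ħ) (hHQ : SeriesConverge M ħ w J H Q)
    {α β : List (PhaseIdx N)} (hα : α.length ≤ 2) (hβ : β.length ≤ 1) {C : Set (ℝ × Phase N)}
    (hC : IsCompact C) (hCJ : C ⊆ J ×ˢ univ) :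
    ∃ ρ : ℝ, 0 < ρ ∧ ∃ b : ℕ × ℕ → ℝ, Summable b ∧
      ∀ t z, (t, z) ∈ C → ∀ u : Phase N, ‖u‖ ≤ ρ → ∀ km,
        |genTerm M ħ w (fun y => pdList α H (y + u)) (pdList β (Q t)) z km| ≤ b km := by
  obtain ⟨ρ, hρ, b, hb, h⟩ := hHQ α β hα hβ C hC hCJ
  refine ⟨ρ, hρ, b, hb, fun t z htz u hu km => le_trans ?_ (h t z htz u hu km.1 km.2)⟩
  rw [pdList_shift, genTerm, abs_mul, abs_div, Nat.abs_cast]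
  gcongr
  exact abs_genCoeff_le M hħ _

lemma SeriesConverge.summable (hħ : 0 < ħ) (hHQ : SeriesConverge M ħ w J H Q)
    {α β : List (PhaseIdx N)} (hα : α.length ≤ 2) (hβ : β.length ≤ 1) {t : ℝ} (ht : t ∈ J)
    (z : Phase N) : Summable (genTerm M ħ w (pdList α H) (pdList β (Q t)) z) := by
  obtain ⟨ρ, hρ, b, hb, h⟩ := hHQ.exists_bound hħ hα hβ (isCompact_singleton (x := (t, z)))
    (by simpa using ht)
  refine Summable.of_norm_bounded hb fun km => ?_
  simpa using h t z rfl 0 (by simpa using hρ.le) km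

lemma SeriesConverge.continuousOn_shift (hħ : 0 < ħ) (hH : ContDiff ℝ ∞ H) (hQ : IsState J Q)
    (hHQ : SeriesConverge M ħ w J H Q)
    {α β : List (PhaseIdx N)} (hα : α.length ≤ 2) (hβ : β.length ≤ 1) {C : Set (ℝ × Phase N)}
    (hC : IsCompact C) (hCJ : C ⊆ J ×ˢ univ) :
    ∃ ρ : ℝ, 0 < ρ ∧ ContinuousOn (fun q : Phase N × ℝ × Phase N =>
      hamGen M ħ w (fun y => pdList α H (y + q.1)) (pdList β (Q q.2.1)) q.2.2)
      (Metric.closedBall 0 ρ ×ˢ C) := by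
  obtain ⟨ρ, hρ, b, hb, h⟩ := hHQ.exists_bound hħ hα hβ hC hCJ
  refine ⟨ρ, hρ, ?_⟩
  simp only [hamGen_eq_tsum]
  refine continuousOn_tsum (fun km => ?_) hb fun km q hq =>
    h q.2.1 q.2.2 hq.2 q.1 (by simpa using hq.1) km
  exact continuousOn_const.mul (((isBidiff_biTerm w _ _).continuousOn
    (contDiff_pdList hH α) hQ β).mono (prod_mono (subset_univ _) hCJ))

lemma SeriesConverge.continuousOn (hħ : 0 < ħ) (hJ : IsOpen J) (hH : ContDiff ℝ ∞ H)
    (hQ : IsState J Q) (hHQ : SeriesConverge M ħ w J H Q)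
    {α β : List (PhaseIdx N)} (hα : α.length ≤ 2) (hβ : β.length ≤ 1) :
    ContinuousOn (fun q : ℝ × Phase N => hamGen M ħ w (pdList α H) (pdList β (Q q.1)) q.2)
      (J ×ˢ univ) := by
  intro q hq
  obtain ⟨C, hCq, hCJ, hC⟩ := local_compact_nhds
    ((hJ.prod isOpen_univ).mem_nhds hq)
  obtain ⟨ρ, hρ, h⟩ := hHQ.continuousOn_shift hħ hH hQ hα hβ hC hCJ
  have h2 : ContinuousOn (fun q : ℝ × Phase N => hamGen M ħ w (pdList α H) (pdList β (Q q.1)) q.2)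
      C := by
    have := h.comp (g := fun q : Phase N × ℝ × Phase N =>
      hamGen M ħ w (fun y => pdList α H (y + q.1)) (pdList β (Q q.2.1)) q.2.2)
      (f := fun q : ℝ × Phase N => ((0 : Phase N), q)) (s := C) (by fun_prop)
      (fun q hq => ⟨by simpa using hρ.le, hq⟩)
    simpa [Function.comp_def] using this
  exact (h2.continuousAt hCq).continuousWithinAt

lemma norm_le_sum_abs_single (ℓ : Phase N →L[ℝ] ℝ) : ‖ℓ‖ ≤ ∑ j, |ℓ (Pi.single j 1)| := by
  refine ℓ.opNorm_le_bound (by positivity) fun x => ?_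
  conv_lhs => rw [← sum_smul_single x]
  rw [map_sum, Finset.sum_mul]
  refine (norm_sum_le _ _).trans (Finset.sum_le_sum fun j _ => ?_)
  rw [map_smul, norm_smul, mul_comm, Real.norm_eq_abs (ℓ _)]
  gcongr
  exact norm_le_pi_norm x j

lemma IsBidiff.hasFDerivAt {B : BiOp N} (h : IsBidiff B) {f g : Phase N → ℝ}
    (hf : ContDiff ℝ ∞ f) (hg : ContDiff ℝ ∞ g) (z : Phase N) :
    HasFDerivAt (B f g) (∑ j, (B (pd j f) g z + B f (pd j g) z) •
      (ContinuousLinearMap.proj j : Phase N →L[ℝ] ℝ)) z := by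
  have := ((h.contDiff hf hg).differentiable (by simp) z).hasFDerivAt
  rw [fderiv_eq_sum_proj] at this
  simpa only [h.pd_apply hf hg] using this

/-- Term-by-term differentiation: each differentiated term has one more derivative on `H` or one on
`Q`, and on a ball around `z` both resulting series have summable majorants. The bounds 2 and 1 on
the orders in `SeriesConverge` are what is needed for `∂H` and `Q` here. -/
lemma SeriesConverge.hasFDerivAt (hħ : 0 < ħ) (hH : ContDiff ℝ ∞ H)
    (hQ : IsState J Q) (hHQ : SeriesConverge M ħ w J H Q) {α : List (PhaseIdx N)}
    (hα : α.length ≤ 1) {t : ℝ} (ht : t ∈ J) (z : Phase N) :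
    HasFDerivAt (hamGen M ħ w (pdList α H) (Q t))
      (∑ j, (hamGen M ħ w (pd j (pdList α H)) (Q t) z + hamGen M ħ w (pdList α H) (pd j (Q t)) z) •
        (ContinuousLinearMap.proj j : Phase N →L[ℝ] ℝ)) z := by
  have hC : IsCompact ({t} ×ˢ Metric.closedBall z 1 : Set (ℝ × Phase N)) :=
    isCompact_singleton.prod (isCompact_closedBall z 1)
  have hCJ : ({t} ×ˢ Metric.closedBall z 1 : Set (ℝ × Phase N)) ⊆ J ×ˢ univ := by
    rintro ⟨s, y⟩ ⟨hs, -⟩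
    simp only [mem_singleton_iff] at hs
    simp [hs, ht]
  have e1 := fun j : PhaseIdx N => hHQ.exists_bound hħ (α := j :: α) (β := [])
    (by simpa using hα) (by simp) hC hCJ
  have e2 := fun j : PhaseIdx N => hHQ.exists_bound hħ (α := α) (β := [j])
    (by omega) (by simp) hC hCJ
  choose ρ₁ hρ₁ b₁ hb₁ h₁ using e1
  choose ρ₂ hρ₂ b₂ hb₂ h₂ using e2
  set f' : ℕ × ℕ → Phase N → Phase N →L[ℝ] ℝ := fun km y =>
    ∑ j, (genTerm M ħ w (pd j (pdList α H)) (Q t) y km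
      + genTerm M ħ w (pdList α H) (pd j (Q t)) y km) •
        (ContinuousLinearMap.proj j : Phase N →L[ℝ] ℝ) with hf'
  have hder : ∀ km, ∀ y ∈ Metric.ball z 1,
      HasFDerivAt (fun y => genTerm M ħ w (pdList α H) (Q t) y km) (f' km y) y := by
    intro km y _
    have := ((isBidiff_biTerm w km.1 km.2).hasFDerivAt (contDiff_pdList hH α)
      (hQ.1 t ht) y).const_mul (genCoeff M ħ km.1 / (km.2.factorial : ℝ))
    refine this.congr_fderiv ?_
    simp only [hf', Finset.smul_sum, smul_smul, genTerm, mul_add]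
  have hbound : ∀ km, ∀ y ∈ Metric.ball z 1, ‖f' km y‖ ≤ ∑ j, (b₁ j km + b₂ j km) := by
    intro km y hy
    refine (norm_le_sum_abs_single _).trans (Finset.sum_le_sum fun j _ => ?_)
    have hmem : (t, y) ∈ ({t} ×ˢ Metric.closedBall z 1 : Set (ℝ × Phase N)) :=
      ⟨rfl, Metric.ball_subset_closedBall hy⟩
    have a1 := h₁ j t y hmem 0 (by simpa using (hρ₁ j).le) km
    have a2 := h₂ j t y hmem 0 (by simpa using (hρ₂ j).le) km
    simp only [add_zero, pdList_cons, pdList_nil] at a1 a2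
    have : f' km y (Pi.single j 1) = genTerm M ħ w (pd j (pdList α H)) (Q t) y km
      + genTerm M ħ w (pdList α H) (pd j (Q t)) y km := by
      simp [hf', Pi.single_apply, -Fintype.sum_sum_type]
    rw [this]
    exact (abs_add_le _ _).trans (add_le_add a1 a2)
  have key := hasFDerivAt_tsum_of_isPreconnected
    (summable_sum fun j (_ : j ∈ Finset.univ) => (hb₁ j).add (hb₂ j)) Metric.isOpen_ball
    (convex_ball z 1).isPreconnected hder hbound (Metric.mem_ball_self one_pos)
    (hHQ.summable hħ (α := α) (β := []) (by omega) (by simp) ht z)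
    (Metric.mem_ball_self one_pos)
  refine key.congr_fderiv (HasSum.tsum_eq (hasSum_sum fun j _ =>
    HasSum.smul_const (HasSum.add ?_ ?_) _))
  · exact (hHQ.summable hħ (α := j :: α) (β := []) (by simpa using hα) (by simp) ht z).hasSum
  · exact (hHQ.summable hħ (α := α) (β := [j]) (by omega) (by simp) ht z).hasSum

/-- The convergence hypothesis admits small translations of `H` against `Q`; that makes the series
differentiable in the translation parameter, with one radius for the whole compact set. -/
lemma SeriesConverge.hasDerivAt_shift (hħ : 0 < ħ) (hH : ContDiff ℝ ∞ H)
    (hHQ : SeriesConverge M ħ w J H Q) {C : Set (ℝ × Phase N)}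
    (hC : IsCompact C) (hCJ : C ⊆ J ×ˢ univ) :
    ∃ ρ : ℝ, 0 < ρ ∧ ∀ t z, (t, z) ∈ C → ∀ (δ : Phase N) (ε : ℝ), |ε| * ‖δ‖ < ρ →
      HasDerivAt (fun e : ℝ => hamGen M ħ w (fun y => H (y + e • δ)) (Q t) z)
        (∑ i, δ i * hamGen M ħ w (fun y => pd i H (y + ε • δ)) (Q t) z) ε := by
  obtain ⟨ρ₀, hρ₀, b₀, hb₀, h₀⟩ := hHQ.exists_bound hħ (α := []) (β := []) (by simp) (by simp) hC hCJ
  have e1 := fun j : PhaseIdx N => hHQ.exists_bound hħ (α := [j]) (β := [])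
    (by simp) (by simp) hC hCJ
  choose ρ₁ hρ₁ b₁ hb₁ h₁ using e1
  obtain ⟨ρ, hρ, hρ0, hρj⟩ : ∃ ρ : ℝ, 0 < ρ ∧ ρ ≤ ρ₀ ∧ ∀ j, ρ ≤ ρ₁ j := by
    -- Inserting `ρ₀` keeps the finite set nonempty even without coordinates.
    refine ⟨(insert ρ₀ (Finset.univ.image ρ₁)).min' (by simp), ?_, ?_, fun j => ?_⟩
    · rw [Finset.lt_min'_iff]
      intro y hy
      rcases Finset.mem_insert.1 hy with rfl | hy
      · exact hρ₀
      · obtain ⟨j, -, rfl⟩ := Finset.mem_image.1 hy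
        exact hρ₁ j
    · exact Finset.min'_le _ _ (by simp)
    · exact Finset.min'_le _ _ (by simp)
  refine ⟨ρ, hρ, fun t z htz δ ε hε => ?_⟩
  -- The parameters whose translation stays below the radius form an open interval (the whole line
  -- if `δ = 0`), hence a connected domain for differentiating the series.
  set U : Set ℝ := {e | |e| * ‖δ‖ < ρ} with hU
  have hUo : IsOpen U := isOpen_lt (by fun_prop) continuous_const
  have hUc : IsPreconnected U := by
    refine Convex.isPreconnected ?_
    have : ConvexOn ℝ univ (fun e : ℝ => |e| * ‖δ‖) := by
      have := (convexOn_univ_norm (E := ℝ)).smul (norm_nonneg δ)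
      simpa [mul_comm] using this
    simpa [hU] using this.convex_lt ρ
  have hnorm : ∀ e ∈ U, ‖e • δ‖ < ρ := fun e he => by
    rw [norm_smul]; exact he
  set f' : ℕ × ℕ → ℝ → ℝ := fun km e =>
    ∑ i, δ i * genTerm M ħ w (fun y => pd i H (y + e • δ)) (Q t) z km with hf'
  have hder : ∀ km, ∀ e ∈ U,
      HasDerivAt (fun e : ℝ => genTerm M ħ w (fun y => H (y + e • δ)) (Q t) z km) (f' km e) e := by
    intro km e _
    have := ((isBidiff_biTerm w km.1 km.2).hasDerivAt_shift hH (Q t) z δ e).const_mul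
      (genCoeff M ħ km.1 / (km.2.factorial : ℝ))
    refine this.congr_deriv ?_
    simp only [hf', Finset.mul_sum, genTerm]
    exact Finset.sum_congr rfl fun i _ => by ring
  have hb : ∀ km, ∀ e ∈ U, ‖f' km e‖ ≤ ∑ i, |δ i| * b₁ i km := by
    intro km e he
    refine (norm_sum_le _ _).trans (Finset.sum_le_sum fun i _ => ?_)
    rw [norm_mul, Real.norm_eq_abs, Real.norm_eq_abs]
    exact mul_le_mul_of_nonneg_left (h₁ i t z htz _ ((hnorm e he).le.trans (hρj i)) km)
      (abs_nonneg _)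
  have hsum0 : ∀ e ∈ U, Summable (genTerm M ħ w (fun y => H (y + e • δ)) (Q t) z) := fun e he =>
    Summable.of_norm_bounded hb₀ fun km => h₀ t z htz _ ((hnorm e he).le.trans hρ0) km
  have hsum1 : ∀ i, Summable (genTerm M ħ w (fun y => pd i H (y + ε • δ)) (Q t) z) := fun i =>
    Summable.of_norm_bounded (hb₁ i) fun km => h₁ i t z htz _ ((hnorm ε hε).le.trans (hρj i)) km
  have key := hasDerivAt_tsum_of_isPreconnected
    (summable_sum fun i (_ : i ∈ Finset.univ) => (hb₁ i).mul_left |δ i|) hUo hUc hder hb hε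
    (hsum0 ε hε) hε
  exact key.congr_deriv (HasSum.tsum_eq (hasSum_sum fun i _ => (hsum1 i).hasSum.mul_left _))

end Series

/-! ### Regularity of the gauge functions -/

section Gauge

variable {J : Set ℝ} {F : ℝ → Phase N → ℝ}

lemma TwiceDifferentiable.differentiableAt_uncurry (hJ : IsOpen J) (hF : TwiceDifferentiable J F)
    {t : ℝ} (ht : t ∈ J) (z : Phase N) :
    DifferentiableAt ℝ (fun q : ℝ × Phase N => F q.1 q.2) (t, z) :=
  (hF.1 (t, z) ⟨ht, mem_univ _⟩).differentiableAt
    ((hJ.prod isOpen_univ).mem_nhds ⟨ht, mem_univ _⟩)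

lemma TwiceDifferentiable.differentiableAt_fderiv (hJ : IsOpen J) (hF : TwiceDifferentiable J F)
    {t : ℝ} (ht : t ∈ J) (z : Phase N) :
    DifferentiableAt ℝ (fderiv ℝ (fun q : ℝ × Phase N => F q.1 q.2)) (t, z) :=
  (hF.2 (t, z) ⟨ht, mem_univ _⟩).differentiableAt
    ((hJ.prod isOpen_univ).mem_nhds ⟨ht, mem_univ _⟩)

lemma hasFDerivAt_slice (t : ℝ) (z : Phase N) :
    HasFDerivAt (fun y : Phase N => (t, y)) (ContinuousLinearMap.inr ℝ ℝ (Phase N)) z :=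
  hasFDerivAt_prodMk_right t z

lemma TwiceDifferentiable.differentiable (hJ : IsOpen J) (hF : TwiceDifferentiable J F)
    {t : ℝ} (ht : t ∈ J) : Differentiable ℝ (F t) := fun z =>
  ((hF.differentiableAt_uncurry hJ ht z).hasFDerivAt.comp z
    (hasFDerivAt_slice t z)).differentiableAt

lemma TwiceDifferentiable.fderiv_slice (hJ : IsOpen J) (hF : TwiceDifferentiable J F)
    {t : ℝ} (ht : t ∈ J) (z : Phase N) :
    fderiv ℝ (F t) z = (fderiv ℝ (fun q : ℝ × Phase N => F q.1 q.2) (t, z)).comp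
      (ContinuousLinearMap.inr ℝ ℝ (Phase N)) :=
  ((hF.differentiableAt_uncurry hJ ht z).hasFDerivAt.comp z (hasFDerivAt_slice t z)).fderiv

lemma TwiceDifferentiable.differentiable_fderiv (hJ : IsOpen J) (hF : TwiceDifferentiable J F)
    {t : ℝ} (ht : t ∈ J) : Differentiable ℝ (fderiv ℝ (F t)) := by
  intro z
  have h : fderiv ℝ (F t) = fun z => (fderiv ℝ (fun q : ℝ × Phase N => F q.1 q.2) (t, z)).comp
      (ContinuousLinearMap.inr ℝ ℝ (Phase N)) := funext (hF.fderiv_slice hJ ht)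
  rw [h]
  have h2 : DifferentiableAt ℝ
      (fun z => fderiv ℝ (fun q : ℝ × Phase N => F q.1 q.2) (t, z)) z :=
    ((hF.differentiableAt_fderiv hJ ht z).hasFDerivAt.comp z
      (hasFDerivAt_slice t z)).differentiableAt
  exact h2.clm_comp (differentiableAt_const _)

lemma TwiceDifferentiable.differentiable_pd (hJ : IsOpen J) (hF : TwiceDifferentiable J F)
    {t : ℝ} (ht : t ∈ J) (i : PhaseIdx N) : Differentiable ℝ (pd i (F t)) := fun z =>
  (hF.differentiable_fderiv hJ ht z).clm_apply (differentiableAt_const _)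

lemma TwiceDifferentiable.pd_comm (hJ : IsOpen J) (hF : TwiceDifferentiable J F)
    {t : ℝ} (ht : t ∈ J) (i j : PhaseIdx N) (z : Phase N) :
    pd i (pd j (F t)) z = pd j (pd i (F t)) z :=
  pd_comm_of_twice (hF.differentiable hJ ht) (hF.differentiable_fderiv hJ ht z) i j

lemma TwiceDifferentiable.continuousOn (hF : TwiceDifferentiable J F) :
    ContinuousOn (fun q : ℝ × Phase N => F q.1 q.2) (J ×ˢ univ) :=
  hF.1.continuousOn

lemma TwiceDifferentiable.continuousOn_pd (hJ : IsOpen J) (hF : TwiceDifferentiable J F)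
    (i : PhaseIdx N) : ContinuousOn (fun q : ℝ × Phase N => pd i (F q.1) q.2) (J ×ˢ univ) := by
  have h : ContinuousOn (fun q : ℝ × Phase N => fderiv ℝ (fun q : ℝ × Phase N => F q.1 q.2) q
      (0, Pi.single i 1)) (J ×ˢ univ) := hF.2.continuousOn.clm_apply continuousOn_const
  refine h.congr ?_
  rintro ⟨t, z⟩ ⟨ht, -⟩
  simp [pd, hF.fderiv_slice hJ ht z]

variable {Γ : PhaseIdx N → PhaseIdx N → ℝ → Phase N → ℝ}

lemma continuousOn_vecGauge (hJ : IsOpen J) (hΓ : ∀ i j, TwiceDifferentiable J (Γ i j))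
    (i : PhaseIdx N) :
    ContinuousOn (fun q : ℝ × Phase N => vecGauge Γ q.1 q.2 i) (J ×ˢ univ) :=
  continuousOn_finsetSum _ fun j _ => (hΓ i j).continuousOn_pd hJ j

lemma differentiable_vecGauge (hJ : IsOpen J) (hΓ : ∀ i j, TwiceDifferentiable J (Γ i j))
    {t : ℝ} (ht : t ∈ J) (i : PhaseIdx N) : Differentiable ℝ (fun z => vecGauge Γ t z i) :=
  Differentiable.fun_sum fun j _ => (hΓ i j).differentiable_pd hJ ht j

/-- The vector gauge is divergence-free. -/
lemma sum_pd_vecGauge (hJ : IsOpen J) (hΓ : ∀ i j, TwiceDifferentiable J (Γ i j))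
    (hΓanti : ∀ i j, ∀ t ∈ J, ∀ z, Γ i j t z = -Γ j i t z) {t : ℝ} (ht : t ∈ J) (z : Phase N) :
    ∑ i, pd i (fun y => vecGauge Γ t y i) z = 0 := by
  have h1 : ∀ i, pd i (fun y => vecGauge Γ t y i) z = ∑ j, pd i (pd j (Γ i j t)) z := fun i =>
    pd_sum _ (fun j _ => (hΓ i j).differentiable_pd hJ ht j z) i
  have h2 : ∀ i j, pd i (pd j (Γ i j t)) z = -pd j (pd i (Γ j i t)) z := by
    intro i j
    rw [(hΓ i j).pd_comm hJ ht, show Γ i j t = fun y => -Γ j i t y from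
      funext (hΓanti i j t ht), pd_neg, pd_neg]
  simp only [h1]
  -- Exchanging the two summation indices shows that the double sum is its own negative.
  have h3 : ∑ i, ∑ j, pd i (pd j (Γ i j t)) z = -∑ i, ∑ j, pd i (pd j (Γ i j t)) z := by
    conv_lhs => rw [Finset.sum_comm]
    rw [← Finset.sum_neg_distrib]
    refine Finset.sum_congr rfl fun i _ => ?_
    rw [← Finset.sum_neg_distrib]
    exact Finset.sum_congr rfl fun j _ => h2 j i
  linarith

lemma continuousOn_pdTilde (hJ : IsOpen J) (hF : TwiceDifferentiable J F) (i : PhaseIdx N) :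
    ContinuousOn (fun q : ℝ × Phase N => pdTilde i (F q.1) q.2) (J ×ˢ univ) := by
  rcases i with n | n
  · exact hF.continuousOn_pd hJ _
  · exact (hF.continuousOn_pd hJ _).neg

lemma differentiable_pdTilde (hJ : IsOpen J) (hF : TwiceDifferentiable J F) {t : ℝ} (ht : t ∈ J)
    (i : PhaseIdx N) : Differentiable ℝ (pdTilde i (F t)) := by
  rcases i with n | n
  · exact hF.differentiable_pd hJ ht _
  · exact (hF.differentiable_pd hJ ht _).fun_neg

/-- A Hamiltonian vector field is divergence-free. -/
lemma sum_pd_pdTilde (hJ : IsOpen J) (hF : TwiceDifferentiable J F) {t : ℝ} (ht : t ∈ J)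
    (z : Phase N) : ∑ i, pd i (pdTilde i (F t)) z = 0 := by
  rw [Fintype.sum_sum_type, ← Finset.sum_add_distrib]
  refine Finset.sum_eq_zero fun n _ => ?_
  have : pd (Sum.inr n) (pdTilde (Sum.inr n) (F t)) z
      = -pd (Sum.inr n) (pd (Sum.inl n) (F t)) z := by
    simp only [pdTilde, pd_neg]
  rw [this, hF.pd_comm hJ ht]
  simp [pdTilde]

end Gauge

/-! ### The Liouville equation as a continuity equation -/

section LiouvilleField

variable {M : Mechanics} {ħ : ℝ} {w : PhaseIdx N → ℝ} {J : Set ℝ} {H : Phase N → ℝ}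
  {Q : ℝ → Phase N → ℝ}

/-- The right-hand side of the Husimi–Liouville equation in terms of the Hamilton generator. -/
def liouvilleField (M : Mechanics) (ħ : ℝ) (w : PhaseIdx N → ℝ) (H g : Phase N → ℝ)
    (z : Phase N) : ℝ :=
  ∑' km : ℕ × ℕ, genCoeff M ħ km.1 / (km.2.factorial : ℝ) * biTerm w (km.1 + 1) km.2 H g z

/-- One Poisson factor is spent on first derivatives of `H` and `Q`; the remaining series are
Hamilton generators, summable by the hypothesis at orders 1 and 1. -/
lemma SeriesConverge.hasSum_liouvilleField (hħ : 0 < ħ) (hHQ : SeriesConverge M ħ w J H Q)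
    {t : ℝ} (ht : t ∈ J) (z : Phase N) :
    HasSum (fun km : ℕ × ℕ => genCoeff M ħ km.1 / (km.2.factorial : ℝ)
        * biTerm w (km.1 + 1) km.2 H (Q t) z)
      (∑ n, (hamGen M ħ w (pd (Sum.inl n) H) (pd (Sum.inr n) (Q t)) z
        - hamGen M ħ w (pd (Sum.inr n) H) (pd (Sum.inl n) (Q t)) z)) := by
  have hs : ∀ i j : PhaseIdx N, HasSum (genTerm M ħ w (pd i H) (pd j (Q t)) z)
      (hamGen M ħ w (pd i H) (pd j (Q t)) z) := fun i j =>
    (hHQ.summable hħ (α := [i]) (β := [j]) (by simp) (by simp) ht z).hasSum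
  have := hasSum_sum fun (n : Fin N) (_ : n ∈ Finset.univ) =>
    (hs (Sum.inl n) (Sum.inr n)).sub (hs (Sum.inr n) (Sum.inl n))
  refine this.congr_fun ?_
  intro km
  simp only [biTerm_succ, poissonStep, genTerm, Finset.mul_sum, mul_sub]

lemma SeriesConverge.liouvilleField_eq (hħ : 0 < ħ) (hHQ : SeriesConverge M ħ w J H Q)
    {t : ℝ} (ht : t ∈ J) (z : Phase N) :
    liouvilleField M ħ w H (Q t) z
      = ∑ n, (hamGen M ħ w (pd (Sum.inl n) H) (pd (Sum.inr n) (Q t)) z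
        - hamGen M ħ w (pd (Sum.inr n) H) (pd (Sum.inl n) (Q t)) z) :=
  (hHQ.hasSum_liouvilleField hħ ht z).tsum_eq

/-- The commutator doubles the odd part of the exponential: `(2/ħ) sin (ħΛ/2) = Λ sinc (ħΛ/2)`. The
factor `Λ` pulled out accounts for `k + 1` on the left against `k` on the right. -/
lemma commutator_coeff {ħ : ℝ} (hħ : 0 < ħ) (k : ℕ) :
    -(Complex.I / (ħ : ℂ)) * ((Complex.I * (ħ / 2 : ℝ)) ^ (k + 1) / ((k + 1).factorial : ℂ)
      * (1 - (-1) ^ (k + 1))) = (genCoeff Mechanics.quantum ħ k : ℂ) := by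
  have hħ' : (ħ : ℂ) ≠ 0 := by exact_mod_cast hħ.ne'
  have hf : ((k + 1).factorial : ℂ) ≠ 0 := by exact_mod_cast (k + 1).factorial_ne_zero
  rcases Nat.even_or_odd k with he | ho
  · obtain ⟨j, rfl⟩ := he.two_dvd
    have h1 : (-1 : ℂ) ^ (2 * j + 1) = -1 := Odd.neg_one_pow ⟨j, rfl⟩
    have h2 : Complex.I ^ (2 * j) = (-1) ^ j := by rw [pow_mul, Complex.I_sq]
    simp only [genCoeff, he, if_true, h1]
    rw [Nat.mul_div_cancel_left _ two_pos, mul_pow, pow_succ Complex.I, h2, pow_succ]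
    push_cast
    field_simp
    linear_combination (-2 * ((ħ : ℂ) / 2) ^ (2 * j)) * Complex.I_sq
  · have h1 : (-1 : ℂ) ^ (k + 1) = 1 := (ho.add_one).neg_one_pow
    simp [genCoeff, Nat.not_even_iff_odd.2 ho, h1]

/-- The commutator of a bounded weighted double series is its odd part. -/
lemma commutator_tsum {ħ : ℝ} (hħ : 0 < ħ) {T : ℕ → ℕ → ℝ}
    (hT : Summable fun km : ℕ × ℕ => (ħ / 2) ^ km.1 / (km.1.factorial : ℝ)
      / (km.2.factorial : ℝ) * |T km.1 km.2|) :
    -(Complex.I / (ħ : ℂ)) *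
      ((∑' km : ℕ × ℕ, (Complex.I * (ħ / 2 : ℝ)) ^ km.1 / (km.1.factorial : ℂ)
          * (1 / (km.2.factorial : ℂ)) * (T km.1 km.2 : ℂ))
        - ∑' km : ℕ × ℕ, (Complex.I * (ħ / 2 : ℝ)) ^ km.1 / (km.1.factorial : ℂ)
          * (1 / (km.2.factorial : ℂ)) * (((-1) ^ km.1 * T km.1 km.2 : ℝ) : ℂ))
      = ((∑' km : ℕ × ℕ, genCoeff Mechanics.quantum ħ km.1 / (km.2.factorial : ℝ)
          * T (km.1 + 1) km.2 : ℝ) : ℂ) := by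
  have hn : ∀ km : ℕ × ℕ, ‖(Complex.I * (ħ / 2 : ℝ)) ^ km.1 / (km.1.factorial : ℂ)
      * (1 / (km.2.factorial : ℂ)) * (T km.1 km.2 : ℂ)‖ = (ħ / 2) ^ km.1 / (km.1.factorial : ℝ)
      / (km.2.factorial : ℝ) * |T km.1 km.2| := by
    intro km
    simp only [norm_mul, norm_div, norm_pow, Complex.norm_I, Complex.norm_real, one_mul,
      Complex.norm_natCast, Real.norm_eq_abs, norm_one, abs_of_pos hħ]
    ring
  have s1 : Summable fun km : ℕ × ℕ => (Complex.I * (ħ / 2 : ℝ)) ^ km.1 / (km.1.factorial : ℂ)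
      * (1 / (km.2.factorial : ℂ)) * (T km.1 km.2 : ℂ) :=
    Summable.of_norm_bounded hT fun km => (hn km).le
  have s2 : Summable fun km : ℕ × ℕ => (Complex.I * (ħ / 2 : ℝ)) ^ km.1 / (km.1.factorial : ℂ)
      * (1 / (km.2.factorial : ℂ)) * (((-1) ^ km.1 * T km.1 km.2 : ℝ) : ℂ) := by
    refine Summable.of_norm_bounded hT fun km => ?_
    rw [← hn km]
    simp
  rw [← s1.tsum_sub s2, ← tsum_mul_left, Complex.ofReal_tsum]
  -- The order-zero Poisson terms cancel in the commutator, so the sum may be reindexed from `k +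
  -- 1`.
  have hinj : Function.Injective (fun km : ℕ × ℕ => (km.1 + 1, km.2)) := by
    rintro ⟨a, b⟩ ⟨c, d⟩ h
    simpa using h
  rw [← hinj.tsum_eq]
  · refine tsum_congr fun km => ?_
    have := commutator_coeff hħ km.1
    push_cast at this ⊢
    rw [← this]
    ring
  · rintro ⟨k, m⟩ h
    rcases k with _ | k
    · simp at h
    · exact ⟨(k, m), rfl⟩

lemma SeriesConverge.husimiLiouville_iff (hħ : 0 < ħ) (hHQ : SeriesConverge M ħ w J H Q) :
    HusimiLiouville M ħ w J H Q ↔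
      ∀ t ∈ J, ∀ z, deriv (fun s => Q s z) t = liouvilleField M ħ w H (Q t) z := by
  cases M with
  | classical =>
    simp only [HusimiLiouville]
    refine forall₂_congr fun t ht => forall_congr' fun z => ?_
    have hinj : Function.Injective (fun m : ℕ => ((0 : ℕ), m)) := fun a b h => by simpa using h
    have : liouvilleField Mechanics.classical ħ w H (Q t) z
        = ∑' m : ℕ, 1 / (m.factorial : ℝ) * biTerm w 1 m H (Q t) z := by
      unfold liouvilleField
      rw [← hinj.tsum_eq]
      · simp [genCoeff]
      · rintro ⟨k, m⟩ h
        rcases k with _ | k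
        · exact ⟨m, rfl⟩
        · simp [genCoeff] at h
    rw [this]
  | quantum =>
    simp only [HusimiLiouville]
    refine forall₂_congr fun t ht => forall_congr' fun z => ?_
    have hT : Summable fun km : ℕ × ℕ => (ħ / 2) ^ km.1 / (km.1.factorial : ℝ)
        / (km.2.factorial : ℝ) * |biTerm w km.1 km.2 H (Q t) z| := by
      obtain ⟨ρ, hρ, b, hb, h⟩ := hHQ [] [] (by simp) (by simp) {(t, z)} isCompact_singleton
        (by simpa using ht)
      refine Summable.of_nonneg_of_le (fun km => by positivity) (fun km => ?_) hb
      simpa [majCoeff, pdList_nil] using h t z rfl 0 (by simpa using hρ.le) km.1 km.2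
    have key := commutator_tsum hħ (T := fun k m => biTerm w k m H (Q t) z) hT
    simp only [← biTerm_swap] at key
    rw [show husimiStar ħ w H (Q t) z - husimiStar ħ w (Q t) H z = _ from rfl]
    unfold husimiStar
    rw [key, Complex.ofReal_inj]
    rfl

variable {A : ℝ → Phase N → ℝ} {Γ : PhaseIdx N → PhaseIdx N → ℝ → Phase N → ℝ}

/-- The flux `∂G/∂z̃ ⊙ Q - ∂A/∂z̃ - 𝓛` of the extended Hamilton equations. -/
def hamFlux (M : Mechanics) (ħ : ℝ) (w : PhaseIdx N → ℝ) (H : Phase N → ℝ)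
    (A : ℝ → Phase N → ℝ) (Γ : PhaseIdx N → PhaseIdx N → ℝ → Phase N → ℝ)
    (Q : ℝ → Phase N → ℝ) (t : ℝ) (z : Phase N) (i : PhaseIdx N) : ℝ :=
  hamGen M ħ w (pdTilde i H) (Q t) z - pdTilde i (A t) z - vecGauge Γ t z i

lemma hamGen_pdTilde_inl (f g : Phase N → ℝ) (n : Fin N) :
    hamGen M ħ w (pdTilde (Sum.inl n) f) g = hamGen M ħ w (pd (Sum.inr n) f) g := rfl

lemma hamGen_pdTilde_inr (f g : Phase N → ℝ) (n : Fin N) :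
    hamGen M ħ w (pdTilde (Sum.inr n) f) g = fun z => -hamGen M ħ w (pd (Sum.inl n) f) g z :=
  funext fun z => hamGen_neg_left _ _ z

lemma SeriesConverge.pd_hamGen (hħ : 0 < ħ) (hH : ContDiff ℝ ∞ H)
    (hQ : IsState J Q) (hHQ : SeriesConverge M ħ w J H Q) (i j : PhaseIdx N) {t : ℝ}
    (ht : t ∈ J) (z : Phase N) :
    pd j (hamGen M ħ w (pd i H) (Q t)) z
      = hamGen M ħ w (pd j (pd i H)) (Q t) z + hamGen M ħ w (pd i H) (pd j (Q t)) z := by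
  have := hHQ.hasFDerivAt hħ hH hQ (α := [i]) (by simp) ht z
  simp only [pdList_singleton] at this
  rw [pd, this.fderiv]
  simp [Pi.single_apply, -Fintype.sum_sum_type]

lemma SeriesConverge.differentiable_hamGen (hħ : 0 < ħ) (hH : ContDiff ℝ ∞ H)
    (hQ : IsState J Q) (hHQ : SeriesConverge M ħ w J H Q) (i : PhaseIdx N) {t : ℝ}
    (ht : t ∈ J) : Differentiable ℝ (hamGen M ħ w (pd i H) (Q t)) := fun z =>
  (hHQ.hasFDerivAt hħ hH hQ (α := [i]) (by simp) ht z).differentiableAt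

lemma SeriesConverge.differentiable_hamGen_pdTilde (hħ : 0 < ħ) (hH : ContDiff ℝ ∞ H)
    (hQ : IsState J Q) (hHQ : SeriesConverge M ħ w J H Q) (i : PhaseIdx N) {t : ℝ}
    (ht : t ∈ J) : Differentiable ℝ (hamGen M ħ w (pdTilde i H) (Q t)) := by
  rcases i with n | n
  · exact hHQ.differentiable_hamGen hħ hH hQ _ ht
  · rw [hamGen_pdTilde_inr]
    exact (hHQ.differentiable_hamGen hħ hH hQ _ ht).fun_neg

lemma SeriesConverge.continuousOn_hamGen_pdTilde (hħ : 0 < ħ) (hJ : IsOpen J)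
    (hH : ContDiff ℝ ∞ H) (hQ : IsState J Q) (hHQ : SeriesConverge M ħ w J H Q)
    (i : PhaseIdx N) :
    ContinuousOn (fun q : ℝ × Phase N => hamGen M ħ w (pdTilde i H) (Q q.1) q.2)
      (J ×ˢ univ) := by
  rcases i with n | n
  · exact hHQ.continuousOn hħ hJ hH hQ (α := [Sum.inr n]) (β := []) (by simp) (by simp)
  · simp only [hamGen_pdTilde_inr]
    exact (hHQ.continuousOn hħ hJ hH hQ (α := [Sum.inl n]) (β := []) (by simp) (by simp)).neg

/-- By the Leibniz rule each pair `(x_n, p_n)` contributes two mixed second derivatives of `H` with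
opposite signs, which cancel; the terms with one derivative on each factor form minus the Liouville
field. -/
lemma SeriesConverge.sum_pd_hamGen_pdTilde (hħ : 0 < ħ) (hH : ContDiff ℝ ∞ H)
    (hQ : IsState J Q) (hHQ : SeriesConverge M ħ w J H Q) {t : ℝ} (ht : t ∈ J) (z : Phase N) :
    ∑ i, pd i (hamGen M ħ w (pdTilde i H) (Q t)) z = -liouvilleField M ħ w H (Q t) z := by
  rw [hHQ.liouvilleField_eq hħ ht, Fintype.sum_sum_type, ← Finset.sum_add_distrib,
    ← Finset.sum_neg_distrib]
  refine Finset.sum_congr rfl fun n _ => ?_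
  rw [hamGen_pdTilde_inr, pd_neg, hamGen_pdTilde_inl, hHQ.pd_hamGen hħ hH hQ _ _ ht]
  beta_reduce
  rw [hHQ.pd_hamGen hħ hH hQ _ _ ht, pd_comm hH (Sum.inr n) (Sum.inl n)]
  ring

lemma continuousOn_hamFlux (hħ : 0 < ħ) (hJ : IsOpen J) (hH : ContDiff ℝ ∞ H)
    (hQ : IsState J Q) (hHQ : SeriesConverge M ħ w J H Q) (hA : TwiceDifferentiable J A)
    (hΓ : ∀ i j, TwiceDifferentiable J (Γ i j)) (i : PhaseIdx N) :
    ContinuousOn (fun q : ℝ × Phase N => hamFlux M ħ w H A Γ Q q.1 q.2 i) (J ×ˢ univ) :=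
  ((hHQ.continuousOn_hamGen_pdTilde hħ hJ hH hQ i).sub (continuousOn_pdTilde hJ hA i)).sub
    (continuousOn_vecGauge hJ hΓ i)

lemma differentiable_hamFlux (hħ : 0 < ħ) (hJ : IsOpen J) (hH : ContDiff ℝ ∞ H)
    (hQ : IsState J Q) (hHQ : SeriesConverge M ħ w J H Q) (hA : TwiceDifferentiable J A)
    (hΓ : ∀ i j, TwiceDifferentiable J (Γ i j)) {t : ℝ} (ht : t ∈ J) (i : PhaseIdx N) :
    Differentiable ℝ (fun z => hamFlux M ħ w H A Γ Q t z i) :=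
  ((hHQ.differentiable_hamGen_pdTilde hħ hH hQ i ht).sub (differentiable_pdTilde hJ hA ht i)).sub
    (differentiable_vecGauge hJ hΓ ht i)

/-- The gauge terms do not contribute to the divergence of the flux. -/
lemma sum_pd_hamFlux (hħ : 0 < ħ) (hJ : IsOpen J) (hH : ContDiff ℝ ∞ H)
    (hQ : IsState J Q) (hHQ : SeriesConverge M ħ w J H Q) (hA : TwiceDifferentiable J A)
    (hΓ : ∀ i j, TwiceDifferentiable J (Γ i j))
    (hΓanti : ∀ i j, ∀ t ∈ J, ∀ z, Γ i j t z = -Γ j i t z) {t : ℝ} (ht : t ∈ J) (z : Phase N) :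
    ∑ i, pd i (fun y => hamFlux M ħ w H A Γ Q t y i) z = -liouvilleField M ħ w H (Q t) z := by
  have h : ∀ i, pd i (fun y => hamFlux M ħ w H A Γ Q t y i) z
      = pd i (hamGen M ħ w (pdTilde i H) (Q t)) z - pd i (pdTilde i (A t)) z
        - pd i (fun y => vecGauge Γ t y i) z := by
    intro i
    have d1 := hHQ.differentiable_hamGen_pdTilde hħ hH hQ i ht z
    have d2 := differentiable_pdTilde hJ hA ht i z
    have d3 := differentiable_vecGauge hJ hΓ ht i z
    unfold hamFlux
    rw [pd_sub (d1.fun_sub d2) d3, pd_sub d1 d2]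
  simp only [h, Finset.sum_sub_distrib]
  rw [hHQ.sum_pd_hamGen_pdTilde hħ hH hQ ht, sum_pd_pdTilde hJ hA ht,
    sum_pd_vecGauge hJ hΓ hΓanti ht]
  ring

/-- For a velocity field that satisfies the extended Hamilton equations, the continuity equation
is the Liouville equation. -/
theorem ExtHamiltonEq.continuityEq_iff (hħ : 0 < ħ) (hJ : IsOpen J) (hH : ContDiff ℝ ∞ H)
    (hQ : IsState J Q) (hHQ : SeriesConverge M ħ w J H Q) (hA : TwiceDifferentiable J A)
    (hΓ : ∀ i j, TwiceDifferentiable J (Γ i j))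
    (hΓanti : ∀ i j, ∀ t ∈ J, ∀ z, Γ i j t z = -Γ j i t z)
    {v : ℝ → Phase N → Phase N} (hv : ExtHamiltonEq M ħ w J H A Γ Q v) :
    ContinuityEq J Q v ↔ HusimiLiouville M ħ w J H Q := by
  rw [hHQ.husimiLiouville_iff hħ]
  refine forall₂_congr fun t ht => forall_congr' fun z => ?_
  have : ∀ i, (fun y => v t y i * Q t y) = fun y => hamFlux M ħ w H A Γ Q t y i := fun i =>
    funext fun y => hv t ht y i
  simp only [this]
  rw [sum_pd_hamFlux hħ hJ hH hQ hHQ hA hΓ hΓanti ht, neg_neg]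

/-- A positive state admits a velocity field that satisfies the extended Hamilton equations. -/
lemma exists_velocity_of_pos (hħ : 0 < ħ) (hJ : IsOpen J) (hH : ContDiff ℝ ∞ H)
    (hQ : IsState J Q) (hHQ : SeriesConverge M ħ w J H Q) (hA : TwiceDifferentiable J A)
    (hΓ : ∀ i j, TwiceDifferentiable J (Γ i j)) (hpos : ∀ t ∈ J, ∀ z, 0 < Q t z) :
    ∃ v : ℝ → Phase N → Phase N, IsVelocity J v ∧ ExtHamiltonEq M ħ w J H A Γ Q v := by
  refine ⟨fun t z i => hamFlux M ħ w H A Γ Q t z i / Q t z, ⟨?_, ?_⟩, ?_⟩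
  · refine continuousOn_pi.2 fun i => (continuousOn_hamFlux hħ hJ hH hQ hHQ hA hΓ i).div
      (hQ.continuousOn_pdList []) ?_
    rintro ⟨t, z⟩ ⟨ht, -⟩
    exact (hpos t ht z).ne'
  · intro t ht
    refine differentiable_pi.2 fun i z => ?_
    simp only [div_eq_mul_inv]
    exact (differentiable_hamFlux hħ hJ hH hQ hHQ hA hΓ ht i z).mul
      (((hQ.1 t ht).differentiable (by simp) z).fun_inv (hpos t ht z).ne')
  · intro t ht z i
    exact div_mul_cancel₀ _ (hpos t ht z).ne'

end LiouvilleField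

/-! ### Differentiation under the integral and the divergence theorem -/

section Analysis

/-- Compactness supplies a constant bound for the derivative, integrable because `K` has finite
measure. It is used both with time and with the variation parameter as `s`. -/
lemma hasDerivAt_setIntegral_of_continuousOn {Y : Type*} [TopologicalSpace Y]
    [TopologicalSpace.PseudoMetrizableSpace Y] [SecondCountableTopology Y] [MeasurableSpace Y]
    [OpensMeasurableSpace Y] {μ : Measure Y} [IsFiniteMeasureOnCompacts μ] {K : Set Y}
    (hK : IsCompact K) (hKm : MeasurableSet K) {f f' : ℝ → Y → ℝ} {a b s₀ : ℝ}
    (hs₀ : s₀ ∈ Ioo a b)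
    (hf : ContinuousOn (fun q : ℝ × Y => f q.1 q.2) (Icc a b ×ˢ K))
    (hf' : ContinuousOn (fun q : ℝ × Y => f' q.1 q.2) (Icc a b ×ˢ K))
    (hd : ∀ s ∈ Ioo a b, ∀ y ∈ K, HasDerivAt (fun s => f s y) (f' s y) s) :
    HasDerivAt (fun s => ∫ y in K, f s y ∂μ) (∫ y in K, f' s₀ y ∂μ) s₀ := by
  obtain ⟨B, hB⟩ := (isCompact_Icc.prod hK).exists_bound_of_continuousOn hf'
  have hslice : ∀ g : ℝ → Y → ℝ, ContinuousOn (fun q : ℝ × Y => g q.1 q.2) (Icc a b ×ˢ K) →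
      ∀ s ∈ Icc a b, ContinuousOn (g s) K := fun g hg s hs =>
    hg.comp (f := fun y => (s, y)) (by fun_prop) fun y hy => ⟨hs, hy⟩
  have hs₀' := Ioo_subset_Icc_self hs₀
  refine (hasDerivAt_integral_of_dominated_loc_of_deriv_le (μ := μ.restrict K) (F := f) (F' := f')
    (bound := fun _ => B) (s := Ioo a b) (Ioo_mem_nhds hs₀.1 hs₀.2) ?_ ?_ ?_ ?_ ?_ ?_).2
  · filter_upwards [Ioo_mem_nhds hs₀.1 hs₀.2] with s hs
    exact (hslice f hf s (Ioo_subset_Icc_self hs)).aestronglyMeasurable hKm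
  · exact (hslice f hf s₀ hs₀').integrableOn_compact' hK hKm
  · exact (hslice f' hf' s₀ hs₀').aestronglyMeasurable hKm
  · refine (ae_restrict_iff' hKm).2 (ae_of_all _ fun y hy s hs => ?_)
    exact hB (s, y) ⟨Ioo_subset_Icc_self hs, hy⟩
  · have := hK.measure_lt_top (μ := μ)
    exact integrableOn_const this.ne
  · exact (ae_restrict_iff' hKm).2 (ae_of_all _ fun y hy s hs => hd s hs y hy)

/-- The integral of the divergence of a compactly supported differentiable vector field vanishes
if the divergence is continuous. -/
lemma integral_divergence_eq_zero {ι : Type*} [Fintype ι] [DecidableEq ι]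
    {X : ι → (ι → ℝ) → ℝ} (hX : ∀ i, Differentiable ℝ (X i)) {K : Set (ι → ℝ)}
    (hK : IsCompact K) (hXK : ∀ i, ∀ z, z ∉ K → X i z = 0)
    (hD : Continuous fun z => ∑ i, fderiv ℝ (X i) z (Pi.single i 1)) :
    ∫ z, ∑ i, fderiv ℝ (X i) z (Pi.single i 1) = 0 := by
  -- Without coordinates the divergence is an empty sum. Otherwise the coordinates are renumbered by
  -- `Fin (n + 1)` to apply the divergence theorem on a box.
  rcases isEmpty_or_nonempty ι with hι | hι
  · simp
  obtain ⟨n, hn⟩ := Nat.exists_eq_succ_of_ne_zero (Fintype.card_ne_zero (α := ι))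
  let e : ι ≃ Fin (n + 1) := Fintype.equivFinOfCardEq hn
  let eL : (ι → ℝ) ≃L[ℝ] (Fin (n + 1) → ℝ) :=
    (LinearEquiv.funCongrLeft ℝ ℝ e.symm).toContinuousLinearEquiv
  have heL : ∀ x k, eL x k = x (e.symm k) := fun x k => rfl
  have heLs : ∀ y i, eL.symm y i = y (e i) := by
    intro y i
    have := heL (eL.symm y) (e i)
    simpa using this.symm
  obtain ⟨R₀, hR₀⟩ := hK.isBounded.subset_ball 0
  -- The cube with half-side `R` contains `K` in its interior; the maximum with 1 keeps `R` positive
  -- even if `K` is empty.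
  set R : ℝ := max R₀ 1 with hR
  have hRpos : 0 < R := lt_of_lt_of_le one_pos (le_max_right _ _)
  have hcoord : ∀ z ∈ K, ∀ i, |z i| < R := fun z hz i =>
    (norm_le_pi_norm z i).trans_lt ((mem_ball_zero_iff.1 (hR₀ hz)).trans_le (le_max_left _ _))
  have hDK : ∀ z, z ∉ K → ∑ i, fderiv ℝ (X i) z (Pi.single i 1) = 0 := by
    intro z hz
    refine Finset.sum_eq_zero fun i _ => ?_
    have : X i =ᶠ[𝓝 z] fun _ => 0 := by
      filter_upwards [hK.isClosed.isOpen_compl.mem_nhds hz] with y hy using hXK i y hy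
    rw [this.fderiv_eq]
    simp
  have hKI : K ⊆ Icc (fun _ : ι => -R) (fun _ => R) := fun z hz =>
    ⟨fun i => (abs_lt.1 (hcoord z hz i)).1.le, fun i => (abs_lt.1 (hcoord z hz i)).2.le⟩
  have hvol : MeasurePreserving eL volume volume := by
    have := volume_measurePreserving_piCongrLeft (fun _ : Fin (n + 1) => ℝ) e
    convert this using 1
    funext x k
    obtain ⟨i, rfl⟩ := e.surjective k
    rw [MeasurableEquiv.piCongrLeft, heL]
    simp [Equiv.piCongrLeft_apply_apply]
  have key := integral_divergence_of_hasFDerivAt_off_countable_of_equiv eL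
    (fun x y => by
      refine ⟨fun h i => ?_, fun h k => h _⟩
      simpa [heL] using h (e i))
    hvol (fun k => X (e.symm k)) (fun k z => fderiv ℝ (X (e.symm k)) z) ∅ countable_empty
    (fun _ => -R) (fun _ => R) (fun _ => by simp only; linarith)
    (fun k => (hX _).continuous.continuousOn) (fun x _ k => (hX _ x).hasFDerivAt)
    (fun z => ∑ i, fderiv ℝ (X i) z (Pi.single i 1)) (fun z => by
      rw [← e.sum_comp]
      refine Finset.sum_congr rfl fun i _ => ?_
      have : eL.symm (Pi.single (e i) 1) = Pi.single i 1 := by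
        funext j
        rw [heLs]
        simp [Pi.single_apply]
      simp [this]) (hD.continuousOn.integrableOn_compact isCompact_Icc)
  rw [← setIntegral_eq_integral_of_forall_compl_eq_zero (fun z hz => hDK z fun h => hz (hKI h)),
    key]
  refine Finset.sum_eq_zero fun k _ => ?_
  -- On the faces one coordinate has modulus `R`, which is impossible in `K`; hence all boundary
  -- integrals vanish.
  have hz : ∀ c : ℝ, |c| = R → ∀ y, X (e.symm k) (eL.symm (k.insertNth c y)) = 0 := by
    intro c hc y
    refine hXK _ _ fun h => ?_
    have := hcoord _ h (e.symm k)
    rw [heLs] at this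
    simp [hc] at this
  have h1 : ∀ y, X (e.symm k) (eL.symm (k.insertNth (eL (fun _ => R) k) y)) = 0 :=
    hz _ (by simp [heL, abs_of_pos hRpos])
  have h2 : ∀ y, X (e.symm k) (eL.symm (k.insertNth (eL (fun _ => -R) k) y)) = 0 :=
    hz _ (by simp [heL, abs_of_pos hRpos])
  simp [h1, h2]

end Analysis

/-! ### Transport of labelled integrals -/

section Transport

variable {J : Set ℝ} {Q : ℝ → Phase N → ℝ} {v : ℝ → Phase N → Phase N} {ti tf : ℝ}
  {L : ℝ → Phase N → ℝ}

/-- `⟨L z_i Q⟩` changes at the rate `⟨L v_i Q⟩`. -/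
lemma IsLabel.hasDerivAt_moment (hQ : IsState J Q) (hv : IsVelocity J v)
    (hcont : ContinuityEq J Q v) (hIJ : Icc ti tf ⊆ J) (hL : IsLabel v ti tf L) (i : PhaseIdx N)
    {t : ℝ} (ht : t ∈ Ioo ti tf) :
    HasDerivAt (fun s => ∫ z, L s z * z i * Q s z) (∫ z, L t z * v t z i * Q t z) t := by
  obtain ⟨hLd, ⟨K, hK, hLK⟩, hLt⟩ := hL
  have hIo : Ioo ti tf ⊆ J := Ioo_subset_Icc_self.trans hIJ
  have hIu : ∀ s ∈ Ioo ti tf, ∀ z : Phase N, Icc ti tf ×ˢ (univ : Set (Phase N)) ∈ 𝓝 (s, z) :=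
    fun s hs z => prod_mem_nhds (Icc_mem_nhds hs.1 hs.2) univ_mem
  have hLat : ∀ s ∈ Ioo ti tf, ∀ z : Phase N,
      ContDiffAt ℝ 1 (fun q : ℝ × Phase N => L q.1 q.2) (s, z) := fun s hs z =>
    (hLd (s, z) ⟨Ioo_subset_Icc_self hs, mem_univ _⟩).contDiffAt (hIu s hs z)
  have hLdt : ∀ s ∈ Ioo ti tf, ∀ z : Phase N, HasDerivAt (fun r => L r z)
      (fderiv ℝ (fun q : ℝ × Phase N => L q.1 q.2) (s, z) (1, 0)) s := fun s hs z => by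
    have h1 := ((hLat s hs z).differentiableAt one_ne_zero).hasFDerivAt
    have h2 : HasDerivAt (fun r : ℝ => (r, z)) ((1 : ℝ), (0 : Phase N)) s :=
      (hasDerivAt_id s).prodMk (hasDerivAt_const s z)
    exact h1.comp_hasDerivAt s h2
  have hLdz : ∀ s ∈ Ioo ti tf, Differentiable ℝ (L s) := fun s hs z =>
    (((hLat s hs z).differentiableAt one_ne_zero).hasFDerivAt.comp z
      (hasFDerivAt_slice s z)).differentiableAt
  have hQd := fun s (hs : s ∈ Ioo ti tf) => hQ.2.2.1 s (hIo hs)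
  set f' : ℝ → Phase N → ℝ := fun s z => (fderiv ℝ (fun q : ℝ × Phase N => L q.1 q.2) (s, z) (1, 0)
    * Q s z + L s z * deriv (fun r => Q r z) s) * z i with hf'
  have hQc : ContinuousOn (fun q : ℝ × Phase N => Q q.1 q.2) (J ×ˢ univ) := hQ.continuousOn_pdList []
  have hf'c : ContinuousOn (fun q : ℝ × Phase N => f' q.1 q.2) (Ioo ti tf ×ˢ univ) := by
    have hsub : Ioo ti tf ×ˢ (univ : Set (Phase N)) ⊆ J ×ˢ univ := prod_mono hIo subset_rfl
    have h1 : ContinuousOn (fderiv ℝ (fun q : ℝ × Phase N => L q.1 q.2)) (Ioo ti tf ×ˢ univ) :=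
      fun q hq => (((hLat q.1 hq.1 q.2).fderiv_right (m := 0)
        (by simp)).continuousAt).continuousWithinAt
    refine ContinuousOn.mul (((h1.clm_apply continuousOn_const).mul (hQc.mono hsub)).add
      (ContinuousOn.mul ?_ (hQ.2.2.2.mono hsub))) (Continuous.continuousOn (by fun_prop))
    exact hLd.continuousOn.mono (prod_mono Ioo_subset_Icc_self subset_rfl)
  -- The derivatives of the label are controlled only at interior times, so a compact time interval
  -- inside the open one is used for the uniform bound.
  obtain ⟨a, ha, hat⟩ := exists_between ht.1
  obtain ⟨b, htb, hb⟩ := exists_between ht.2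
  have hab : Icc a b ⊆ Ioo ti tf := fun s hs => ⟨ha.trans_le hs.1, hs.2.trans_lt hb⟩
  have hder := hasDerivAt_setIntegral_of_continuousOn (μ := volume) hK hK.measurableSet
    (f := fun s z => L s z * z i * Q s z) (f' := f') (a := a) (b := b) (s₀ := t) ⟨hat, htb⟩
    (ContinuousOn.mul (ContinuousOn.mul
      (hLd.continuousOn.mono (prod_mono (hab.trans Ioo_subset_Icc_self) (subset_univ _)))
      (Continuous.continuousOn (by fun_prop)))
      (hQc.mono (prod_mono (hab.trans hIo) (subset_univ _))))
    (hf'c.mono (prod_mono hab (subset_univ _)))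
    (fun s hs z _ => by
      have hs' := hab (Ioo_subset_Icc_self hs)
      have := ((hLdt s hs' z).mul_const (z i)).mul (hQd s hs' z).hasDerivAt
      refine this.congr_deriv ?_
      simp only [hf']
      ring)
  have hsupp : ∀ s ∈ Icc ti tf, ∀ g : Phase N → ℝ, (∀ z, L s z = 0 → g z = 0) →
      ∫ z in K, g z = ∫ z, g z := fun s hs g hg =>
    setIntegral_eq_integral_of_forall_compl_eq_zero fun z hz => hg z (hLK s hs z hz)
  have hder2 : HasDerivAt (fun s => ∫ z, L s z * z i * Q s z) (∫ z in K, f' t z) t := by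
    refine hder.congr_of_eventuallyEq ?_
    filter_upwards [Icc_mem_nhds ht.1 ht.2] with s hs
    exact (hsupp s hs _ fun z hz => by simp [hz]).symm
  refine hder2.congr_deriv ?_
  -- integration by parts in phase space
  have htJ := hIo ht
  have hQz : Differentiable ℝ (Q t) := (hQ.1 t htJ).differentiable (by simp)
  have hvz : ∀ j, Differentiable ℝ (fun y => v t y j) := fun j =>
    (differentiable_pi.1 (hv.2 t htJ)) j
  have hLz := hLdz t ht
  have hcoord : Differentiable ℝ (fun z : Phase N => z i) := by fun_prop
  have hLdt0 : ∀ z, deriv (fun s => L s z) t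
      = fderiv ℝ (fun q : ℝ × Phase N => L q.1 q.2) (t, z) (1, 0) := fun z => (hLdt t ht z).deriv
  -- In the divergence of `z_i L Q v`, differentiating `z_i` gives `L v_i Q`; the transport of the
  -- label and the continuity equation turn the rest into `-z_i ∂_t (L Q)`.
  have hdiv : ∀ z, ∑ j, pd j (fun y => y i * (L t y * (v t y j * Q t y))) z
      = L t z * v t z i * Q t z - f' t z := by
    intro z
    have h1 : ∀ j, pd j (fun y => y i * (L t y * (v t y j * Q t y))) z
        = pd j (fun y : Phase N => y i) z * (L t z * (v t z j * Q t z))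
          + z i * (pd j (L t) z * (v t z j * Q t z)
            + L t z * pd j (fun y => v t y j * Q t y) z) := by
      intro j
      rw [pd_mul (hcoord z) ((hLz z).fun_mul ((hvz j z).fun_mul (hQz z))),
        pd_mul (hLz z) ((hvz j z).fun_mul (hQz z))]
    have h2 : ∀ j, pd j (fun y : Phase N => y i) z = if j = i then 1 else 0 := by
      intro j
      have : HasFDerivAt (fun y : Phase N => y i)
        (ContinuousLinearMap.proj i : Phase N →L[ℝ] ℝ) z := hasFDerivAt_apply i z
      rw [pd, this.fderiv]
      simp [Pi.single_apply, eq_comm]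
    simp only [h1, h2, Finset.sum_add_distrib, ite_mul, one_mul, zero_mul, Finset.sum_ite_eq',
      Finset.mem_univ, if_true, ← Finset.mul_sum]
    have h3 := hLt t ht z
    have h4 := hcont t htJ z
    rw [hLdt0] at h3
    simp only [hf', h3, h4]
    have h5 : ∑ j, pd j (L t) z * (v t z j * Q t z) = (∑ j, v t z j * pd j (L t) z) * Q t z := by
      rw [Finset.sum_mul]
      exact Finset.sum_congr rfl fun j _ => by ring
    rw [h5]
    ring
  have hslice : ∀ g : ℝ × Phase N → ℝ, ∀ S : Set ℝ, t ∈ S → ContinuousOn g (S ×ˢ univ) →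
      Continuous fun z => g (t, z) := fun g S hS hg =>
    continuousOn_univ.1 (hg.comp (f := fun z => (t, z)) (by fun_prop) fun z _ => ⟨hS, mem_univ _⟩)
  have c1 : Continuous fun z => L t z * v t z i * Q t z :=
    (hLz.continuous.mul (hvz i).continuous).mul hQz.continuous
  have c2 : Continuous fun z => f' t z := hslice _ _ ht hf'c
  have key := integral_divergence_eq_zero
    (X := fun j y => y i * (L t y * (v t y j * Q t y)))
    (fun j => hcoord.fun_mul (hLz.fun_mul ((hvz j).fun_mul hQz))) hK
    (fun j z hz => by simp [hLK t (Ioo_subset_Icc_self ht) z hz])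
    (by
      refine (c1.sub c2).congr fun z => ?_
      exact (hdiv z).symm)
  have key2 : ∫ z, (L t z * v t z i * Q t z - f' t z) = 0 := by
    rw [← key]
    exact integral_congr_ae (ae_of_all _ fun z => (hdiv z).symm)
  rw [← hsupp t (Ioo_subset_Icc_self ht) (fun z => L t z * v t z i * Q t z)
    (fun z hz => by simp [hz])]
  have hz : ∀ z, z ∉ K → L t z * v t z i * Q t z - f' t z = 0 := by
    intro z hz
    rw [← hdiv]
    refine Finset.sum_eq_zero fun j _ => ?_
    have : (fun y => y i * (L t y * (v t y j * Q t y))) =ᶠ[𝓝 z] fun _ => 0 := by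
      filter_upwards [hK.isClosed.isOpen_compl.mem_nhds hz] with y hy
      simp [hLK t (Ioo_subset_Icc_self ht) y hy]
    rw [pd, this.fderiv_eq]
    simp
  rw [← setIntegral_eq_integral_of_forall_compl_eq_zero (s := K) hz,
    integral_sub (c1.continuousOn.integrableOn_compact hK)
      (c2.continuousOn.integrableOn_compact hK)] at key2
  linarith

end Transport

/-! ### The first variation of the action -/

section Variation

variable {M : Mechanics} {ħ : ℝ} {w : PhaseIdx N → ℝ} {J : Set ℝ} {H : Phase N → ℝ}
  {Q : ℝ → Phase N → ℝ} {A : ℝ → Phase N → ℝ}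
  {Γ : PhaseIdx N → PhaseIdx N → ℝ → Phase N → ℝ} {v : ℝ → Phase N → Phase N} {ti tf : ℝ}
  {L : ℝ → Phase N → ℝ} {δz : ℝ → Phase N} {K : Set (Phase N)}

/-- Expressing "for a small radius" through a filter allows finitely many radii to be merged into
one. -/
lemma eventually_nhdsGT_of_antitone {P : ℝ → Prop} (hP : ∀ r s, r ≤ s → P s → P r)
    (h : ∃ ρ > 0, P ρ) : ∀ᶠ ρ in 𝓝[>] 0, P ρ := by
  obtain ⟨ρ, hρ, h⟩ := h
  filter_upwards [Ioc_mem_nhdsGT hρ] with r hr using hP r ρ hr.2 h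

/-- The Hamilton generator after a small time-dependent translation of `H`. -/
lemma SeriesConverge.exists_shift (hħ : 0 < ħ) (hH : ContDiff ℝ ∞ H) (hQ : IsState J Q)
    (hHQ : SeriesConverge M ħ w J H Q) {T : Set ℝ} (hT : IsCompact T) (hTJ : T ⊆ J)
    (hK : IsCompact K) (hδ : Continuous δz) :
    ∃ e : ℝ, 0 < e ∧
      ContinuousOn (fun q : ℝ × ℝ × Phase N =>
        hamGen M ħ w (fun y => H (y + q.1 • δz q.2.1)) (Q q.2.1) q.2.2) (Icc (-e) e ×ˢ T ×ˢ K) ∧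
      (∀ i, ContinuousOn (fun q : ℝ × ℝ × Phase N =>
        hamGen M ħ w (fun y => pd i H (y + q.1 • δz q.2.1)) (Q q.2.1) q.2.2)
          (Icc (-e) e ×ˢ T ×ˢ K)) ∧
      ∀ ε ∈ Ioo (-e) e, ∀ t ∈ T, ∀ z ∈ K,
        HasDerivAt (fun ε : ℝ => hamGen M ħ w (fun y => H (y + ε • δz t)) (Q t) z)
          (∑ i, δz t i * hamGen M ħ w (fun y => pd i H (y + ε • δz t)) (Q t) z) ε := by
  have hC : IsCompact (T ×ˢ K) := hT.prod hK
  have hCJ : T ×ˢ K ⊆ J ×ˢ univ := prod_mono hTJ (subset_univ _)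
  obtain ⟨D, hD⟩ := hT.exists_bound_of_continuousOn hδ.continuousOn
  have E0 := eventually_nhdsGT_of_antitone (fun r s hrs hs => hs.mono (prod_mono
    (Metric.closedBall_subset_closedBall hrs) subset_rfl))
    (hHQ.continuousOn_shift hħ hH hQ (α := []) (β := []) (by simp) (by simp) hC hCJ)
  have E1 := fun i : PhaseIdx N => eventually_nhdsGT_of_antitone (fun r s hrs hs => hs.mono
    (prod_mono (Metric.closedBall_subset_closedBall hrs) subset_rfl))
    (hHQ.continuousOn_shift hħ hH hQ (α := [i]) (β := []) (by simp) (by simp) hC hCJ)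
  have E2 := eventually_nhdsGT_of_antitone (fun r s hrs hs t z htz δ ε hε =>
    hs t z htz δ ε (hε.trans_le hrs)) (hHQ.hasDerivAt_shift hħ hH hC hCJ)
  obtain ⟨ρ, ⟨⟨h0, h1⟩, h2⟩, hρ⟩ :=
    (((E0.and (eventually_all.2 E1)).and E2).and self_mem_nhdsWithin).exists
  have hρ : 0 < ρ := hρ
  -- With `D` bounding `δz` on `T`, parameters up to `ρ / (|D| + 1)` give translations of norm at
  -- most `ρ`.
  have hD1 : 0 < |D| + 1 := by positivity
  have hsmall : ∀ ε, ∀ t ∈ T, |ε| * ‖δz t‖ ≤ |ε| * (|D| + 1) := fun ε t ht => by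
    have := (hD t ht).trans (le_abs_self D)
    gcongr
    linarith
  have hmaps : MapsTo (fun q : ℝ × ℝ × Phase N => (q.1 • δz q.2.1, q.2))
      (Icc (-(ρ / (|D| + 1))) (ρ / (|D| + 1)) ×ˢ T ×ˢ K)
      (Metric.closedBall (0 : Phase N) ρ ×ˢ T ×ˢ K) := by
    rintro ⟨ε, t, z⟩ ⟨hε, ht, hz⟩
    refine ⟨?_, ht, hz⟩
    rw [mem_closedBall_zero_iff, norm_smul, Real.norm_eq_abs]
    refine (hsmall ε t ht).trans ?_
    have := abs_le.2 ⟨hε.1, hε.2⟩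
    rwa [le_div_iff₀ hD1] at this
  refine ⟨ρ / (|D| + 1), by positivity, ?_, fun i => ?_, fun ε hε t ht z hz => ?_⟩
  · exact h0.comp (f := fun q : ℝ × ℝ × Phase N => (q.1 • δz q.2.1, q.2))
      (by fun_prop) hmaps
  · exact (h1 i).comp (f := fun q : ℝ × ℝ × Phase N => (q.1 • δz q.2.1, q.2))
      (by fun_prop) hmaps
  · refine h2 t z ⟨ht, hz⟩ (δz t) ε ((hsmall ε t ht).trans_lt ?_)
    have := abs_lt.2 ⟨hε.1, hε.2⟩
    rwa [lt_div_iff₀ hD1] at this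

/-- The kinetic, dynamic and gauge parts of the integrand of the varied action, in coordinates
that are carried along with the fluid parcels. -/
def kinPart (Q : ℝ → Phase N → ℝ) (v : ℝ → Phase N → Phase N) (L : ℝ → Phase N → ℝ)
    (δz : ℝ → Phase N) (ε t : ℝ) (z : Phase N) : ℝ :=
  L t z * (∑ n : Fin N, (z + ε • δz t) (Sum.inr n) * (v t z + ε • deriv δz t) (Sum.inl n)) * Q t z


def dynPart (M : Mechanics) (ħ : ℝ) (w : PhaseIdx N → ℝ) (H : Phase N → ℝ)
    (Q : ℝ → Phase N → ℝ) (L : ℝ → Phase N → ℝ) (δz : ℝ → Phase N) (ε t : ℝ) (z : Phase N) : ℝ :=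
  L t z * hamGen M ħ w (fun y => H (y + ε • δz t)) (Q t) z


def gaugePart (A : ℝ → Phase N → ℝ) (Γ : PhaseIdx N → PhaseIdx N → ℝ → Phase N → ℝ)
    (L : ℝ → Phase N → ℝ) (δz : ℝ → Phase N) (ε t : ℝ) (z : Phase N) : ℝ :=
  L t z * (A t (z + ε • δz t) + ∑ i, zTilde (z + ε • δz t) i * vecGauge Γ t z i)

/-- Substituting `z + ε δz(t)` for `z` in each phase-space integral removes the shift from
everything attached to the parcels. Since the generator is translation invariant, `H` is then
displaced against an unmoved `Q`. -/
lemma extAction_shift (ε : ℝ) :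
    extAction M ħ w H A ti tf (shiftBy ε δz Q) (shiftVelocity ε δz v) (shiftBy ε δz L)
      (fun i j => shiftBy ε δz (Γ i j))
      = ∫ t in ti..tf, ((∫ z, kinPart Q v L δz ε t z) - (∫ z, dynPart M ħ w H Q L δz ε t z)
          + ∫ z, gaugePart A Γ L δz ε t z) := by
  unfold extAction
  congr 1
  funext t
  have hs : ∀ f : Phase N → ℝ, ∫ z, f z = ∫ z, f (z + ε • δz t) := fun f =>
    (integral_add_right_eq_self f _).symm
  congr 1
  · congr 1
    · rw [hs]
      simp [kinPart, shiftBy, shiftVelocity]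
    · rw [hs]
      refine integral_congr_ae (ae_of_all _ fun z => ?_)
      simp [dynPart, shiftBy, hamGen_shift]
  · rw [hs]
    refine integral_congr_ae (ae_of_all _ fun z => ?_)
    have hg : ∀ i, vecGauge (fun i j => shiftBy ε δz (Γ i j)) t (z + ε • δz t) i
        = vecGauge Γ t z i := by
      intro i
      unfold vecGauge
      refine Finset.sum_congr rfl fun j _ => ?_
      have := congrFun (pd_shift j (Γ i j t) (-(ε • δz t))) (z + ε • δz t)
      have h2 : shiftBy ε δz (Γ i j) t = fun y => Γ i j t (y + -(ε • δz t)) := by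
        funext y
        simp [shiftBy, sub_eq_add_neg]
      beta_reduce
      rw [h2, this]
      simp
    simp [gaugePart, shiftBy, hg]

lemma zTilde_add (x y : Phase N) (i : PhaseIdx N) : zTilde (x + y) i = zTilde x i + zTilde y i := by
  rcases i with n | n <;> simp [zTilde]
  ring

lemma zTilde_smul (c : ℝ) (x : Phase N) (i : PhaseIdx N) :
    zTilde (c • x) i = c * zTilde x i := by
  rcases i with n | n <;> simp [zTilde]

lemma continuous_zTilde (i : PhaseIdx N) : Continuous fun z : Phase N => zTilde z i := by
  rcases i with n | n <;> simp only [zTilde] <;> fun_prop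

/-- The derivative of `kinPart` in the variation parameter. -/
def kinDeriv (Q : ℝ → Phase N → ℝ) (v : ℝ → Phase N → Phase N) (L : ℝ → Phase N → ℝ)
    (δz : ℝ → Phase N) (ε t : ℝ) (z : Phase N) : ℝ :=
  L t z * (∑ n : Fin N, (δz t (Sum.inr n) * (v t z + ε • deriv δz t) (Sum.inl n)
    + (z + ε • δz t) (Sum.inr n) * deriv δz t (Sum.inl n))) * Q t z

/-- The derivative of `dynPart` in the variation parameter. -/
def dynDeriv (M : Mechanics) (ħ : ℝ) (w : PhaseIdx N → ℝ) (H : Phase N → ℝ)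
    (Q : ℝ → Phase N → ℝ) (L : ℝ → Phase N → ℝ) (δz : ℝ → Phase N) (ε t : ℝ) (z : Phase N) : ℝ :=
  L t z * ∑ i, δz t i * hamGen M ħ w (fun y => pd i H (y + ε • δz t)) (Q t) z

/-- The derivative of `gaugePart` in the variation parameter. -/
def gaugeDeriv (A : ℝ → Phase N → ℝ) (Γ : PhaseIdx N → PhaseIdx N → ℝ → Phase N → ℝ)
    (L : ℝ → Phase N → ℝ) (δz : ℝ → Phase N) (ε t : ℝ) (z : Phase N) : ℝ :=
  L t z * ((∑ i, δz t i * pd i (A t) (z + ε • δz t)) + ∑ i, zTilde (δz t) i * vecGauge Γ t z i)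

lemma hasDerivAt_kinPart (ε t : ℝ) (z : Phase N) :
    HasDerivAt (fun ε => kinPart Q v L δz ε t z) (kinDeriv Q v L δz ε t z) ε := by
  unfold kinPart kinDeriv
  refine HasDerivAt.mul_const (HasDerivAt.const_mul _ (HasDerivAt.fun_sum fun n _ => ?_)) _
  have h : ∀ (a : Phase N) (b : Phase N) (i : PhaseIdx N),
      HasDerivAt (fun ε : ℝ => (a + ε • b) i) (b i) ε := fun a b i => by
    simpa using ((hasDerivAt_id ε).mul_const (b i)).const_add (a i)
  exact (h _ _ _).mul (h _ _ _)

lemma hasDerivAt_gaugePart (hJ : IsOpen J) (hA : TwiceDifferentiable J A) {t : ℝ} (ht : t ∈ J)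
    (ε : ℝ) (z : Phase N) :
    HasDerivAt (fun ε => gaugePart A Γ L δz ε t z) (gaugeDeriv A Γ L δz ε t z) ε := by
  unfold gaugePart gaugeDeriv
  refine HasDerivAt.const_mul _ (HasDerivAt.add (hasDerivAt_line (hA.differentiable hJ ht _))
    (HasDerivAt.fun_sum fun i _ => HasDerivAt.mul_const ?_ _))
  simp only [zTilde_add, zTilde_smul]
  simpa using ((hasDerivAt_id ε).mul_const (zTilde (δz t) i)).const_add (zTilde z i)

/-! ### Joint continuity of the varied integrands and their derivatives -/

section Continuity

variable {S : Set ℝ}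

lemma continuousOn_lift {g : ℝ × Phase N → ℝ} {T : Set ℝ} {U : Set (Phase N)}
    (hg : ContinuousOn g (T ×ˢ U)) :
    ContinuousOn (fun q : ℝ × ℝ × Phase N => g q.2) (S ×ˢ T ×ˢ U) :=
  hg.comp (by fun_prop) fun q hq => hq.2

lemma continuousOn_kin (hQ : IsState J Q) (hv : IsVelocity J v) (hIJ : Icc ti tf ⊆ J)
    (hL : ContinuousOn (fun q : ℝ × Phase N => L q.1 q.2) (Icc ti tf ×ˢ K))
    (hδ : ContDiff ℝ 1 δz) :
    ContinuousOn (fun q : ℝ × ℝ × Phase N => kinPart Q v L δz q.1 q.2.1 q.2.2)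
        (S ×ˢ Icc ti tf ×ˢ K) ∧
      ContinuousOn (fun q : ℝ × ℝ × Phase N => kinDeriv Q v L δz q.1 q.2.1 q.2.2)
        (S ×ˢ Icc ti tf ×ˢ K) := by
  have hsub : Icc ti tf ×ˢ K ⊆ J ×ˢ univ := prod_mono hIJ (subset_univ _)
  have cL := continuousOn_lift (S := S) hL
  have cQ := continuousOn_lift (S := S) ((hQ.continuousOn_pdList []).mono hsub)
  simp only [pdList_nil] at cQ
  have cv : ∀ i, ContinuousOn (fun q : ℝ × ℝ × Phase N => v q.2.1 q.2.2 i)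
      (S ×ˢ Icc ti tf ×ˢ K) := fun i =>
    continuousOn_lift (S := S) ((continuousOn_pi.1 hv.1 i).mono hsub)
  have cδ := hδ.continuous
  have cδ' : Continuous (deriv δz) := hδ.continuous_deriv le_rfl
  have cδ'i : ∀ i, Continuous fun t => deriv δz t i := fun i => continuous_pi_iff.1 cδ' i
  have cδi : ∀ i, Continuous fun t => δz t i := fun i => continuous_pi_iff.1 cδ i
  unfold kinPart kinDeriv
  simp only [Pi.add_apply, Pi.smul_apply, smul_eq_mul]
  constructor
  · refine (cL.mul (continuousOn_finsetSum _ fun n _ => ContinuousOn.mul ?_ ?_)).mul cQ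
    · exact Continuous.continuousOn (by fun_prop)
    · exact (cv _).add (Continuous.continuousOn (by fun_prop))
  · refine (cL.mul (continuousOn_finsetSum _ fun n _ => ContinuousOn.add (ContinuousOn.mul ?_ ?_)
      ?_)).mul cQ
    · exact Continuous.continuousOn (by fun_prop)
    · exact (cv _).add (Continuous.continuousOn (by fun_prop))
    · exact Continuous.continuousOn (by fun_prop)

lemma continuousOn_gauge (hJ : IsOpen J) (hA : TwiceDifferentiable J A)
    (hΓ : ∀ i j, TwiceDifferentiable J (Γ i j)) (hIJ : Icc ti tf ⊆ J)
    (hL : ContinuousOn (fun q : ℝ × Phase N => L q.1 q.2) (Icc ti tf ×ˢ K))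
    (hδ : Continuous δz) :
    ContinuousOn (fun q : ℝ × ℝ × Phase N => gaugePart A Γ L δz q.1 q.2.1 q.2.2)
        (S ×ˢ Icc ti tf ×ˢ K) ∧
      ContinuousOn (fun q : ℝ × ℝ × Phase N => gaugeDeriv A Γ L δz q.1 q.2.1 q.2.2)
        (S ×ˢ Icc ti tf ×ˢ K) := by
  have hsub : Icc ti tf ×ˢ K ⊆ J ×ˢ univ := prod_mono hIJ (subset_univ _)
  have cL := continuousOn_lift (S := S) hL
  have cG : ∀ i, ContinuousOn (fun q : ℝ × ℝ × Phase N => vecGauge Γ q.2.1 q.2.2 i)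
      (S ×ˢ Icc ti tf ×ˢ K) := fun i =>
    continuousOn_lift (S := S) ((continuousOn_vecGauge hJ hΓ i).mono hsub)
  have cs : ∀ g : ℝ × Phase N → ℝ, ContinuousOn g (J ×ˢ univ) →
      ContinuousOn (fun q : ℝ × ℝ × Phase N => g (q.2.1, q.2.2 + q.1 • δz q.2.1))
        (S ×ˢ Icc ti tf ×ˢ K) := fun g hg =>
    hg.comp (by fun_prop) fun q hq => ⟨hIJ hq.2.1, mem_univ _⟩
  have cδi : ∀ i, Continuous fun t => δz t i := fun i => continuous_pi_iff.1 hδ i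
  unfold gaugePart gaugeDeriv
  constructor
  · refine cL.mul ((cs _ hA.continuousOn).add (continuousOn_finsetSum _ fun i _ =>
      ContinuousOn.mul (Continuous.continuousOn ?_) (cG i)))
    exact (continuous_zTilde i).comp (by fun_prop)
  · refine cL.mul ((continuousOn_finsetSum _ fun i _ => ContinuousOn.mul
      (Continuous.continuousOn (by fun_prop)) (cs _ (hA.continuousOn_pd hJ i))).add
      (continuousOn_finsetSum _ fun i _ =>
      ContinuousOn.mul (Continuous.continuousOn ?_) (cG i)))
    exact (continuous_zTilde i).comp (by fun_prop)

end Continuity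

lemma setIntegral_Icc_prod {f : ℝ × Phase N → ℝ} (hK : IsCompact K) (htt : ti ≤ tf)
    (hf : ContinuousOn f (Icc ti tf ×ˢ K)) :
    ∫ q in Icc ti tf ×ˢ K, f q = ∫ t in ti..tf, ∫ z in K, f (t, z) := by
  rw [intervalIntegral.integral_of_le htt, ← integral_Icc_eq_integral_Ioc]
  rw [Measure.volume_eq_prod, setIntegral_prod]
  rw [← Measure.volume_eq_prod]
  exact hf.integrableOn_compact (isCompact_Icc.prod hK)

lemma continuousOn_slice {f : ℝ × Phase N → ℝ} {T : Set ℝ} {U : Set (Phase N)} {t : ℝ}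
    (ht : t ∈ T) (hf : ContinuousOn f (T ×ˢ U)) : ContinuousOn (fun z => f (t, z)) U :=
  hf.comp (by fun_prop) fun _ hz => ⟨ht, hz⟩

/-- The terms with the time derivative of the variation and those with `ṗ` form a total time
derivative. -/
lemma IsLabel.integral_boundary (hQ : IsState J Q) (hv : IsVelocity J v)
    (hcont : ContinuityEq J Q v) (htt : ti < tf) (hIJ : Icc ti tf ⊆ J) (hL : IsLabel v ti tf L)
    (hδ : ContDiff ℝ 1 δz) (hδi : δz ti = 0) (hδf : δz tf = 0) (i j : PhaseIdx N) :
    ∫ t in ti..tf, (deriv δz t j * (∫ z, L t z * z i * Q t z)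
      + δz t j * ∫ z, L t z * v t z i * Q t z) = 0 := by
  obtain ⟨K, hK, hLK⟩ := hL.2.1
  have hsub : Icc ti tf ×ˢ univ ⊆ J ×ˢ (univ : Set (Phase N)) := prod_mono hIJ subset_rfl
  have cQ : ContinuousOn (fun q : ℝ × Phase N => Q q.1 q.2) (Icc ti tf ×ˢ univ) :=
    (hQ.continuousOn_pdList []).mono hsub
  have c1 : ContinuousOn (fun t => ∫ z, L t z * z i * Q t z) (Icc ti tf) :=
    continuousOn_integral_of_compact_support hK
      ((hL.1.continuousOn.mul (Continuous.continuousOn (by fun_prop))).mul cQ)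
      fun t z ht hz => by simp [hLK t ht z hz]
  have c2 : ContinuousOn (fun t => ∫ z, L t z * v t z i * Q t z) (Icc ti tf) :=
    continuousOn_integral_of_compact_support hK
      ((hL.1.continuousOn.mul ((continuousOn_pi.1 hv.1 i).mono hsub)).mul cQ)
      fun t z ht hz => by simp [hLK t ht z hz]
  have cδ : Continuous fun t => δz t j := continuous_pi_iff.1 hδ.continuous j
  have cδ' : Continuous fun t => deriv δz t j :=
    continuous_pi_iff.1 (hδ.continuous_deriv le_rfl) j
  have hδd : ∀ t, HasDerivAt (fun t => δz t j) (deriv δz t j) t := fun t =>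
    hasDerivAt_pi.1 ((hδ.differentiable one_ne_zero) t).hasDerivAt j
  -- The integrand is the derivative of `δz_j ⟨L z_i Q⟩` at interior times. The fundamental theorem
  -- asks only for continuity at the end points, where `δz` vanishes.
  rw [integral_eq_of_hasDerivAt_off_countable_of_le
    (fun t => δz t j * ∫ z, L t z * z i * Q t z) _ htt.le countable_empty
    (cδ.continuousOn.mul c1)
    (fun t ht => (hδd t).mul (hL.hasDerivAt_moment hQ hv hcont hIJ i ht.1))]
  · simp [hδi, hδf]
  · refine ContinuousOn.intervalIntegrable ?_
    rw [uIcc_of_le htt.le]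
    exact (cδ'.continuousOn.mul c1).add (cδ.continuousOn.mul c2)

/-- The first variation of the extended action. -/
theorem IsLabel.hasDerivAt_extAction (hħ : 0 < ħ) (hJ : IsOpen J) (hH : ContDiff ℝ ∞ H)
    (hQ : IsState J Q) (hHQ : SeriesConverge M ħ w J H Q) (hA : TwiceDifferentiable J A)
    (hΓ : ∀ i j, TwiceDifferentiable J (Γ i j)) (hv : IsVelocity J v)
    (hcont : ContinuityEq J Q v) (htt : ti < tf) (hIJ : Icc ti tf ⊆ J) (hL : IsLabel v ti tf L)
    (hδ : ContDiff ℝ 1 δz) (hδi : δz ti = 0) (hδf : δz tf = 0) :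
    HasDerivAt (fun ε : ℝ => extAction M ħ w H A ti tf (shiftBy ε δz Q)
        (shiftVelocity ε δz v) (shiftBy ε δz L) (fun i j => shiftBy ε δz (Γ i j)))
      (∫ t in ti..tf, ∑ i, zTilde (δz t) i *
        ∫ z, L t z * (v t z i * Q t z - hamFlux M ħ w H A Γ Q t z i)) 0 := by
  obtain ⟨K, hK, hLK⟩ := hL.2.1
  have hsub : Icc ti tf ×ˢ K ⊆ J ×ˢ univ := prod_mono hIJ (subset_univ _)
  obtain ⟨e, he, s0, s1, s2⟩ := hHQ.exists_shift hħ hH hQ isCompact_Icc hIJ hK hδ.continuous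
  have cLu : ContinuousOn (fun q : ℝ × Phase N => L q.1 q.2) (Icc ti tf ×ˢ univ) :=
    hL.1.continuousOn
  have cL : ContinuousOn (fun q : ℝ × Phase N => L q.1 q.2) (Icc ti tf ×ˢ K) :=
    cLu.mono (prod_mono subset_rfl (subset_univ _))
  have cδi : ∀ i, Continuous fun t => δz t i := fun i => continuous_pi_iff.1 hδ.continuous i
  obtain ⟨k0, k1⟩ := continuousOn_kin (S := Icc (-e) e) (K := K) hQ hv hIJ cL hδ
  obtain ⟨g0, g1⟩ := continuousOn_gauge (S := Icc (-e) e) (K := K) hJ hA hΓ hIJ cL hδ.continuous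
  have d0 : ContinuousOn (fun q : ℝ × ℝ × Phase N => dynPart M ħ w H Q L δz q.1 q.2.1 q.2.2)
      (Icc (-e) e ×ˢ Icc ti tf ×ˢ K) := (continuousOn_lift cL).mul s0
  have d1 : ContinuousOn (fun q : ℝ × ℝ × Phase N => dynDeriv M ħ w H Q L δz q.1 q.2.1 q.2.2)
      (Icc (-e) e ×ˢ Icc ti tf ×ˢ K) :=
    (continuousOn_lift cL).mul (continuousOn_finsetSum _ fun i _ =>
      (Continuous.continuousOn (by have := cδi i; fun_prop)).mul (s1 i))
  -- Time and phase space are treated as one compact product domain, so a single differentiation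
  -- under the integral sign suffices; Fubini separates them again.
  set Φ : ℝ → ℝ × Phase N → ℝ := fun ε q => kinPart Q v L δz ε q.1 q.2
    - dynPart M ħ w H Q L δz ε q.1 q.2 + gaugePart A Γ L δz ε q.1 q.2 with hΦ
  set Φ' : ℝ → ℝ × Phase N → ℝ := fun ε q => kinDeriv Q v L δz ε q.1 q.2
    - dynDeriv M ħ w H Q L δz ε q.1 q.2 + gaugeDeriv A Γ L δz ε q.1 q.2 with hΦ'
  have cΦ : ContinuousOn (fun q : ℝ × ℝ × Phase N => Φ q.1 q.2) (Icc (-e) e ×ˢ Icc ti tf ×ˢ K) :=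
    (k0.sub d0).add g0
  have cΦ' : ContinuousOn (fun q : ℝ × ℝ × Phase N => Φ' q.1 q.2)
      (Icc (-e) e ×ˢ Icc ti tf ×ˢ K) := (k1.sub d1).add g1
  have slice3 : ∀ f : ℝ × ℝ × Phase N → ℝ, ContinuousOn f (Icc (-e) e ×ˢ Icc ti tf ×ˢ K) →
      ∀ ε ∈ Icc (-e) e, ContinuousOn (fun q => f (ε, q)) (Icc ti tf ×ˢ K) := fun f hf ε hε =>
    hf.comp (by fun_prop) fun q hq => ⟨hε, hq⟩
  have hsupp : ∀ s ∈ Icc ti tf, ∀ g : Phase N → ℝ, (∀ z, L s z = 0 → g z = 0) →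
      ∫ z in K, g z = ∫ z, g z := fun s hs g hg =>
    setIntegral_eq_integral_of_forall_compl_eq_zero fun z hz => hg z (hLK s hs z hz)
  have hder := hasDerivAt_setIntegral_of_continuousOn (μ := (volume : Measure (ℝ × Phase N)))
    (isCompact_Icc.prod hK) (measurableSet_Icc.prod hK.measurableSet) (f := Φ) (f' := Φ')
    (a := -e) (b := e) (s₀ := 0) ⟨by linarith, he⟩ cΦ cΦ'
    (fun ε hε q hq => ((hasDerivAt_kinPart ε q.1 q.2).sub
      ((s2 ε hε q.1 hq.1 q.2 hq.2).const_mul (L q.1 q.2))).add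
      (hasDerivAt_gaugePart hJ hA (hIJ hq.1) ε q.2))
  have h0 : (0 : ℝ) ∈ Icc (-e) e := ⟨by linarith, he.le⟩
  have hS : HasDerivAt (fun ε : ℝ => extAction M ħ w H A ti tf (shiftBy ε δz Q)
        (shiftVelocity ε δz v) (shiftBy ε δz L) (fun i j => shiftBy ε δz (Γ i j)))
      (∫ q in Icc ti tf ×ˢ K, Φ' 0 q) 0 := by
    refine hder.congr_of_eventuallyEq ?_
    filter_upwards [Icc_mem_nhds (by linarith : -e < 0) he] with ε hε
    rw [extAction_shift, setIntegral_Icc_prod hK htt.le (slice3 _ cΦ ε hε)]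
    refine intervalIntegral.integral_congr fun t ht => ?_
    rw [uIcc_of_le htt.le] at ht
    have ik : IntegrableOn (fun z => kinPart Q v L δz ε t z) K :=
      (continuousOn_slice ht (slice3 _ k0 ε hε)).integrableOn_compact hK
    have id : IntegrableOn (fun z => dynPart M ħ w H Q L δz ε t z) K :=
      (continuousOn_slice ht (slice3 _ d0 ε hε)).integrableOn_compact hK
    have ig : IntegrableOn (fun z => gaugePart A Γ L δz ε t z) K :=
      (continuousOn_slice ht (slice3 _ g0 ε hε)).integrableOn_compact hK
    simp only [hΦ]
    rw [← hsupp t ht (fun z => kinPart Q v L δz ε t z) (fun z hz => by simp [kinPart, hz]),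
      ← hsupp t ht (fun z => dynPart M ħ w H Q L δz ε t z) (fun z hz => by simp [dynPart, hz]),
      ← hsupp t ht (fun z => gaugePart A Γ L δz ε t z) (fun z hz => by simp [gaugePart, hz])]
    rw [← integral_sub ik id, ← integral_add (f := fun z => kinPart Q v L δz ε t z
      - dynPart M ħ w H Q L δz ε t z) (ik.sub id) ig]
  refine hS.congr_deriv ?_
  rw [setIntegral_Icc_prod hK htt.le (slice3 _ cΦ' 0 h0)]
  -- the residual of the extended Hamilton equations, and the total time derivative
  have cQ : ContinuousOn (fun q : ℝ × Phase N => Q q.1 q.2) (J ×ˢ univ) :=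
    hQ.continuousOn_pdList []
  have cE : ∀ i, ContinuousOn (fun q : ℝ × Phase N => L q.1 q.2 *
      (v q.1 q.2 i * Q q.1 q.2 - hamFlux M ħ w H A Γ Q q.1 q.2 i)) (Icc ti tf ×ˢ univ) := fun i =>
    cLu.mul ((((continuousOn_pi.1 hv.1 i).mul cQ).sub
      (continuousOn_hamFlux hħ hJ hH hQ hHQ hA hΓ i)).mono (prod_mono hIJ subset_rfl))
  have cm : ∀ i, ContinuousOn (fun q : ℝ × Phase N => L q.1 q.2 * q.2 i * Q q.1 q.2)
      (Icc ti tf ×ˢ univ) := fun i =>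
    (cLu.mul (Continuous.continuousOn (by fun_prop))).mul (cQ.mono (prod_mono hIJ subset_rfl))
  have cmv : ∀ i, ContinuousOn (fun q : ℝ × Phase N => L q.1 q.2 * v q.1 q.2 i * Q q.1 q.2)
      (Icc ti tf ×ˢ univ) := fun i =>
    (cLu.mul ((continuousOn_pi.1 hv.1 i).mono (prod_mono hIJ subset_rfl))).mul
      (cQ.mono (prod_mono hIJ subset_rfl))
  have toInt : ∀ f : ℝ × Phase N → ℝ, ContinuousOn f (Icc ti tf ×ˢ univ) → ∀ t ∈ Icc ti tf,
      IntegrableOn (fun z => f (t, z)) K := fun f hf t ht =>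
    ((continuousOn_slice ht hf).mono (subset_univ _)).integrableOn_compact hK
  -- The conjugate of `δz` paired with `v` is `δp·ẋ - δx·ṗ`. Adding and subtracting `δx·ṗ` produces
  -- the residual and the integrand of the boundary term.
  have hpoint : ∀ t ∈ Icc ti tf, ∀ z, Φ' 0 (t, z)
      = (∑ i, zTilde (δz t) i * (L t z * (v t z i * Q t z - hamFlux M ħ w H A Γ Q t z i)))
        + ∑ n : Fin N, (deriv δz t (Sum.inl n) * (L t z * z (Sum.inr n) * Q t z)
          + δz t (Sum.inl n) * (L t z * v t z (Sum.inr n) * Q t z)) := by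
    intro t ht z
    simp only [hΦ', kinDeriv, dynDeriv, gaugeDeriv, zero_smul, add_zero, Fintype.sum_sum_type,
      hamFlux, hamGen_pdTilde_inl, hamGen_pdTilde_inr]
    simp only [zTilde, pdTilde]
    simp only [Finset.mul_sum, mul_add, Finset.sum_mul, ← Finset.sum_add_distrib,
      ← Finset.sum_sub_distrib]
    refine Finset.sum_congr rfl fun n _ => ?_
    ring
  have hinner : ∀ t ∈ Icc ti tf, ∫ z in K, Φ' 0 (t, z)
      = (∑ i, zTilde (δz t) i *
          ∫ z, L t z * (v t z i * Q t z - hamFlux M ħ w H A Γ Q t z i))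
        + ∑ n : Fin N, (deriv δz t (Sum.inl n) * (∫ z, L t z * z (Sum.inr n) * Q t z)
          + δz t (Sum.inl n) * ∫ z, L t z * v t z (Sum.inr n) * Q t z) := by
    intro t ht
    have i1 : ∀ i, IntegrableOn (fun z => zTilde (δz t) i *
        (L t z * (v t z i * Q t z - hamFlux M ħ w H A Γ Q t z i))) K := fun i =>
      (toInt _ (cE i) t ht).const_mul _
    have i2 : ∀ n : Fin N, IntegrableOn (fun z => deriv δz t (Sum.inl n)
        * (L t z * z (Sum.inr n) * Q t z)) K := fun n => (toInt _ (cm _) t ht).const_mul _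
    have i3 : ∀ n : Fin N, IntegrableOn (fun z => δz t (Sum.inl n)
        * (L t z * v t z (Sum.inr n) * Q t z)) K := fun n => (toInt _ (cmv _) t ht).const_mul _
    have i4 : ∀ n : Fin N, IntegrableOn (fun z => deriv δz t (Sum.inl n)
        * (L t z * z (Sum.inr n) * Q t z) + δz t (Sum.inl n)
        * (L t z * v t z (Sum.inr n) * Q t z)) K := fun n => (i2 n).add (i3 n)
    simp only [hpoint t ht]
    rw [integral_add (integrable_finsetSum _ fun i _ => i1 i)
      (integrable_finsetSum _ fun n _ => i4 n), integral_finsetSum _ fun i _ => i1 i,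
      integral_finsetSum _ fun n _ => i4 n]
    congr 1
    · refine Finset.sum_congr rfl fun i _ => ?_
      rw [integral_const_mul, hsupp t ht _ fun z hz => by simp [hz]]
    · refine Finset.sum_congr rfl fun n _ => ?_
      rw [integral_add (i2 n) (i3 n), integral_const_mul, integral_const_mul,
        hsupp t ht (fun z => L t z * z (Sum.inr n) * Q t z) (fun z hz => by simp [hz]),
        hsupp t ht (fun z => L t z * v t z (Sum.inr n) * Q t z) (fun z hz => by simp [hz])]
  have hcI : ∀ f : ℝ × Phase N → ℝ, ContinuousOn f (Icc ti tf ×ˢ univ) →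
      (∀ t z, L t z = 0 → f (t, z) = 0) →
      ContinuousOn (fun t => ∫ z, f (t, z)) (Icc ti tf) := fun f hf hf0 =>
    continuousOn_integral_of_compact_support hK (f := fun t z => f (t, z)) hf
      fun t z ht hz => hf0 t z (hLK t ht z hz)
  have cδ' : ∀ i, Continuous fun t => deriv δz t i := fun i =>
    continuous_pi_iff.1 (hδ.continuous_deriv le_rfl) i
  have toII : ∀ f : ℝ → ℝ, ContinuousOn f (Icc ti tf) → IntervalIntegrable f volume ti tf :=
    fun f hf => ContinuousOn.intervalIntegrable (by rwa [uIcc_of_le htt.le])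
  have J0 : ∀ n : Fin N, ContinuousOn (fun t => deriv δz t (Sum.inl n)
      * (∫ z, L t z * z (Sum.inr n) * Q t z)
          + δz t (Sum.inl n) * ∫ z, L t z * v t z (Sum.inr n) * Q t z) (Icc ti tf) := fun n =>
    ((cδ' _).continuousOn.mul (hcI _ (cm _) fun t z h => by simp [h])).add
      ((cδi _).continuousOn.mul (hcI _ (cmv _) fun t z h => by simp [h]))
  have J2 : IntervalIntegrable (fun t => ∑ i, zTilde (δz t) i *
          ∫ z, L t z * (v t z i * Q t z - hamFlux M ħ w H A Γ Q t z i)) volume ti tf :=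
    toII _ (continuousOn_finsetSum _ fun i _ =>
      (((continuous_zTilde i).comp hδ.continuous).continuousOn.mul
        (hcI _ (cE i) fun t z h => by simp [h])))
  rw [intervalIntegral.integral_congr (fun t ht => hinner t (by rwa [uIcc_of_le htt.le] at ht)),
    intervalIntegral.integral_add J2 (toII _ (continuousOn_finsetSum _ fun n _ => J0 n)),
    intervalIntegral.integral_finsetSum fun n _ => toII _ (J0 n),
    Finset.sum_eq_zero fun n _ => hL.integral_boundary hQ hv hcont htt hIJ hδ hδi hδf _ _,
    add_zero]

/-- The extended Hamilton equations imply the variation principle. -/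
theorem ExtHamiltonEq.variationPrinciple (hħ : 0 < ħ) (hJ : IsOpen J) (hH : ContDiff ℝ ∞ H)
    (hQ : IsState J Q) (hHQ : SeriesConverge M ħ w J H Q) (hA : TwiceDifferentiable J A)
    (hΓ : ∀ i j, TwiceDifferentiable J (Γ i j)) (hv : IsVelocity J v)
    (hcont : ContinuityEq J Q v) (heq : ExtHamiltonEq M ħ w J H A Γ Q v) :
    VariationPrinciple M ħ w J H A Γ Q v := by
  intro ti tf htt hIJ L hL δz hδ hδi hδf
  refine (hL.hasDerivAt_extAction hħ hJ hH hQ hHQ hA hΓ hv hcont htt hIJ hδ hδi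
    hδf).congr_deriv ?_
  rw [intervalIntegral.integral_congr (g := fun _ => 0)]
  · simp
  · intro t ht
    rw [uIcc_of_le htt.le] at ht
    have : ∀ z i, v t z i * Q t z - hamFlux M ħ w H A Γ Q t z i = 0 := fun z i =>
      sub_eq_zero.2 (heq t (hIJ ht) z i)
    simp [this]

end Variation

/-! ### Differentiability of superposition operators on spaces of continuous functions -/

section Superposition

variable {I E F : Type*} [TopologicalSpace I] [NormedAddCommGroup E] [NormedAddCommGroup F]

/-- The superposition operator `γ ↦ (r ↦ f (r, γ r))`. -/
def superposition (f : C(I × E, F)) (γ : C(I, E)) : C(I, F) :=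
  f.comp ((ContinuousMap.id I).prodMk γ)

@[simp]
lemma superposition_apply (f : C(I × E, F)) (γ : C(I, E)) (r : I) :
    superposition f γ r = f (r, γ r) := rfl

/-- By currying, continuity into the compact-open topology reduces to joint continuity, and
evaluation is jointly continuous because `I` is compact. -/
lemma continuous_superposition [CompactSpace I] (f : C(I × E, F)) : Continuous (superposition f) := by
  refine ContinuousMap.continuous_of_continuous_uncurry _ ?_
  exact f.continuous.comp (continuous_snd.prodMk continuous_eval)

variable [CompactSpace I] [NormedSpace ℝ E] [NormedSpace ℝ F]

/-- Pointwise application of a continuous family of continuous linear maps. -/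
def pointwiseApply : C(I, E →L[ℝ] F) →L[ℝ] C(I, E) →L[ℝ] C(I, F) :=
  LinearMap.mkContinuous₂
    (LinearMap.mk₂ ℝ (fun (A : C(I, E →L[ℝ] F)) (h : C(I, E)) => (⟨fun r => A r (h r), by fun_prop⟩ : C(I, F)))
      (fun A B h => by ext r; simp) (fun c A h => by ext r; simp)
      (fun A h k => by ext r; simp) (fun c A h => by ext r; simp)) 1
    (fun A h => by
      rw [one_mul]
      refine (ContinuousMap.norm_le _ (by positivity)).2 fun r => ?_
      refine ((A r).le_opNorm _).trans ?_
      gcongr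
      · exact A.norm_coe_le_norm r
      · exact h.norm_coe_le_norm r)

@[simp]
lemma pointwiseApply_apply (A : C(I, E →L[ℝ] F)) (h : C(I, E)) (r : I) :
    pointwiseApply A h r = A r (h r) := rfl

/-- The mean value inequality is applied at each `r`, with a constant independent of `r`: continuity
of the superposition operator of `f'` at `γ` controls `f'` uniformly along `γ`. No compactness of
balls in `E` is needed. -/
lemma hasFDerivAt_superposition (f : C(I × E, F)) (f' : C(I × E, E →L[ℝ] F))
    (hf : ∀ r x, HasFDerivAt (fun y => f (r, y)) (f' (r, x)) x) (γ : C(I, E)) :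
    HasFDerivAt (superposition f) (pointwiseApply (superposition f' γ)) γ := by
  rw [hasFDerivAt_iff_isLittleO, Asymptotics.isLittleO_iff]
  intro c hc
  obtain ⟨δ, hδ, hball⟩ := Metric.continuousAt_iff.1
    ((continuous_superposition f').continuousAt (x := γ)) c hc
  filter_upwards [Metric.ball_mem_nhds γ hδ] with η hη
  refine (ContinuousMap.norm_le _ (by positivity)).2 fun r => ?_
  have hsub : ‖η r - γ r‖ ≤ ‖η - γ‖ := (η - γ).norm_coe_le_norm r
  have hηδ : ‖η - γ‖ < δ := by rwa [mem_ball_iff_norm] at hη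
  have hb : ∀ x ∈ Metric.closedBall (γ r) ‖η - γ‖, ‖f' (r, x) - f' (r, γ r)‖ ≤ c := by
    intro x hx
    -- A constant translate of `γ` is a curve close to `γ` that passes through `x` at `r`, so the
    -- estimate for curves gives one at the point.
    have h1 : dist (γ + ContinuousMap.const I (x - γ r)) γ < δ := by
      rw [dist_eq_norm, add_sub_cancel_left]
      refine lt_of_le_of_lt ((ContinuousMap.norm_le _ (norm_nonneg _)).2 fun s => ?_) hηδ
      simpa [dist_eq_norm] using hx
    have h2 := (hball h1).le
    rw [dist_eq_norm] at h2
    have h3 := ((superposition f' (γ + ContinuousMap.const I (x - γ r))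
      - superposition f' γ).norm_coe_le_norm r).trans h2
    simpa using h3
  have key := (convex_closedBall (γ r) ‖η - γ‖).norm_image_sub_le_of_norm_hasFDerivWithin_le'
    (f := fun y => f (r, y)) (φ := f' (r, γ r)) (x := γ r) (y := η r)
    (fun x _ => (hf r x).hasFDerivWithinAt) hb (Metric.mem_closedBall_self (norm_nonneg _))
    (by rw [mem_closedBall_iff_norm]; exact hsub)
  refine key.trans ?_
  gcongr

lemma contDiff_superposition (f : C(I × E, F)) (f' : C(I × E, E →L[ℝ] F))
    (hf : ∀ r x, HasFDerivAt (fun y => f (r, y)) (f' (r, x)) x) :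
    ContDiff ℝ 1 (superposition f) :=
  contDiff_one_iff_hasFDerivAt.2 ⟨fun γ => pointwiseApply (superposition f' γ),
    pointwiseApply.continuous.comp (continuous_superposition f'),
    hasFDerivAt_superposition f f' hf⟩

end Superposition

/-! ### Primitives of continuous functions -/

section Primitive

variable {E : Type*} [NormedAddCommGroup E] {a b : ℝ}

lemma continuous_extend (hab : a ≤ b) (η : C(Icc a b, E)) : Continuous (IccExtend hab η) :=
  η.continuous.Icc_extend'

lemma continuous_eval_extend (hab : a ≤ b) :
    Continuous fun q : ℝ × C(Icc a b, E) => IccExtend hab q.2 q.1 := by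
  have : Continuous fun q : ℝ × C(Icc a b, E) => q.2 (projIcc a b hab q.1) :=
    continuous_eval.comp (continuous_snd.prodMk ((continuous_projIcc (h := hab)).comp continuous_fst))
  exact this

variable [NormedSpace ℝ E]

lemma norm_integral_extend_le (hab : a ≤ b) (η : C(Icc a b, E)) (s t : ℝ) :
    ‖∫ r in s..t, IccExtend hab η r‖ ≤ ‖η‖ * |t - s| :=
  intervalIntegral.norm_integral_le_of_norm_le_const fun _ _ => η.norm_coe_le_norm _

/-- The primitive of a continuous function on `[a, b]`, extended by constants. -/
def primitive (hab : a ≤ b) (s t : ℝ) : C(Icc a b, E) →L[ℝ] E :=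
  LinearMap.mkContinuous
    { toFun := fun η => ∫ r in s..t, IccExtend hab η r
      map_add' := fun η ζ => by
        rw [← intervalIntegral.integral_add ((continuous_extend hab η).intervalIntegrable _ _)
          ((continuous_extend hab ζ).intervalIntegrable _ _)]
        rfl
      map_smul' := fun c η => by
        rw [RingHom.id_apply, ← intervalIntegral.integral_smul]
        rfl } |t - s| (fun η => by rw [mul_comm]; exact norm_integral_extend_le hab η s t)

lemma primitive_apply (hab : a ≤ b) (s t : ℝ) (η : C(Icc a b, E)) :
    primitive hab s t η = ∫ r in s..t, IccExtend hab η r := rfl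

lemma norm_primitive_le (hab : a ≤ b) (s t : ℝ) :
    ‖(primitive hab s t : C(Icc a b, E) →L[ℝ] E)‖ ≤ |t - s| :=
  LinearMap.mkContinuous_norm_le _ (abs_nonneg _) _

lemma primitive_sub (hab : a ≤ b) (s t t' : ℝ) :
    (primitive hab s t : C(Icc a b, E) →L[ℝ] E) - primitive hab s t' = primitive hab t' t := by
  ext η
  simp only [sub_apply, primitive_apply]
  exact intervalIntegral.integral_interval_sub_left
    ((continuous_extend hab η).intervalIntegrable _ _)
    ((continuous_extend hab η).intervalIntegrable _ _)

lemma continuous_primitive (hab : a ≤ b) (s : ℝ) :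
    Continuous fun t => (primitive hab s t : C(Icc a b, E) →L[ℝ] E) := by
  have h : LipschitzWith 1 fun t => (primitive hab s t : C(Icc a b, E) →L[ℝ] E) := by
    refine LipschitzWith.of_dist_le_mul fun t t' => ?_
    rw [dist_eq_norm, primitive_sub, NNReal.coe_one, one_mul, Real.dist_eq]
    exact norm_primitive_le hab _ _
  exact h.continuous

/-- The partial derivatives are given by the fundamental theorem in the end point and by linearity
in the curve. Both are jointly continuous, hence combine to a total derivative. -/
lemma hasFDerivAt_primitive [CompleteSpace E] (hab : a ≤ b) (s : ℝ) (q : ℝ × C(Icc a b, E)) :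
    HasFDerivAt (fun q : ℝ × C(Icc a b, E) => primitive hab s q.1 q.2)
      ((ContinuousLinearMap.toSpanSingleton ℝ (IccExtend hab q.2 q.1)).coprod
        (primitive hab s q.1)) q := by
  set f₁ : ℝ → C(Icc a b, E) → ℝ →L[ℝ] E := fun t η =>
    ContinuousLinearMap.toSpanSingleton ℝ (IccExtend hab η t) with hf₁
  set f₂ : ℝ → C(Icc a b, E) → C(Icc a b, E) →L[ℝ] E := fun t η => primitive hab s t with hf₂
  have c₁ : Continuous fun q : ℝ × C(Icc a b, E) => f₁ q.1 q.2 :=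
    (ContinuousLinearMap.toSpanSingletonCLE (𝕜 := ℝ) (E := E)).continuous.comp
      (continuous_eval_extend hab)
  have c₂ : Continuous fun q : ℝ × C(Icc a b, E) => f₂ q.1 q.2 :=
    (continuous_primitive hab s).comp continuous_fst
  refine (hasStrictFDerivAt_uncurry_coprod (f := fun t η => primitive hab s t η) (f₁ := f₁)
    (f₂ := f₂) (u := q) ?_ ?_ c₁.continuousAt c₂.continuousAt).hasFDerivAt
  · refine Eventually.of_forall fun p => ?_
    exact ((continuous_extend hab p.2).integral_hasStrictDerivAt s p.1).hasDerivAt.hasFDerivAt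
  · exact Eventually.of_forall fun p =>
      (primitive hab s p.1 : C(Icc a b, E) →L[ℝ] E).hasFDerivAt (x := p.2)

lemma contDiff_primitive [CompleteSpace E] (hab : a ≤ b) (s : ℝ) :
    ContDiff ℝ 1 fun q : ℝ × C(Icc a b, E) => primitive hab s q.1 q.2 := by
  have c₁ : Continuous fun q : ℝ × C(Icc a b, E) =>
      ContinuousLinearMap.toSpanSingleton ℝ (IccExtend hab q.2 q.1) :=
    (ContinuousLinearMap.toSpanSingletonCLE (𝕜 := ℝ) (E := E)).continuous.comp
      (continuous_eval_extend hab)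
  have c₂ : Continuous fun q : ℝ × C(Icc a b, E) =>
      (primitive hab s q.1 : C(Icc a b, E) →L[ℝ] E) :=
    (continuous_primitive hab s).comp continuous_fst
  exact contDiff_one_iff_hasFDerivAt.2 ⟨_, by fun_prop, hasFDerivAt_primitive hab s⟩

/-- The primitive as a continuous function on `[a, b]`. -/
def primitiveMap (hab : a ≤ b) (s : Icc a b) : C(Icc a b, E) →L[ℝ] C(Icc a b, E) :=
  LinearMap.mkContinuous
    { toFun := fun η => ⟨fun t => primitive hab s t η, by
        have := continuous_primitive (E := E) hab s
        fun_prop⟩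
      map_add' := fun η ζ => by ext t; simp
      map_smul' := fun c η => by ext t; simp } (b - a) (fun η => by
        refine (ContinuousMap.norm_le _ (mul_nonneg (sub_nonneg.2 hab) (norm_nonneg _))).2
          fun t => ?_
        refine (norm_integral_extend_le hab η s t).trans ?_
        rw [mul_comm]
        refine mul_le_mul_of_nonneg_right ?_ (norm_nonneg _)
        exact abs_sub_le_of_le_of_le t.2.1 t.2.2 s.2.1 s.2.2)

lemma primitiveMap_apply (hab : a ≤ b) (s t : Icc a b) (η : C(Icc a b, E)) :
    primitiveMap hab s η t = primitive hab s t η := rfl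

lemma norm_primitiveMap_le (hab : a ≤ b) (s : Icc a b) :
    ‖(primitiveMap hab s : C(Icc a b, E) →L[ℝ] C(Icc a b, E))‖ ≤ b - a :=
  LinearMap.mkContinuous_norm_le _ (sub_nonneg.2 hab) _

/-- The embedding of constants. -/
def constMap (I E : Type*) [TopologicalSpace I] [CompactSpace I] [NormedAddCommGroup E]
    [NormedSpace ℝ E] : E →L[ℝ] C(I, E) :=
  LinearMap.mkContinuous
    { toFun := ContinuousMap.const I
      map_add' := fun _ _ => rfl
      map_smul' := fun _ _ => rfl } 1
    (fun x => (ContinuousMap.norm_le _ (by positivity)).2 fun t => (one_mul ‖x‖).ge)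

@[simp]
lemma constMap_apply {I : Type*} [TopologicalSpace I] [CompactSpace I] (x : E) (t : I) :
    constMap I E x t = x := rfl

end Primitive

/-! ### Local first integrals of a time-dependent vector field -/

section FirstIntegral

variable {E : Type*} [NormedAddCommGroup E] [NormedSpace ℝ E] {J : Set ℝ}
  {v : ℝ → E → E} {t₀ : ℝ} {z₀ : E}

/-- Picard–Lindelöf on an interval so short that `(b - a) * B < 1`, where `B` bounds the spatial
derivative of `v` along the trajectory. The smallness makes the linearized integral equation
invertible. -/
lemma exists_local_trajectory [ProperSpace E] (hJ : IsOpen J) (ht₀ : t₀ ∈ J)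
    (hv : ContinuousOn (fun q : ℝ × E => v q.1 q.2) (J ×ˢ univ))
    (hd : ∀ t ∈ J, Differentiable ℝ (v t))
    (hv' : ContinuousOn (fun q : ℝ × E => fderiv ℝ (v q.1) q.2) (J ×ˢ univ)) (z₀ : E) :
    ∃ a b, a < t₀ ∧ t₀ < b ∧ Icc a b ⊆ J ∧ ∃ B, (b - a) * B < 1 ∧ 0 ≤ B ∧ ∃ α : ℝ → E,
      ContinuousOn α (Icc a b) ∧ (∀ t ∈ Icc a b, α t = z₀ + ∫ r in t₀..t, v r (α r)) ∧
      ∀ r ∈ Icc a b, ‖fderiv ℝ (v r) (α r)‖ ≤ B := by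
  obtain ⟨r₀, hr₀, hr₀J⟩ := Metric.nhds_basis_closedBall.mem_iff.1 (hJ.mem_nhds ht₀)
  rw [Real.closedBall_eq_Icc] at hr₀J
  have hC : IsCompact (Icc (t₀ - r₀) (t₀ + r₀) ×ˢ Metric.closedBall z₀ 1) :=
    isCompact_Icc.prod (isCompact_closedBall z₀ 1)
  have hCJ : Icc (t₀ - r₀) (t₀ + r₀) ×ˢ Metric.closedBall z₀ 1 ⊆ J ×ˢ univ :=
    prod_mono hr₀J (subset_univ _)
  obtain ⟨V₀, hV₀⟩ := hC.exists_bound_of_continuousOn (hv.mono hCJ)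
  obtain ⟨B₀, hB₀⟩ := hC.exists_bound_of_continuousOn (hv'.mono hCJ)
  have hV : ∀ t ∈ Icc (t₀ - r₀) (t₀ + r₀), ∀ x ∈ Metric.closedBall z₀ 1, ‖v t x‖ ≤ |V₀| :=
    fun t ht x hx => (hV₀ (t, x) ⟨ht, hx⟩).trans (le_abs_self _)
  have hB : ∀ t ∈ Icc (t₀ - r₀) (t₀ + r₀), ∀ x ∈ Metric.closedBall z₀ 1,
      ‖fderiv ℝ (v t) x‖ ≤ |B₀| := fun t ht x hx => (hB₀ (t, x) ⟨ht, hx⟩).trans (le_abs_self _)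
  -- The three bounds keep the times in `J`, keep the displacement `|V₀| * τ` within the unit ball,
  -- and give `2 * τ * |B₀| < 1` for the interval length `2 * τ`.
  set τ : ℝ := min r₀ (min (1 / (|V₀| + 1)) (1 / (2 * |B₀| + 1) / 2)) with hτ
  have hτpos : 0 < τ := by
    refine lt_min hr₀ (lt_min ?_ ?_) <;> positivity
  have hτr : τ ≤ r₀ := min_le_left _ _
  have hτV : |V₀| * τ ≤ 1 := by
    have h1 : τ ≤ 1 / (|V₀| + 1) := (min_le_right _ _).trans (min_le_left _ _)
    rw [le_div_iff₀ (by positivity)] at h1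
    nlinarith [abs_nonneg V₀]
  have hτB : 2 * τ * |B₀| < 1 := by
    have h1 : τ ≤ 1 / (2 * |B₀| + 1) / 2 := (min_le_right _ _).trans (min_le_right _ _)
    rw [div_div, le_div_iff₀ (by positivity)] at h1
    nlinarith [abs_nonneg B₀]
  have hsub : Icc (t₀ - τ) (t₀ + τ) ⊆ Icc (t₀ - r₀) (t₀ + r₀) :=
    Icc_subset_Icc (by linarith) (by linarith)
  have ht₀I : t₀ ∈ Icc (t₀ - τ) (t₀ + τ) := ⟨by linarith, by linarith⟩
  have hPL : IsPicardLindelof v (⟨t₀, ht₀I⟩ : Icc (t₀ - τ) (t₀ + τ)) z₀ 1 0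
      (Real.toNNReal |V₀|) (Real.toNNReal |B₀|) := by
    refine ⟨fun t ht => ?_, fun x _ => ?_, fun t ht x hx => ?_, ?_⟩
    · refine (convex_closedBall z₀ _).lipschitzOnWith_of_nnnorm_fderiv_le (𝕜 := ℝ)
        (fun x _ => hd t (hr₀J (hsub ht)) x) fun x hx => ?_
      rw [← NNReal.coe_le_coe, coe_nnnorm, Real.coe_toNNReal _ (abs_nonneg _)]
      exact hB t (hsub ht) x hx
    · exact hv.comp (f := fun t => ((t, x) : ℝ × E)) (by fun_prop) fun t ht => ⟨hr₀J (hsub ht), mem_univ _⟩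
    · rw [Real.coe_toNNReal _ (abs_nonneg _)]
      exact hV t (hsub ht) x hx
    · rw [Real.coe_toNNReal _ (abs_nonneg _)]
      simpa using hτV
  obtain ⟨α, hα₀, hα⟩ := hPL.exists_eq_forall_mem_Icc_hasDerivWithinAt₀
  have hα₀ : α t₀ = z₀ := hα₀
  have hαc : ContinuousOn α (Icc (t₀ - τ) (t₀ + τ)) := fun t ht => (hα t ht).continuousWithinAt
  -- By continuity at `t₀` the trajectory stays in the unit ball on a possibly shorter interval,
  -- where `|B₀|` bounds the derivative.
  have hαat : ContinuousAt α t₀ :=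
    hαc.continuousAt (Icc_mem_nhds (by linarith) (by linarith))
  obtain ⟨s, hs, hsα⟩ := Metric.continuousAt_iff.1 hαat 1 one_pos
  set σ : ℝ := min τ (s / 2) with hσ
  have hσpos : 0 < σ := lt_min hτpos (by linarith)
  have hστ : σ ≤ τ := min_le_left _ _
  have hσs : σ ≤ s / 2 := min_le_right _ _
  have hsub' : Icc (t₀ - σ) (t₀ + σ) ⊆ Icc (t₀ - τ) (t₀ + τ) :=
    Icc_subset_Icc (by linarith) (by linarith)
  refine ⟨t₀ - σ, t₀ + σ, by linarith, by linarith, (hsub'.trans hsub).trans hr₀J, |B₀|, ?_,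
    abs_nonneg _, α, hαc.mono hsub', fun t ht => ?_, fun r hr => ?_⟩
  · have := mul_le_mul_of_nonneg_right hστ (abs_nonneg B₀)
    nlinarith
  · have hu : uIcc t₀ t ⊆ Icc (t₀ - τ) (t₀ + τ) :=
      uIcc_subset_Icc ht₀I (hsub' ht)
    have := ODE.picard_eq_of_hasDerivAt (f := v) (u := univ) (t₀ := t₀) (t := t) (α := α)
      (hv.mono (prod_mono (hu.trans (hsub.trans hr₀J)) subset_rfl))
      (fun r hr => (hα r (hu hr)).mono hu) (mapsTo_univ _ _)
    rw [← hα₀, ← this]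
    simp [ODE.picard_apply]
  · refine hB r (hsub (hsub' hr)) _ ?_
    have : dist r t₀ < s := by
      rw [Real.dist_eq, abs_lt]
      constructor <;> linarith [hr.1, hr.2]
    rw [← hα₀]
    exact (hsα this).le

/-- `ψ (t, z)` is the position at time `t₀` of the trajectory that passes through `z` at time `t`.
Considering the whole trajectory as a point of the Banach space `C([a, b], E)` gives joint `C¹`
dependence from the implicit function theorem, although `v` need not be differentiable in time. -/
lemma exists_local_first_integral [ProperSpace E] [CompleteSpace E] (hJ : IsOpen J) (ht₀ : t₀ ∈ J)
    (hv : ContinuousOn (fun q : ℝ × E => v q.1 q.2) (J ×ˢ univ))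
    (hd : ∀ t ∈ J, Differentiable ℝ (v t))
    (hv' : ContinuousOn (fun q : ℝ × E => fderiv ℝ (v q.1) q.2) (J ×ˢ univ)) (z₀ : E) :
    ∃ ψ : ℝ × E → E, ContDiffAt ℝ 1 ψ (t₀, z₀) ∧ (∀ᶠ z in 𝓝 z₀, ψ (t₀, z) = z) ∧
      ∀ᶠ p in 𝓝 (t₀, z₀), fderiv ℝ ψ p (1, v p.1 p.2) = 0 := by
  obtain ⟨a, b, ha, hb, hJab, B, hB1, hB0, α, hαc, hα, hαB⟩ :=
    exists_local_trajectory hJ ht₀ hv hd hv' z₀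
  have hab : a ≤ b := (ha.trans hb).le
  have ht₀I : t₀ ∈ Icc a b := ⟨ha.le, hb.le⟩
  have hmem : ∀ q : Icc a b × E, ((q.1 : ℝ), q.2) ∈ J ×ˢ (univ : Set E) :=
    fun q => ⟨hJab q.1.2, mem_univ _⟩
  let f : C(Icc a b × E, E) := ⟨fun q => v q.1 q.2,
    hv.comp_continuous (f := fun q : Icc a b × E => ((q.1 : ℝ), q.2)) (by fun_prop) hmem⟩
  let f' : C(Icc a b × E, E →L[ℝ] E) := ⟨fun q => fderiv ℝ (v q.1) q.2,
    hv'.comp_continuous (f := fun q : Icc a b × E => ((q.1 : ℝ), q.2)) (by fun_prop) hmem⟩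
  have hf : ∀ r x, HasFDerivAt (fun y => f (r, y)) (f' (r, x)) x :=
    fun r x => (hd r (hJab r.2) x).hasFDerivAt
  let S : C(Icc a b, E) →L[ℝ] C(Icc a b, E) := primitiveMap hab ⟨t₀, ht₀I⟩
  let c : E →L[ℝ] C(Icc a b, E) := constMap (Icc a b) E
  -- A zero of `Φ ((t, z), γ)` is a curve with `γ s = z + ∫ r in t..s, v r (γ r)`; the integral from
  -- the variable time `t` is written as a difference of integrals from `t₀`.
  let Φ : (ℝ × E) × C(Icc a b, E) → C(Icc a b, E) := fun u =>
    u.2 - c u.1.2 - (S (superposition f u.2) - c (primitive hab t₀ u.1.1 (superposition f u.2)))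
  have hΦc : ContDiff ℝ 1 Φ := by
    have h1 : ContDiff ℝ 1 fun u : (ℝ × E) × C(Icc a b, E) => superposition f u.2 :=
      (contDiff_superposition f f' hf).comp contDiff_snd
    have h2 : ContDiff ℝ 1 fun u : (ℝ × E) × C(Icc a b, E) =>
        primitive hab t₀ u.1.1 (superposition f u.2) :=
      (contDiff_primitive hab t₀).comp ((contDiff_fst.comp contDiff_fst).prodMk h1)
    exact (contDiff_snd.sub (c.contDiff.comp (contDiff_snd.comp contDiff_fst))).sub
      ((S.contDiff.comp h1).sub (c.contDiff.comp h2))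
  have hΦ' : ∀ u w, fderiv ℝ Φ u w = w.2 - c w.1.2
      - (S (pointwiseApply (superposition f' u.2) w.2)
        - c (w.1.1 • IccExtend hab (superposition f u.2) u.1.1
          + primitive hab t₀ u.1.1 (pointwiseApply (superposition f' u.2) w.2))) := by
    intro u w
    have h1 : HasFDerivAt (fun u : (ℝ × E) × C(Icc a b, E) => superposition f u.2) _ u :=
      (hasFDerivAt_superposition f f' hf u.2).comp u hasFDerivAt_snd
    have h2 : HasFDerivAt (fun u : (ℝ × E) × C(Icc a b, E) =>
        primitive hab t₀ u.1.1 (superposition f u.2)) _ u :=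
      (hasFDerivAt_primitive hab t₀ (u.1.1, superposition f u.2)).comp
        (f := fun u : (ℝ × E) × C(Icc a b, E) => (u.1.1, superposition f u.2)) u
        ((hasFDerivAt_fst.comp u hasFDerivAt_fst).prodMk h1)
    have h3 : HasFDerivAt Φ _ u :=
      (hasFDerivAt_snd.sub (c.hasFDerivAt.comp u (hasFDerivAt_snd.comp u hasFDerivAt_fst))).sub
        ((S.hasFDerivAt.comp u h1).sub (c.hasFDerivAt.comp u h2))
    rw [h3.fderiv]
    simp
  let γ₀ : C(Icc a b, E) := ⟨fun t => α t, hαc.comp_continuous continuous_subtype_val fun t => t.2⟩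
  have hext : ∀ t ∈ Icc a b, ∫ r in t₀..t, IccExtend hab (superposition f γ₀) r
      = ∫ r in t₀..t, v r (α r) := by
    intro t ht
    refine intervalIntegral.integral_congr fun r hr => ?_
    have hr' : r ∈ Icc a b := uIcc_subset_Icc ht₀I ht hr
    simp only [IccExtend_of_mem hab _ hr']
    rfl
  have hΦ₀ : Φ ((t₀, z₀), γ₀) = 0 := by
    ext t
    have h1 := hα t t.2
    have h2 := hext t t.2
    have h3 : Φ ((t₀, z₀), γ₀) t = α t - z₀
      - ((∫ r in t₀..t, IccExtend hab (superposition f γ₀) r)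
        - ∫ r in t₀..t₀, IccExtend hab (superposition f γ₀) r) := rfl
    rw [h3, intervalIntegral.integral_same, h2, h1]
    simp
  let D : (ℝ × E) × C(Icc a b, E) → C(Icc a b, E) →L[ℝ] C(Icc a b, E) := fun u =>
    fderiv ℝ Φ u ∘L .inr ℝ (ℝ × E) C(Icc a b, E)
  have hDc : Continuous D := by
    have := hΦc.continuous_fderiv one_ne_zero
    exact ((ContinuousLinearMap.compL ℝ C(Icc a b, E) ((ℝ × E) × C(Icc a b, E))
      C(Icc a b, E)).flip (.inr ℝ (ℝ × E) C(Icc a b, E))).continuous.comp this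
  -- The partial derivative in the curve is the identity minus an operator of norm at most `(b - a)
  -- * B < 1`, invertible by the Neumann series.
  have hDunit : IsUnit (D ((t₀, z₀), γ₀)) := by
    have hD : D ((t₀, z₀), γ₀) = 1 - S ∘L pointwiseApply (superposition f' γ₀) := by
      ext h t
      simp [D, hΦ', primitive_apply]
    rw [hD]
    have hT : ∀ T : C(Icc a b, E) →L[ℝ] C(Icc a b, E), ‖T‖ < 1 → IsUnit (1 - T) :=
      fun T hT => isUnit_one_sub_of_norm_lt_one (R := C(Icc a b, E) →L[ℝ] C(Icc a b, E)) hT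
    refine hT _ (lt_of_le_of_lt ?_ hB1)
    have h1 : ‖pointwiseApply (superposition f' γ₀)‖ ≤ B := by
      refine ContinuousLinearMap.opNorm_le_bound _ hB0 fun h => ?_
      refine (ContinuousMap.norm_le _ (by positivity)).2 fun r => ?_
      exact ((f' (r, γ₀ r)).le_opNorm _).trans
        (mul_le_mul (hαB r r.2) (h.norm_coe_le_norm r) (norm_nonneg _) hB0)
    refine (ContinuousLinearMap.opNorm_comp_le _ _).trans ?_
    exact mul_le_mul (norm_primitiveMap_le hab _) h1 (norm_nonneg _) (sub_nonneg.2 hab)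
  have hinv : (fderiv ℝ Φ ((t₀, z₀), γ₀) ∘L .inr ℝ (ℝ × E) C(Icc a b, E)).IsInvertible := by
    obtain ⟨U, hU⟩ := hDunit
    exact ⟨ContinuousLinearEquiv.unitsEquiv ℝ _ U, hU⟩
  have cdf : ContDiffAt ℝ 1 Φ ((t₀, z₀), γ₀) := hΦc.contDiffAt
  let γ : ℝ × E → C(Icc a b, E) := cdf.implicitFunction one_ne_zero hinv
  have hγ0 : γ (t₀, z₀) = γ₀ := cdf.implicitFunction_apply_self one_ne_zero hinv
  have hγ1 : ContDiffAt ℝ 1 γ (t₀, z₀) := cdf.contDiffAt_implicitFunction one_ne_zero hinv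
  have hγ2 : ∀ᶠ p in 𝓝 (t₀, z₀), Φ (p, γ p) = 0 := by
    have := cdf.eventually_apply_implicitFunction one_ne_zero hinv
    filter_upwards [this] with p hp
    exact hp.trans hΦ₀
  have hpI : ∀ᶠ p : ℝ × E in 𝓝 (t₀, z₀), p.1 ∈ Ioo a b :=
    continuousAt_fst.eventually (Ioo_mem_nhds ha hb)
  have hunit : ∀ᶠ p in 𝓝 (t₀, z₀), IsUnit (D (p, γ p)) := by
    have h1 : ContinuousAt (fun p => D (p, γ p)) (t₀, z₀) :=
      hDc.continuousAt.comp (continuousAt_id.prodMk hγ1.continuousAt)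
    have h2 : IsOpen {T : C(Icc a b, E) →L[ℝ] C(Icc a b, E) | IsUnit T} :=
      Units.isOpen (R := C(Icc a b, E) →L[ℝ] C(Icc a b, E))
    refine h1.eventually (h2.mem_nhds ?_)
    show IsUnit (D ((t₀, z₀), γ (t₀, z₀)))
    rwa [hγ0]
  have heval : ∀ p : ℝ × E, ∀ hp : p.1 ∈ Icc a b, Φ (p, γ p) = 0 → γ p ⟨p.1, hp⟩ = p.2 := by
    intro p hp h
    have h1 := congrArg (fun η : C(Icc a b, E) => η ⟨p.1, hp⟩) h
    have h2 : γ p ⟨p.1, hp⟩ - p.2 - ((primitive hab t₀ p.1 (superposition f (γ p)))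
      - primitive hab t₀ p.1 (superposition f (γ p))) = 0 := h1
    rwa [sub_self, sub_zero, sub_eq_zero] at h2
  -- Moving `(t, z)` along the flow does not change the trajectory. In the direction `(1, v)` the
  -- changes of the initial value and of the lower limit cancel, because the curve passes through
  -- `z` at time `t`; invertibility of `D`, an open condition, then annihilates the derivative of
  -- the curve.
  have hzero : ∀ᶠ p in 𝓝 (t₀, z₀), fderiv ℝ γ p (1, v p.1 p.2) = 0 := by
    filter_upwards [hγ2.eventually_nhds, hpI, hunit, hγ1.eventually (by simp)]
      with p hp hpI hpU hpd
    have hpI' : p.1 ∈ Icc a b := Ioo_subset_Icc_self hpI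
    have hd1 : HasFDerivAt γ (fderiv ℝ γ p) p := (hpd.differentiableAt one_ne_zero).hasFDerivAt
    have hd2 : HasFDerivAt (fun q => Φ (q, γ q)) _ p :=
      ((hΦc.differentiable one_ne_zero) (p, γ p)).hasFDerivAt.comp p
        ((hasFDerivAt_id p).prodMk hd1)
    have hd3 : HasFDerivAt (fun q => Φ (q, γ q)) (0 : ℝ × E →L[ℝ] C(Icc a b, E)) p :=
      (hasFDerivAt_const (0 : C(Icc a b, E)) p).congr_of_eventuallyEq hp
    have h1 := congrArg (fun T : ℝ × E →L[ℝ] C(Icc a b, E) => T (1, v p.1 p.2))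
      (hd2.unique hd3)
    have h2 : fderiv ℝ Φ (p, γ p) ((1, v p.1 p.2), fderiv ℝ γ p (1, v p.1 p.2)) = 0 := h1
    have h3 : fderiv ℝ Φ (p, γ p) ((1, v p.1 p.2), 0) = 0 := by
      rw [hΦ']
      have h4 : IccExtend hab (superposition f (γ p)) p.1 = v p.1 p.2 := by
        rw [IccExtend_of_mem hab _ hpI']
        show v p.1 (γ p ⟨p.1, hpI'⟩) = _
        rw [heval p hpI' hp.self_of_nhds]
      simp [h4]
    have h5 : D (p, γ p) (fderiv ℝ γ p (1, v p.1 p.2)) = 0 := by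
      rw [← h2, ← sub_zero (fderiv ℝ Φ (p, γ p) _), ← h3, ← map_sub]
      simp [D]
    obtain ⟨U, hU⟩ := hpU
    rw [← hU] at h5
    have h6 := congrArg (fun x => (↑U⁻¹ : C(Icc a b, E) →L[ℝ] C(Icc a b, E)) x) h5
    simpa [← mul_apply_eq_comp] using h6
  let e : C(Icc a b, E) →L[ℝ] E := ContinuousMap.evalCLM ℝ (⟨t₀, ht₀I⟩ : Icc a b)
  refine ⟨fun p => e (γ p), e.contDiff.contDiffAt.comp _ hγ1, ?_, ?_⟩
  · have hc : ContinuousAt (fun z : E => (t₀, z)) z₀ := by fun_prop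
    filter_upwards [hc.eventually hγ2] with z hz
    exact heval (t₀, z) ht₀I hz
  · filter_upwards [hzero, hγ1.eventually (by simp)] with p hp hpd
    have := (e.hasFDerivAt.comp p (hpd.differentiableAt one_ne_zero).hasFDerivAt).fderiv
    have h7 : fderiv ℝ (fun p => e (γ p)) p = e ∘L fderiv ℝ γ p := this
    rw [h7, ContinuousLinearMap.comp_apply, hp, map_zero]

end FirstIntegral

/-! ### Localized labels and the converse of the variation principle -/

section Labels

variable {M : Mechanics} {ħ : ℝ} {w : PhaseIdx N → ℝ} {J : Set ℝ} {H : Phase N → ℝ}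
  {A : ℝ → Phase N → ℝ} {Γ : PhaseIdx N → PhaseIdx N → ℝ → Phase N → ℝ}
  {Q : ℝ → Phase N → ℝ} {v : ℝ → Phase N → Phase N}

/-- There are nonnegative labels concentrated near any given space-time point. -/
lemma exists_localized_label (hJ : IsOpen J) (hv : IsRegularVelocity J v) {t₀ : ℝ} (ht₀ : t₀ ∈ J)
    (z₀ : Phase N) {U : Set (ℝ × Phase N)} (hU : U ∈ 𝓝 (t₀, z₀)) :
    ∃ τ : ℝ, 0 < τ ∧ Icc (t₀ - τ) (t₀ + τ) ⊆ J ∧ ∃ L : ℝ → Phase N → ℝ,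
      IsLabel v (t₀ - τ) (t₀ + τ) L ∧ (∀ t z, 0 ≤ L t z) ∧ 0 < L t₀ z₀ ∧
      ∀ t ∈ Icc (t₀ - τ) (t₀ + τ), ∀ z, L t z ≠ 0 → (t, z) ∈ U := by
  obtain ⟨ψ, hψ, hψ0, hψ'⟩ := exists_local_first_integral hJ ht₀ hv.1.1 hv.1.2 hv.2 z₀
  have hψ0' : ∀ᶠ p : ℝ × Phase N in 𝓝 (t₀, z₀), ψ (t₀, p.2) = p.2 :=
    (continuousAt_snd (p := (t₀, z₀))).eventually hψ0
  have hJ' : ∀ᶠ p : ℝ × Phase N in 𝓝 (t₀, z₀), p.1 ∈ J :=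
    continuousAt_fst.eventually (hJ.mem_nhds ht₀)
  obtain ⟨r, hr, hball⟩ := Metric.eventually_nhds_iff.1
    (((hψ.eventually (by simp)).and hψ').and ((hψ0'.and hJ').and hU))
  have hdist : ∀ {t : ℝ} {z : Phase N}, |t - t₀| < r → ‖z - z₀‖ < r →
      dist (t, z) (t₀, z₀) < r := by
    intro t z h1 h2
    rw [Prod.dist_eq, max_lt_iff]
    exact ⟨by rwa [Real.dist_eq], by rwa [dist_eq_norm]⟩
  -- The bump is supported within distance `r / 4`. Since `ψ (t₀, z) = z`, the annulus `S` from `3 *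
  -- r / 8` to `r / 2` is sent outside that ball at `t₀`, and by compactness also at nearby times.
  -- Hence `φ ∘ ψ` vanishes on the annulus and extends by zero without loss of smoothness.
  let φ : ContDiffBump z₀ := ⟨r / 8, r / 4, by positivity, by linarith⟩
  set S : Set (Phase N) := Metric.closedBall z₀ (r / 2) \ Metric.ball z₀ (3 * r / 8) with hS
  have hScomp : IsCompact S := (isCompact_closedBall z₀ (r / 2)).diff Metric.isOpen_ball
  have htube : ∀ᶠ t in 𝓝 t₀, ∀ z ∈ S, ψ (t, z) ∈ (Metric.closedBall z₀ (r / 4))ᶜ := by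
    refine hScomp.eventually_forall_of_forall_eventually
      (P := fun t z => ψ (t, z) ∈ (Metric.closedBall z₀ (r / 4))ᶜ) fun z hz => ?_
    have hz1 : ‖z - z₀‖ ≤ r / 2 := by simpa [dist_eq_norm] using hz.1
    have hz2 : 3 * r / 8 ≤ ‖z - z₀‖ := by simpa [dist_eq_norm] using hz.2
    have hb := hball (hdist (t := t₀) (z := z) (by simpa using hr) (by linarith))
    have hc : ContinuousAt ψ (t₀, z) := hb.1.1.continuousAt
    refine hc.eventually (Metric.isClosed_closedBall.isOpen_compl.mem_nhds ?_)
    rw [hb.2.1.1, mem_compl_iff, mem_closedBall_iff_norm, not_le]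
    linarith
  obtain ⟨σ₀, hσ₀, hσ⟩ := Metric.eventually_nhds_iff.1 htube
  set σ : ℝ := min σ₀ r with hσdef
  have hσpos : 0 < σ := lt_min hσ₀ hr
  have hσr : σ ≤ r := min_le_right _ _
  let g : ℝ × Phase N → ℝ := fun p => if ‖p.2 - z₀‖ < r / 2 then φ (ψ p) else 0
  have hg0 : ∀ p : ℝ × Phase N, |p.1 - t₀| < σ → 3 * r / 8 ≤ ‖p.2 - z₀‖ → g p = 0 := by
    intro p h1 h2
    by_cases h : ‖p.2 - z₀‖ < r / 2
    · have h3 := hσ (y := p.1) (by rw [Real.dist_eq]; exact h1.trans_le (min_le_left _ _)) p.2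
        ⟨by rw [mem_closedBall_iff_norm]; exact h.le,
          by rw [mem_ball_iff_norm, not_lt]; exact h2⟩
      simp only [g, if_pos h]
      refine φ.zero_of_le_dist ?_
      rw [mem_compl_iff, Metric.mem_closedBall, not_le] at h3
      exact h3.le
    · simp [g, h]
  have hcs : Continuous fun p : ℝ × Phase N => ‖p.2 - z₀‖ := by fun_prop
  have hct : Continuous fun p : ℝ × Phase N => |p.1 - t₀| := by fun_prop
  have hg : ∀ p : ℝ × Phase N, |p.1 - t₀| < σ →
      ContDiffAt ℝ 1 g p ∧ fderiv ℝ g p (1, v p.1 p.2) = 0 := by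
    intro p hp
    by_cases h : ‖p.2 - z₀‖ < r / 2
    · have hb := hball (hdist (hp.trans_le hσr) (h.trans (by linarith)))
      have he : g =ᶠ[𝓝 p] fun q => φ (ψ q) := by
        filter_upwards [hcs.continuousAt.eventually_lt continuousAt_const h] with q hq
        simp [g, hq]
      have hb1 : ContDiffAt ℝ 1 ψ p := hb.1.1
      have hφ : ContDiffAt ℝ 1 (φ : Phase N → ℝ) (ψ p) := φ.contDiffAt
      refine ⟨(hφ.comp p hb1).congr_of_eventuallyEq he, ?_⟩
      have h1 : fderiv ℝ g p = fderiv ℝ (φ : Phase N → ℝ) (ψ p) ∘L fderiv ℝ ψ p := by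
        rw [he.fderiv_eq]
        exact fderiv_comp p (hφ.differentiableAt one_ne_zero)
          (hb1.differentiableAt one_ne_zero)
      rw [h1, ContinuousLinearMap.comp_apply, hb.1.2, map_zero]
    · have he : g =ᶠ[𝓝 p] fun _ => 0 := by
        have h2 : 3 * r / 8 < ‖p.2 - z₀‖ := by linarith [not_lt.1 h]
        filter_upwards [continuousAt_const.eventually_lt hcs.continuousAt h2,
          hct.continuousAt.eventually_lt continuousAt_const hp] with q hq1 hq2
        exact hg0 q hq2 hq1.le
      refine ⟨contDiffAt_const.congr_of_eventuallyEq he, ?_⟩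
      rw [he.fderiv_eq]
      simp
  have hτ : ∀ t ∈ Icc (t₀ - σ / 2) (t₀ + σ / 2), |t - t₀| < σ := by
    intro t ht
    rw [abs_lt]
    constructor <;> linarith [ht.1, ht.2]
  refine ⟨σ / 2, by linarith, fun t ht => ?_, fun t z => g (t, z), ⟨?_, ?_, ?_⟩, ?_, ?_, ?_⟩
  · exact (hball (hdist (z := z₀) ((hτ t ht).trans_le hσr) (by simpa using hr))).2.1.2
  · exact fun p hp => (hg p (hτ p.1 hp.1)).1.contDiffWithinAt
  · refine ⟨Metric.closedBall z₀ (r / 2), isCompact_closedBall _ _, fun t _ z hz => ?_⟩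
    rw [mem_closedBall_iff_norm, not_le] at hz
    simp [g, hz.not_gt]
  · intro t ht z
    obtain ⟨h1, h2⟩ := hg (t, z) (hτ t (Ioo_subset_Icc_self ht))
    have hd : HasFDerivAt g (fderiv ℝ g (t, z)) (t, z) :=
      (h1.differentiableAt one_ne_zero).hasFDerivAt
    have h3 : deriv (fun s => g (s, z)) t = fderiv ℝ g (t, z) (1, 0) := by
      have := (hd.comp t (hasFDerivAt_prodMk_left t z)).hasDerivAt.deriv
      simpa [Function.comp_def] using this
    have h4 : fderiv ℝ (fun y => g (t, y)) z (v t z) = fderiv ℝ g (t, z) (0, v t z) := by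
      have := (hd.comp z (hasFDerivAt_prodMk_right t z)).fderiv
      have h5 : fderiv ℝ (fun y => g (t, y)) z = _ := this
      rw [h5]
      simp
    rw [h3, ← fderiv_eq_sum_pd, h4, eq_neg_iff_add_eq_zero, ← map_add]
    simpa using h2
  · intro t z
    by_cases h : ‖z - z₀‖ < r / 2
    · simp only [g, if_pos h]; exact φ.nonneg
    · simp [g, h]
  · have h : ‖z₀ - z₀‖ < r / 2 := by simpa using hr
    have h1 := hball (hdist (t := t₀) (z := z₀) (by simpa using hr) (by simpa using hr))
    simp only [g, if_pos h, h1.2.1.1]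
    exact φ.pos_of_mem_ball (Metric.mem_ball_self (by positivity))
  · intro t ht z hz
    have h : ‖z - z₀‖ < r / 2 := by
      by_contra h
      exact hz (by simp [g, h])
    exact (hball (hdist ((hτ t ht).trans_le hσr) (h.trans (by linarith)))).2.2

/-- Conjugation squares to minus the identity. It is used to test a single component of the
residual. -/
lemma exists_zTilde_eq (y : Phase N) : ∃ x : Phase N, ∀ i, zTilde x i = y i :=
  ⟨fun i => -zTilde y i, fun i => by rcases i with n | n <;> simp [zTilde]⟩

/-- The variation principle implies the extended Hamilton equations. -/
theorem VariationPrinciple.extHamiltonEq (hħ : 0 < ħ) (hJ : IsOpen J) (hH : ContDiff ℝ ∞ H)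
    (hQ : IsState J Q) (hHQ : SeriesConverge M ħ w J H Q) (hA : TwiceDifferentiable J A)
    (hΓ : ∀ i j, TwiceDifferentiable J (Γ i j)) (hv : IsRegularVelocity J v)
    (hcont : ContinuityEq J Q v) (hvar : VariationPrinciple M ħ w J H A Γ Q v) :
    ExtHamiltonEq M ħ w J H A Γ Q v := by
  intro t₀ ht₀ z₀ i
  rw [← sub_eq_zero]
  by_contra hne
  let F : ℝ × Phase N → ℝ := fun q => v q.1 q.2 i * Q q.1 q.2 - hamFlux M ħ w H A Γ Q q.1 q.2 i
  have hF : ContinuousOn F (J ×ˢ univ) :=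
    ((continuousOn_pi.1 hv.1.1 i).mul (hQ.continuousOn_pdList [])).sub
      (continuousOn_hamFlux hħ hJ hH hQ hHQ hA hΓ i)
  set c : ℝ := F (t₀, z₀) with hc
  have hc0 : c ≠ 0 := hne
  have hcF : ContinuousAt (fun q => c * F q) (t₀, z₀) :=
    continuousAt_const.mul
      (hF.continuousAt ((hJ.prod isOpen_univ).mem_nhds ⟨ht₀, mem_univ _⟩))
  have hU : {q | 0 < c * F q} ∈ 𝓝 (t₀, z₀) :=
    hcF.eventually (lt_mem_nhds (by simpa [← hc] using mul_self_pos.2 hc0))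
  obtain ⟨τ, hτ, hIJ, L, hL, hL0, hLpos, hLU⟩ := exists_localized_label hJ hv ht₀ z₀ hU
  obtain ⟨K, hK, hLK⟩ := hL.2.1
  obtain ⟨e, he⟩ := exists_zTilde_eq (Pi.single i c : Phase N)
  set ti := t₀ - τ with hti
  set tf := t₀ + τ with htf
  have htt : ti < tf := by linarith
  -- A smooth profile that vanishes at both end points and is positive between them. With `e` as
  -- direction the first variation becomes the integral of `η` times the labelled mean of `c * F`,
  -- which is positive near the chosen point.
  let η : ℝ → ℝ := fun t => (t - ti) ^ 2 * (t - tf) ^ 2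
  have hδ : ContDiff ℝ 1 fun t => η t • e := by fun_prop
  have key := (hL.hasDerivAt_extAction (δz := fun t => η t • e) hħ hJ hH hQ hHQ hA hΓ hv.1 hcont
    htt hIJ hδ (by simp [η]) (by simp [η])).unique
    (hvar ti tf htt hIJ L hL _ hδ (by simp [η]) (by simp [η]))
  have hpt : ∀ t, ∑ j, zTilde (η t • e) j *
      ∫ z, L t z * (v t z j * Q t z - hamFlux M ħ w H A Γ Q t z j)
      = η t * ∫ z, L t z * (c * F (t, z)) := by
    intro t
    rw [Finset.sum_eq_single i (fun j _ hj => by simp [zTilde_smul, he, hj]) (by simp),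
      zTilde_smul, he, Pi.single_eq_same, mul_assoc, ← integral_const_mul]
    congr 2
    funext z
    simp only [F]
    ring
  simp only [hpt] at key
  have hLF : ContinuousOn (fun q : ℝ × Phase N => L q.1 q.2 * (c * F q)) (Icc ti tf ×ˢ univ) :=
    hL.1.continuousOn.mul (continuousOn_const.mul (hF.mono (prod_mono hIJ subset_rfl)))
  have hint : ContinuousOn (fun t => ∫ z, L t z * (c * F (t, z))) (Icc ti tf) :=
    continuousOn_integral_of_compact_support hK (f := fun t z => L t z * (c * F (t, z))) hLF
      fun t z ht hz => by simp [hLK t ht z hz]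
  have hnn : ∀ t ∈ Icc ti tf, ∀ z, 0 ≤ L t z * (c * F (t, z)) := by
    intro t ht z
    by_cases h : L t z = 0
    · simp [h]
    · exact mul_nonneg (hL0 t z) (le_of_lt (hLU t ht z h))
  have ht₀I : t₀ ∈ Icc ti tf := ⟨by linarith, by linarith⟩
  refine absurd key (ne_of_gt (intervalIntegral.integral_pos htt
    ((Continuous.continuousOn (by fun_prop)).mul hint) (fun t ht => ?_) ⟨t₀, ht₀I, ?_⟩))
  · exact mul_nonneg (by positivity)
      (integral_nonneg (hnn t (Ioc_subset_Icc_self ht)))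
  · refine mul_pos ?_ ?_
    · have h1 : t₀ - ti ≠ 0 := by simpa [hti] using hτ.ne'
      have h2 : t₀ - tf ≠ 0 := by simpa [htf] using hτ.ne'
      positivity
    · have hcz : Continuous fun z => L t₀ z * (c * F (t₀, z)) :=
        hLF.comp_continuous (f := fun z : Phase N => (t₀, z)) (by fun_prop)
          fun z => ⟨ht₀I, mem_univ _⟩
      refine hcz.integral_pos_of_hasCompactSupport_nonneg_nonzero (x := z₀)
        (HasCompactSupport.intro hK fun z hz => by simp [hLK t₀ ht₀I z hz]) (hnn t₀ ht₀I) ?_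
      exact mul_ne_zero hLpos.ne' (mul_self_ne_zero.2 hc0)

end Labels

/-! ### Functions of exponential growth -/

/-- Functions of at most exponential growth. -/
def IsExpBounded (f : Phase N → ℝ) : Prop :=
  ∃ C a : ℝ, 0 ≤ C ∧ 0 ≤ a ∧ ∀ y, |f y| ≤ C * Real.exp (a * ‖y‖)

namespace IsExpBounded

variable {f g : Phase N → ℝ}

lemma of_le (hg : IsExpBounded g) (h : ∀ y, |f y| ≤ |g y|) : IsExpBounded f := by
  obtain ⟨C, a, hC, ha, hg⟩ := hg
  exact ⟨C, a, hC, ha, fun y => (h y).trans (hg y)⟩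

lemma of_poly {C : ℝ} {r : ℕ} (h : ∀ y, |f y| ≤ C * (1 + ‖y‖) ^ r) : IsExpBounded f := by
  refine ⟨|C|, r, abs_nonneg _, by positivity, fun y => (h y).trans ?_⟩
  have h1 : (1 + ‖y‖) ^ r ≤ Real.exp (r * ‖y‖) := by
    rw [Real.exp_nat_mul]
    gcongr
    linarith [Real.add_one_le_exp ‖y‖]
  exact mul_le_mul (le_abs_self C) h1 (by positivity) (abs_nonneg _)

lemma mul (hf : IsExpBounded f) (hg : IsExpBounded g) : IsExpBounded fun y => f y * g y := by
  obtain ⟨C, a, hC, ha, hf⟩ := hf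
  obtain ⟨D, b, hD, hb, hg⟩ := hg
  refine ⟨C * D, a + b, by positivity, by positivity, fun y => ?_⟩
  rw [abs_mul, add_mul, Real.exp_add, mul_mul_mul_comm]
  exact mul_le_mul (hf y) (hg y) (abs_nonneg _) (by positivity)

lemma add (hf : IsExpBounded f) (hg : IsExpBounded g) : IsExpBounded fun y => f y + g y := by
  obtain ⟨C, a, hC, ha, hf⟩ := hf
  obtain ⟨D, b, hD, hb, hg⟩ := hg
  refine ⟨C + D, a + b, by positivity, by positivity, fun y => (abs_add_le _ _).trans ?_⟩
  rw [add_mul]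
  refine add_le_add ((hf y).trans ?_) ((hg y).trans ?_)
  · gcongr; linarith
  · gcongr; linarith

lemma const (c : ℝ) : IsExpBounded fun _ : Phase N => c :=
  of_poly (C := |c|) (r := 0) (by simp)

lemma sum {σ : Type*} (s : Finset σ) {F : σ → Phase N → ℝ} (hF : ∀ i ∈ s, IsExpBounded (F i)) :
    IsExpBounded fun y => ∑ i ∈ s, F i y := by
  classical
  induction s using Finset.induction_on with
  | empty => simpa using const 0
  | insert i s hi ih =>
    simp only [Finset.sum_insert hi]
    exact (hF i (by simp)).add (ih fun j hj => hF j (by simp [hj]))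

lemma shift (hf : IsExpBounded f) (u : Phase N) : IsExpBounded fun y => f (y + u) := by
  obtain ⟨C, a, hC, ha, hf⟩ := hf
  refine ⟨C * Real.exp (a * ‖u‖), a, by positivity, ha, fun y => (hf _).trans ?_⟩
  rw [mul_assoc, ← Real.exp_add, ← mul_add]
  gcongr
  linarith [norm_add_le y u]

lemma exp_sum (a : Phase N) : IsExpBounded fun y => Real.exp (∑ i, a i * y i) := by
  refine ⟨1, ∑ i, |a i|, zero_le_one, Finset.sum_nonneg fun i _ => abs_nonneg _, fun y => ?_⟩
  rw [one_mul, abs_of_pos (Real.exp_pos _), Finset.sum_mul]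
  refine Real.exp_le_exp.2 (Finset.sum_le_sum fun i _ => ?_)
  refine (le_abs_self _).trans ?_
  rw [abs_mul]
  exact mul_le_mul_of_nonneg_left (norm_le_pi_norm y i) (abs_nonneg _)

end IsExpBounded

/-- Smooth functions all of whose derivatives have at most exponential growth. -/
def IsTame (f : Phase N → ℝ) : Prop :=
  ContDiff ℝ ∞ f ∧ ∀ α : List (PhaseIdx N), IsExpBounded (pdList α f)

namespace IsTame

variable {f g : Phase N → ℝ}

lemma isExpBounded (hf : IsTame f) : IsExpBounded f := hf.2 []

lemma continuous (hf : IsTame f) : Continuous f := hf.1.continuous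

lemma differentiable (hf : IsTame f) : Differentiable ℝ f := hf.1.differentiable (by simp)

/-- A set of smooth functions of exponential growth that is stable under differentiation consists
of tame functions. -/
lemma of_stable {S : Set (Phase N → ℝ)} (hS : ∀ f ∈ S, ContDiff ℝ ∞ f ∧ IsExpBounded f)
    (hpd : ∀ f ∈ S, ∀ i, SkodjeGauge.pd i f ∈ S) (hf : f ∈ S) : IsTame f := by
  refine ⟨(hS f hf).1, fun α => (hS _ ?_).2⟩
  induction α with
  | nil => exact hf
  | cons i α ih => exact hpd _ ih i

lemma pdList (hf : IsTame f) (α : List (PhaseIdx N)) : IsTame (pdList α f) :=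
  ⟨contDiff_pdList hf.1 α, fun β => by rw [← pdList_append]; exact hf.2 _⟩

lemma pd (hf : IsTame f) (i : PhaseIdx N) : IsTame (pd i f) := hf.pdList [i]

lemma add (hf : IsTame f) (hg : IsTame g) : IsTame fun y => f y + g y := by
  refine of_stable (S := {h | ∃ f g : Phase N → ℝ, IsTame f ∧ IsTame g ∧ h = fun y => f y + g y})
    ?_ ?_ ⟨f, g, hf, hg, rfl⟩
  · rintro _ ⟨f, g, hf, hg, rfl⟩
    exact ⟨hf.1.add hg.1, hf.isExpBounded.add hg.isExpBounded⟩
  · rintro _ ⟨f, g, hf, hg, rfl⟩ i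
    exact ⟨_, _, hf.pd i, hg.pd i, funext fun z => pd_add (hf.differentiable z)
      (hg.differentiable z) i⟩

lemma const_mul (hf : IsTame f) (c : ℝ) : IsTame fun y => c * f y := by
  refine of_stable (S := {h | ∃ f : Phase N → ℝ, IsTame f ∧ h = fun y => c * f y})
    ?_ ?_ ⟨f, hf, rfl⟩
  · rintro _ ⟨f, hf, rfl⟩
    exact ⟨contDiff_const.mul hf.1, (IsExpBounded.const c).mul hf.isExpBounded⟩
  · rintro _ ⟨f, hf, rfl⟩ i
    exact ⟨_, hf.pd i, funext fun z => pd_const_mul (hf.differentiable z) c i⟩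

lemma sub (hf : IsTame f) (hg : IsTame g) : IsTame fun y => f y - g y := by
  simpa [sub_eq_add_neg] using hf.add (hg.const_mul (-1))

lemma of_temperate (hf : f.HasTemperateGrowth) : IsTame f := by
  refine ⟨hf.1, fun α => ?_⟩
  obtain ⟨k, C, h⟩ := hf.2 α.length
  refine IsExpBounded.of_poly (C := C) (r := k) fun y => ?_
  rw [pdList_eq_iteratedFDeriv hf.1, ← Real.norm_eq_abs]
  refine (ContinuousMultilinearMap.le_opNorm _ _).trans ?_
  simpa [Pi.norm_single] using h y

lemma coord (i : PhaseIdx N) : IsTame fun y : Phase N => y i :=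
  of_temperate (ContinuousLinearMap.proj (R := ℝ) (φ := fun _ : PhaseIdx N => ℝ) i).hasTemperateGrowth

lemma const (c : ℝ) : IsTame fun _ : Phase N => c :=
  of_temperate (Function.HasTemperateGrowth.const c)

lemma shift (hf : IsTame f) (u : Phase N) : IsTame fun y => f (y + u) :=
  ⟨hf.1.comp (contDiff_id.add contDiff_const), fun α => by
    rw [pdList_shift]; exact (hf.2 α).shift u⟩

lemma sum {σ : Type*} (s : Finset σ) {F : σ → Phase N → ℝ} (hF : ∀ i ∈ s, IsTame (F i)) :
    IsTame fun y => ∑ i ∈ s, F i y := by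
  classical
  induction s using Finset.induction_on with
  | empty => simpa using const 0
  | insert i s hi ih =>
    simp only [Finset.sum_insert hi]
    exact (hF i (by simp)).add (ih fun j hj => hF j (by simp [hj]))

/-- Products of tame functions are tame. -/
lemma mul (hf : IsTame f) (hg : IsTame g) : IsTame fun y => f y * g y := by
  -- Single products are not stable under differentiation; finite sums of products are, by the
  -- Leibniz rule.
  refine of_stable (S := {h | ∃ (σ : Type) (_ : Fintype σ) (F G : σ → Phase N → ℝ),
    (∀ k, IsTame (F k)) ∧ (∀ k, IsTame (G k)) ∧ h = fun y => ∑ k, F k y * G k y}) ?_ ?_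
    ⟨Unit, inferInstance, fun _ => f, fun _ => g, fun _ => hf, fun _ => hg, by simp⟩
  · rintro _ ⟨σ, _, F, G, hF, hG, rfl⟩
    exact ⟨ContDiff.sum fun k _ => (hF k).1.mul (hG k).1,
      IsExpBounded.sum _ fun k _ => (hF k).isExpBounded.mul (hG k).isExpBounded⟩
  · rintro _ ⟨σ, _, F, G, hF, hG, rfl⟩ i
    refine ⟨σ ⊕ σ, inferInstance, Sum.elim (fun k => SkodjeGauge.pd i (F k)) F,
      Sum.elim G (fun k => SkodjeGauge.pd i (G k)), ?_, ?_, funext fun z => ?_⟩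
    · rintro (k | k)
      exacts [(hF k).pd i, hF k]
    · rintro (k | k)
      exacts [hG k, (hG k).pd i]
    · rw [pd_sum (f := fun k y => F k y * G k y) _ fun k _ =>
        ((hF k).differentiable z).mul ((hG k).differentiable z), Fintype.sum_sum_type]
      simp only [Sum.elim_inl, Sum.elim_inr, ← Finset.sum_add_distrib]
      exact Finset.sum_congr rfl fun k _ => pd_mul ((hF k).differentiable z)
        ((hG k).differentiable z) i

lemma pd_exp_sum (a : Phase N) (i : PhaseIdx N) :
    SkodjeGauge.pd i (fun y => Real.exp (∑ j, a j * y j))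
      = fun y => a i * Real.exp (∑ j, a j * y j) := by
  funext z
  have h : HasFDerivAt (fun y : Phase N => ∑ j, a j * y j)
      (∑ j, a j • (ContinuousLinearMap.proj j : Phase N →L[ℝ] ℝ)) z :=
    HasFDerivAt.fun_sum fun j _ => (hasFDerivAt_apply j z).const_mul (a j)
  simp only [SkodjeGauge.pd, h.exp.fderiv]
  simp [-Fintype.sum_sum_type, Pi.single_apply, mul_comm]

lemma exp_sum (a : Phase N) : IsTame fun y => Real.exp (∑ i, a i * y i) := by
  refine of_stable (S := {h | ∃ c : ℝ, h = fun y : Phase N => c * Real.exp (∑ i, a i * y i)})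
    ?_ ?_ ⟨1, by simp⟩
  · rintro _ ⟨c, rfl⟩
    exact ⟨by fun_prop, (IsExpBounded.const c).mul (IsExpBounded.exp_sum a)⟩
  · rintro _ ⟨c, rfl⟩ i
    refine ⟨c * a i, funext fun z => ?_⟩
    rw [pd_const_mul (by fun_prop), pd_exp_sum]
    ring

lemma bidiff {B : BiOp N} (hB : IsBidiff B) (hf : IsTame f) (hg : IsTame g) : IsTame (B f g) := by
  obtain ⟨σ, _, c, α, β, h⟩ := hB
  have : B f g = fun z => ∑ s, c s * (SkodjeGauge.pdList (α s) f z * SkodjeGauge.pdList (β s) g z) :=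
    funext (h f g)
  rw [this]
  exact sum _ fun s _ => ((hf.pdList _).mul (hg.pdList _)).const_mul _

end IsTame

/-! ### The Gaussian kernel -/

section Kernel

variable {w : PhaseIdx N → ℝ}

/-- The kernel is a product of centred normal densities with variances `w i ^ 2`, so its
normalization follows from dimension one. -/
lemma husimiKernel_eq_prod (hw : ∀ i, 0 < w i) (u : Phase N) :
    husimiKernel w u
      = ∏ i, ProbabilityTheory.gaussianPDFReal 0 (Real.toNNReal (w i ^ 2)) (u i) := by
  have hs : ∀ i, √(2 * Real.pi * w i ^ 2) = √(2 * Real.pi) * w i := fun i => by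
    rw [Real.sqrt_mul (by positivity), Real.sqrt_sq (hw i).le]
  rw [Fintype.prod_sum_type, ← Finset.prod_mul_distrib]
  refine Finset.prod_congr rfl fun n _ => ?_
  simp only [ProbabilityTheory.gaussianPDFReal, Real.coe_toNNReal _ (sq_nonneg _), sub_zero, hs]
  rw [mul_mul_mul_comm, ← Real.exp_add, ← mul_inv, mul_mul_mul_comm, Real.mul_self_sqrt (by positivity),
    one_div]
  congr 1
  · congr 1
    ring
  · congr 1
    ring

lemma husimiKernel_eq_exp (hw : ∀ i, 0 < w i) : ∃ c : ℝ, 0 < c ∧ ∀ u : Phase N,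
    husimiKernel w u = c * Real.exp (-∑ i, u i ^ 2 / (2 * w i ^ 2)) := by
  refine ⟨∏ i, (√(2 * Real.pi * w i ^ 2))⁻¹, Finset.prod_pos fun i _ => ?_, fun u => ?_⟩
  · have := hw i
    positivity
  · rw [husimiKernel_eq_prod hw, ← Finset.sum_neg_distrib, Real.exp_sum, ← Finset.prod_mul_distrib]
    refine Finset.prod_congr rfl fun i _ => ?_
    simp [ProbabilityTheory.gaussianPDFReal, Real.coe_toNNReal _ (sq_nonneg _), neg_div]

lemma husimiKernel_pos (hw : ∀ i, 0 < w i) (u : Phase N) : 0 < husimiKernel w u := by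
  obtain ⟨c, hc, h⟩ := husimiKernel_eq_exp hw
  rw [h]
  positivity

lemma contDiff_husimiKernel (hw : ∀ i, 0 < w i) : ContDiff ℝ ∞ (husimiKernel w) := by
  obtain ⟨c, hc, h⟩ := husimiKernel_eq_exp hw
  have h' : husimiKernel w = fun u : Phase N => c * Real.exp (-∑ i, u i ^ 2 / (2 * w i ^ 2)) :=
    funext h
  rw [h']
  simp only [div_eq_mul_inv]
  fun_prop

lemma continuous_husimiKernel (hw : ∀ i, 0 < w i) : Continuous (husimiKernel w) :=
  (contDiff_husimiKernel hw).continuous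

lemma husimiKernel_neg (hw : ∀ i, 0 < w i) (u : Phase N) : husimiKernel w (-u) = husimiKernel w u := by
  obtain ⟨c, hc, h⟩ := husimiKernel_eq_exp hw
  simp [h]

lemma pd_husimiKernel (hw : ∀ i, 0 < w i) (i : PhaseIdx N) (u : Phase N) :
    pd i (husimiKernel w) u = -(u i / w i ^ 2 * husimiKernel w u) := by
  obtain ⟨c, hc, h⟩ := husimiKernel_eq_exp hw
  have h' : husimiKernel w = fun u : Phase N => c * Real.exp (-∑ i, u i ^ 2 / (2 * w i ^ 2)) :=
    funext h
  have hd : HasFDerivAt (fun y : Phase N => ∑ j, y j ^ 2 / (2 * w j ^ 2))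
      (∑ j, (u j / w j ^ 2) • (ContinuousLinearMap.proj j : Phase N →L[ℝ] ℝ)) u := by
    refine HasFDerivAt.fun_sum fun j _ => ?_
    have h1 : HasFDerivAt (fun y : Phase N => y j)
        (ContinuousLinearMap.proj j : Phase N →L[ℝ] ℝ) u := hasFDerivAt_apply j u
    have h2 : HasDerivAt (fun s : ℝ => s ^ 2 / (2 * w j ^ 2)) (u j / w j ^ 2) (u j) := by
      refine ((hasDerivAt_pow 2 (u j)).div_const _).congr_deriv ?_
      have := (hw j).ne'
      field_simp
      norm_num
    exact h2.comp_hasFDerivAt u h1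
  rw [h', pd_const_mul (by exact hd.neg.exp.differentiableAt)]
  have h3 := hd.neg.exp.fderiv
  simp only [pd]
  have h4 : fderiv ℝ (fun y : Phase N => Real.exp (-∑ j, y j ^ 2 / (2 * w j ^ 2))) u = _ := h3
  rw [h4]
  simp [-Fintype.sum_sum_type, Pi.single_apply]
  ring

/-- Completing the square. -/
lemma exp_mul_husimiKernel (hw : ∀ i, 0 < w i) (a u : Phase N) :
    Real.exp (∑ i, a i * u i) * husimiKernel w u
      = Real.exp (∑ i, w i ^ 2 * a i ^ 2 / 2) * husimiKernel w (u - fun i => w i ^ 2 * a i) := by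
  obtain ⟨c, hc, h⟩ := husimiKernel_eq_exp hw
  rw [h, h, mul_left_comm, mul_left_comm _ c, ← Real.exp_add, ← Real.exp_add]
  congr 2
  rw [← Finset.sum_neg_distrib, ← Finset.sum_neg_distrib, ← Finset.sum_add_distrib,
    ← Finset.sum_add_distrib]
  refine Finset.sum_congr rfl fun i _ => ?_
  have := (hw i).ne'
  simp only [Pi.sub_apply]
  field_simp
  ring

lemma integral_husimiKernel (hw : ∀ i, 0 < w i) : ∫ u : Phase N, husimiKernel w u = 1 := by
  simp only [husimiKernel_eq_prod hw]
  rw [integral_fintype_prod_volume_eq_prod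
    (fun i => ProbabilityTheory.gaussianPDFReal 0 (Real.toNNReal (w i ^ 2)))]
  refine Finset.prod_eq_one fun i _ => ProbabilityTheory.integral_gaussianPDFReal_eq_one 0 ?_
  have := hw i
  rw [← NNReal.coe_ne_zero, Real.coe_toNNReal _ (sq_nonneg _)]
  positivity

lemma integrable_husimiKernel (hw : ∀ i, 0 < w i) : Integrable (husimiKernel (N := N) w) := by
  -- The integral of a non-integrable function is 0 by convention, whereas this integral is 1.
  by_contra h
  have := integral_husimiKernel hw
  rw [integral_undef h] at this
  exact zero_ne_one this

lemma integrable_exp_mul_husimiKernel (hw : ∀ i, 0 < w i) (a : Phase N) :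
    Integrable fun u : Phase N => Real.exp (∑ i, a i * u i) * husimiKernel w u := by
  simp only [exp_mul_husimiKernel hw]
  exact ((integrable_husimiKernel hw).comp_sub_right _).const_mul _

lemma integral_exp_mul_husimiKernel (hw : ∀ i, 0 < w i) (a : Phase N) :
    ∫ u : Phase N, Real.exp (∑ i, a i * u i) * husimiKernel w u
      = Real.exp (∑ i, w i ^ 2 * a i ^ 2 / 2) := by
  simp only [exp_mul_husimiKernel hw]
  rw [integral_const_mul, integral_sub_right_eq_self (husimiKernel w), integral_husimiKernel hw,
    mul_one]

/-- For the supremum norm, the exponential of one coordinate's modulus is at most the sum of the two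
linear exponentials. The summand 1 makes the logarithm of the bound nonnegative and covers `N = 0`.
-/
lemma exp_norm_le (a : ℝ) (y : Phase N) :
    Real.exp (a * ‖y‖) ≤ 1 + ∑ i, (Real.exp (∑ j, (Pi.single i a : Phase N) j * y j)
      + Real.exp (∑ j, (Pi.single i (-a) : Phase N) j * y j)) := by
  have hs : ∀ i (b : ℝ), ∑ j, (Pi.single i b : Phase N) j * y j = b * y i := fun i b => by
    simp [-Fintype.sum_sum_type, Pi.single_apply]
  simp only [hs]
  set S := ∑ i, (Real.exp (a * y i) + Real.exp (-a * y i)) with hS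
  have hS0 : 0 ≤ S := Finset.sum_nonneg fun i _ => by positivity
  have h1 : ‖a • y‖ ≤ Real.log (1 + S) := by
    refine (pi_norm_le_iff_of_nonneg (Real.log_nonneg (by linarith))).2 fun i => ?_
    rw [Real.le_log_iff_exp_le (by linarith)]
    have h2 : Real.exp (a * y i) + Real.exp (-a * y i) ≤ S :=
      Finset.single_le_sum (f := fun i => Real.exp (a * y i) + Real.exp (-a * y i))
        (fun i _ => by positivity) (Finset.mem_univ i)
    have h3 : Real.exp ‖(a • y) i‖ ≤ Real.exp (a * y i) + Real.exp (-a * y i) := by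
      rw [Pi.smul_apply, smul_eq_mul, Real.norm_eq_abs]
      rcases abs_cases (a * y i) with ⟨h, _⟩ | ⟨h, _⟩ <;> rw [h]
      · linarith [Real.exp_pos (-a * y i)]
      · rw [← neg_mul]; linarith [Real.exp_pos (a * y i)]
    linarith
  rw [Real.le_log_iff_exp_le (by linarith), norm_smul] at h1
  refine le_trans (Real.exp_le_exp.2 ?_) h1
  gcongr
  exact le_abs_self a

lemma IsExpBounded.integrable_mul_husimiKernel {f : Phase N → ℝ} (hf : IsExpBounded f)
    (hfm : AEStronglyMeasurable f) (hw : ∀ i, 0 < w i) :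
    Integrable fun u => f u * husimiKernel w u := by
  obtain ⟨C, a, hC, ha, hf⟩ := hf
  have hi : Integrable fun u : Phase N => C * ((1 + ∑ i, (Real.exp (∑ j, (Pi.single i a : Phase N) j * u j)
      + Real.exp (∑ j, (Pi.single i (-a) : Phase N) j * u j))) * husimiKernel w u) := by
    refine Integrable.const_mul ?_ _
    simp only [add_mul, one_mul, Finset.sum_mul]
    exact (integrable_husimiKernel hw).add (integrable_finsetSum _ fun i _ =>
      (integrable_exp_mul_husimiKernel hw _).add (integrable_exp_mul_husimiKernel hw _))
  refine hi.mono' (hfm.mul (continuous_husimiKernel hw).aestronglyMeasurable)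
    (Eventually.of_forall fun u => ?_)
  rw [norm_mul, Real.norm_eq_abs, Real.norm_of_nonneg (husimiKernel_pos hw u).le, ← mul_assoc]
  refine mul_le_mul_of_nonneg_right ((hf u).trans ?_) (husimiKernel_pos hw u).le
  gcongr
  exact exp_norm_le a u

end Kernel

/-! ### The Gaussian measure -/

section GaussMeasure

variable {w : PhaseIdx N → ℝ}

/-- The Gaussian probability measure with density `husimiKernel w`. -/
def gaussMeasure (w : PhaseIdx N → ℝ) : Measure (Phase N) :=
  volume.withDensity fun y => ENNReal.ofReal (husimiKernel w y)

lemma measurable_ofReal_husimiKernel (hw : ∀ i, 0 < w i) :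
    Measurable fun y : Phase N => ENNReal.ofReal (husimiKernel w y) :=
  (continuous_husimiKernel hw).measurable.ennreal_ofReal

lemma integral_gaussMeasure (hw : ∀ i, 0 < w i) (f : Phase N → ℝ) :
    ∫ y, f y ∂gaussMeasure w = ∫ y, f y * husimiKernel w y := by
  rw [gaussMeasure, integral_withDensity_eq_integral_toReal_smul₀
    (measurable_ofReal_husimiKernel hw).aemeasurable (by simp)]
  refine integral_congr_ae (Eventually.of_forall fun y => ?_)
  simp only [ENNReal.toReal_ofReal (husimiKernel_pos hw y).le, smul_eq_mul, mul_comm]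

lemma integrable_gaussMeasure_iff (hw : ∀ i, 0 < w i) {f : Phase N → ℝ} :
    Integrable f (gaussMeasure w) ↔ Integrable fun y => f y * husimiKernel w y := by
  rw [gaussMeasure, integrable_withDensity_iff (measurable_ofReal_husimiKernel hw) (by simp)]
  simp only [ENNReal.toReal_ofReal (husimiKernel_pos hw _).le]

lemma isProbabilityMeasure_gaussMeasure (hw : ∀ i, 0 < w i) :
    IsProbabilityMeasure (gaussMeasure w) := by
  refine ⟨?_⟩
  rw [gaussMeasure, withDensity_apply _ MeasurableSet.univ, Measure.restrict_univ,
    ← ofReal_integral_eq_lintegral_ofReal (integrable_husimiKernel hw)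
      (Eventually.of_forall fun y => (husimiKernel_pos hw y).le), integral_husimiKernel hw,
    ENNReal.ofReal_one]

lemma absolutelyContinuous_gaussMeasure (hw : ∀ i, 0 < w i) : volume ≪ gaussMeasure w :=
  withDensity_absolutelyContinuous' (measurable_ofReal_husimiKernel hw).aemeasurable
    (Eventually.of_forall fun y => by simpa using husimiKernel_pos hw y)

lemma IsExpBounded.integrable {f : Phase N → ℝ} (hf : IsExpBounded f) (hfc : Continuous f)
    (hw : ∀ i, 0 < w i) : Integrable f (gaussMeasure w) :=
  (integrable_gaussMeasure_iff hw).2 (hf.integrable_mul_husimiKernel hfc.aestronglyMeasurable hw)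

/-- Translation and evenness of the kernel turn the convolution into an average of translates over a
fixed measure, so derivatives in `z` fall on `f`. -/
lemma husimi_eq_integral (hw : ∀ i, 0 < w i) (f : Phase N → ℝ) (z : Phase N) :
    husimi w f z = ∫ y, f (y + z) ∂gaussMeasure w := by
  rw [integral_gaussMeasure hw, husimi,
    ← integral_add_right_eq_self (fun y => f y * husimiKernel w (z - y)) z]
  refine integral_congr_ae (Eventually.of_forall fun y => ?_)
  simp only [sub_add_cancel_right, husimiKernel_neg hw]

lemma IsTame.integrable {f : Phase N → ℝ} (hf : IsTame f) (hw : ∀ i, 0 < w i) :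
    Integrable f (gaussMeasure w) := hf.isExpBounded.integrable hf.continuous hw

lemma IsTame.memLp {f : Phase N → ℝ} (hf : IsTame f) (hw : ∀ i, 0 < w i) :
    MemLp f 2 (gaussMeasure w) := by
  refine (memLp_two_iff_integrable_sq hf.continuous.aestronglyMeasurable).2 ?_
  simpa [sq] using (hf.mul hf).integrable hw

/-- Gaussian integration by parts. -/
lemma integral_pd_mul_gaussMeasure {f φ : Phase N → ℝ} (hf : IsTame f) (hφ : IsTame φ)
    (hw : ∀ i, 0 < w i) (i : PhaseIdx N) :
    ∫ y, pd i f y * φ y ∂gaussMeasure w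
      = ∫ y, f y * ((1 / w i ^ 2) * (y i * φ y) - pd i φ y) ∂gaussMeasure w := by
  rw [integral_gaussMeasure hw, integral_gaussMeasure hw]
  have hk := (contDiff_husimiKernel (N := N) hw).differentiable (by simp)
  have hpd : ∀ y, fderiv ℝ (fun y => φ y * husimiKernel w y) y (Pi.single i 1)
      = (pd i φ y - (1 / w i ^ 2) * (y i * φ y)) * husimiKernel w y := fun y => by
    have h := pd_mul (hφ.differentiable y) (hk y) i
    rw [pd_husimiKernel hw] at h
    refine h.trans ?_
    ring
  have hint : ∀ g : Phase N → ℝ, IsTame g → Integrable fun y => g y * husimiKernel w y :=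
    fun g hg => hg.isExpBounded.integrable_mul_husimiKernel hg.continuous.aestronglyMeasurable hw
  have hop : IsTame fun y => pd i φ y - (1 / w i ^ 2) * (y i * φ y) :=
    (hφ.pd i).sub (((IsTame.coord i).mul hφ).const_mul _)
  have key := integral_mul_fderiv_eq_neg_fderiv_mul_of_integrable (𝕜 := ℝ) (μ := volume) (f := f)
    (g := fun y => φ y * husimiKernel w y) (v := Pi.single i 1) ?_ ?_ ?_
    (fun y _ => hf.differentiable y) (fun y _ => (hφ.differentiable y).mul (hk y))
  · simp only [hpd] at key
    rw [← neg_eq_iff_eq_neg, ← integral_neg] at key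
    refine Eq.trans ?_ (key.symm.trans ?_) <;>
    · refine integral_congr_ae (Eventually.of_forall fun y => ?_)
      simp only [pd]
      ring
  · simpa only [mul_assoc, pd] using hint _ ((hf.pd i).mul hφ)
  · simp only [hpd]
    simpa only [mul_assoc] using hint _ (hf.mul hop)
  · simpa only [mul_assoc] using hint _ (hf.mul hφ)

/-- The mean of a derivative is represented by a tame function. -/
lemma exists_integral_pdList_eq (hw : ∀ i, 0 < w i) (α : List (PhaseIdx N)) :
    ∃ p : Phase N → ℝ, IsTame p ∧ ∀ f : Phase N → ℝ, IsTame f →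
      ∫ y, pdList α f y ∂gaussMeasure w = ∫ y, f y * p y ∂gaussMeasure w := by
  -- The induction needs an arbitrary tame weight, because every integration by parts changes the
  -- weight.
  suffices h : ∀ φ : Phase N → ℝ, IsTame φ → ∃ p : Phase N → ℝ, IsTame p ∧
      ∀ f : Phase N → ℝ, IsTame f →
      ∫ y, pdList α f y * φ y ∂gaussMeasure w = ∫ y, f y * p y ∂gaussMeasure w by
    simpa using h _ (IsTame.const 1)
  induction α with
  | nil => exact fun φ hφ => ⟨φ, hφ, fun f _ => rfl⟩
  | cons i α ih =>
    intro φ hφ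
    obtain ⟨p, hp, h⟩ := ih _ ((((IsTame.coord i).mul hφ).const_mul (1 / w i ^ 2)).sub (hφ.pd i))
    exact ⟨p, hp, fun f hf => by
      rw [← h f hf, pdList_cons, integral_pd_mul_gaussMeasure (hf.pdList α) hφ hw i]⟩

lemma integral_exp_gaussMeasure (hw : ∀ i, 0 < w i) (a : Phase N) :
    ∫ y, Real.exp (∑ i, a i * y i) ∂gaussMeasure w = Real.exp (∑ i, w i ^ 2 * a i ^ 2 / 2) := by
  rw [integral_gaussMeasure hw, integral_exp_mul_husimiKernel hw]

end GaussMeasure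

/-! ### Uniqueness of exponential moments -/

/-- All exponential moments are finite, so for each functional the complex moment generating
function is entire and is determined by its real values; its value at `i` is the characteristic
function. -/
lemma measure_ext_of_exp_moments {E : Type*} [NormedAddCommGroup E] [NormedSpace ℝ E]
    [CompleteSpace E] [MeasurableSpace E] [BorelSpace E] [SecondCountableTopology E]
    {μ ν : Measure E} [IsFiniteMeasure μ] [IsFiniteMeasure ν]
    (hμ : ∀ L : E →L[ℝ] ℝ, Integrable (fun x => Real.exp (L x)) μ)
    (h : ∀ L : E →L[ℝ] ℝ, ∫ x, Real.exp (L x) ∂μ = ∫ x, Real.exp (L x) ∂ν) : μ = ν := by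
  refine Measure.ext_of_charFunDual (funext fun L => ?_)
  have hmgf : ProbabilityTheory.mgf L μ = ProbabilityTheory.mgf L ν := funext fun t => by
    simpa [ProbabilityTheory.mgf] using h (t • L)
  have hset : ProbabilityTheory.integrableExpSet L μ = univ := eq_univ_of_forall fun t => by
    simpa [ProbabilityTheory.integrableExpSet] using hμ (t • L)
  have h0 : μ = 0 ↔ ν = 0 := by
    have h1 := h 0
    simp only [zero_apply, Real.exp_zero, integral_const, smul_eq_mul, mul_one] at h1
    rw [← Measure.measure_univ_eq_zero, ← Measure.measure_univ_eq_zero (μ := ν),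
      ← measureReal_eq_zero_iff, ← measureReal_eq_zero_iff, h1]
  have key := ProbabilityTheory.eqOn_complexMGF_of_mgf' hmgf h0 (x := Complex.I)
    (by simp [hset])
  simpa [ProbabilityTheory.complexMGF, charFunDual_apply, mul_comm] using key

/-! ### Totality of exponentials and injectivity of the Husimi transform -/

section Completeness

variable {w : PhaseIdx N → ℝ}

/-- The exponentials are total for the Gaussian measure. -/
lemma ae_eq_zero_of_exp_moments (hw : ∀ i, 0 < w i) {f : Phase N → ℝ}
    (hf : MemLp f 2 (gaussMeasure w))
    (h : ∀ a : Phase N, ∫ y, f y * Real.exp (∑ i, a i * y i) ∂gaussMeasure w = 0) :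
    f =ᵐ[gaussMeasure w] 0 := by
  have := isProbabilityMeasure_gaussMeasure hw
  have hfi : Integrable f (gaussMeasure w) := hf.integrable one_le_two
  have hfe : ∀ a : Phase N,
      Integrable (fun y => f y * Real.exp (∑ i, a i * y i)) (gaussMeasure w) := fun a =>
    hf.integrable_mul ((IsTame.exp_sum a).memLp hw)
  have hL : ∀ L : Phase N →L[ℝ] ℝ, ∃ a : Phase N, ∀ y, L y = ∑ i, a i * y i := fun L =>
    ⟨fun i => L (Pi.single i 1), fun y => by
      conv_lhs => rw [← sum_smul_single y]
      simp [map_sum, mul_comm]⟩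
  have hfm : AEMeasurable f (gaussMeasure w) := hf.aestronglyMeasurable.aemeasurable
  have hp : AEMeasurable (fun y => ENNReal.ofReal (f y)) (gaussMeasure w) := hfm.ennreal_ofReal
  have hn : AEMeasurable (fun y => ENNReal.ofReal (-f y)) (gaussMeasure w) :=
    hfm.neg.ennreal_ofReal
  have ip : ∫⁻ y, ENNReal.ofReal (f y) ∂gaussMeasure w ≠ ⊤ := hfi.lintegral_lt_top.ne
  have iN : ∫⁻ y, ENNReal.ofReal (-f y) ∂gaussMeasure w ≠ ⊤ := hfi.neg.lintegral_lt_top.ne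
  have := isFiniteMeasure_withDensity ip
  have := isFiniteMeasure_withDensity iN
  have hip : ∀ a : Phase N, Integrable
      (fun y => max (f y) 0 * Real.exp (∑ i, a i * y i)) (gaussMeasure w) := fun a => by
    refine (hfe a).mono ((hfm.max aemeasurable_const).aestronglyMeasurable.mul
      (IsTame.exp_sum a).continuous.aestronglyMeasurable) (Eventually.of_forall fun y => ?_)
    rw [norm_mul, norm_mul]
    gcongr
    rw [Real.norm_eq_abs, Real.norm_eq_abs, abs_of_nonneg (le_max_right _ _)]
    exact max_le (le_abs_self _) (abs_nonneg _)
  have hin : ∀ a : Phase N, Integrable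
      (fun y => max (-f y) 0 * Real.exp (∑ i, a i * y i)) (gaussMeasure w) := fun a => by
    refine ((hip a).sub (hfe a)).congr (Eventually.of_forall fun y => ?_)
    simp only [Pi.sub_apply, ← sub_mul]
    congr 1
    rcases le_total (f y) 0 with h | h
    · simp [h]
    · simp [h]
  -- The positive and negative parts of `f` are densities of finite measures with equal exponential
  -- moments; by uniqueness the two parts agree almost everywhere, and as at each point one of them
  -- is zero, both vanish.
  have heq : (gaussMeasure w).withDensity (fun y => ENNReal.ofReal (f y))
      = (gaussMeasure w).withDensity (fun y => ENNReal.ofReal (-f y)) := by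
    refine measure_ext_of_exp_moments (fun L => ?_) fun L => ?_
    · obtain ⟨a, ha⟩ := hL L
      simp only [ha]
      rw [integrable_withDensity_iff_integrable_smul₀' hp (by simp)]
      simpa [ENNReal.toReal_ofReal'] using hip a
    · obtain ⟨a, ha⟩ := hL L
      simp only [ha]
      rw [integral_withDensity_eq_integral_toReal_smul₀ hp (by simp),
        integral_withDensity_eq_integral_toReal_smul₀ hn (by simp)]
      simp only [ENNReal.toReal_ofReal', smul_eq_mul]
      rw [← sub_eq_zero, ← integral_sub (hip a) (hin a)]
      refine Eq.trans ?_ (h a)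
      refine integral_congr_ae (Eventually.of_forall fun y => ?_)
      simp only [← sub_mul]
      congr 1
      rcases le_total (f y) 0 with h | h
      · simp [h]
      · simp [h]
  have hae := (withDensity_eq_iff hp hn ip).1 heq
  filter_upwards [hae] with y hy
  rcases le_total (f y) 0 with h | h
  · rw [ENNReal.ofReal_of_nonpos h, eq_comm, ENNReal.ofReal_eq_zero] at hy
    simp only [Pi.zero_apply]
    linarith
  · rw [ENNReal.ofReal_of_nonpos (neg_nonpos.2 h), ENNReal.ofReal_eq_zero] at hy
    exact le_antisymm hy h

lemma IsExpBounded.memLp {f : Phase N → ℝ} (hf : IsExpBounded f) (hfc : Continuous f)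
    (hw : ∀ i, 0 < w i) : MemLp f 2 (gaussMeasure w) := by
  refine (memLp_two_iff_integrable_sq hfc.aestronglyMeasurable).2 ?_
  simpa [sq] using (hf.mul hf).integrable (hfc.mul hfc) hw

/-- The Husimi transform is injective. -/
lemma eq_zero_of_husimi_eq_zero (hw : ∀ i, 0 < w i) {f : Phase N → ℝ} (hfc : Continuous f)
    (hf : IsExpBounded f) (h : ∀ z, husimi w f z = 0) : f = 0 := by
  have hae : f =ᵐ[gaussMeasure w] 0 := by
    refine ae_eq_zero_of_exp_moments hw (hf.memLp hfc hw) fun a => ?_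
    rw [integral_gaussMeasure hw]
    -- By completing the square, the exponential moment with exponent `a` is a constant times the
    -- Husimi transform at the point `w i ^ 2 * a i`.
    have h1 := h fun i => w i ^ 2 * a i
    rw [husimi] at h1
    have h2 : ∀ y : Phase N, f y * Real.exp (∑ i, a i * y i) * husimiKernel w y
        = Real.exp (∑ i, w i ^ 2 * a i ^ 2 / 2)
          * (f y * husimiKernel w ((fun i => w i ^ 2 * a i) - y)) := fun y => by
      rw [mul_assoc, exp_mul_husimiKernel hw, ← husimiKernel_neg hw, neg_sub]
      ring
    simp only [h2]
    rw [integral_const_mul, h1, mul_zero]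
  have hae' : f =ᵐ[volume] 0 := (absolutelyContinuous_gaussMeasure hw).ae_eq hae
  exact Measure.eq_of_ae_eq hae' hfc continuous_zero

end Completeness

/-! ### Expansions of an inner product in positive forms -/

section Forms

variable {E : Type*} [NormedAddCommGroup E] [InnerProductSpace ℝ E]

/-- On the span, positivity bounds the partial sums of the quadratic forms by the squared norm, and
density extends the bound. Cauchy–Schwarz then makes these partial sums equicontinuous, so the set
where they converge to the squared norm is closed. Polarization returns to the bilinear statement.
-/
lemma hasSum_inner_of_dense_span {T : ℕ → E →L[ℝ] E →L[ℝ] ℝ}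
    (hsymm : ∀ m x y, T m x y = T m y x) (hpos : ∀ m x, 0 ≤ T m x x) {D : Set E}
    (hD : (Submodule.span ℝ D).topologicalClosure = ⊤)
    (h : ∀ x ∈ D, ∀ y ∈ D, HasSum (fun m => T m x y) (inner ℝ x y)) (x y : E) :
    HasSum (fun m => T m x y) (inner ℝ x y) := by
  have h1 : ∀ x ∈ D, ∀ y ∈ Submodule.span ℝ D, HasSum (fun m => T m x y) (inner ℝ x y) := by
    intro x hx y hy
    induction hy using Submodule.span_induction with
    | mem y hy => exact h x hx y hy
    | zero => simp
    | add y y' _ _ hy hy' => simpa [inner_add_right] using hy.add hy'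
    | smul c y _ hy => simpa [inner_smul_right] using hy.mul_left c
  have h2 : ∀ x ∈ Submodule.span ℝ D, ∀ y ∈ Submodule.span ℝ D,
      HasSum (fun m => T m x y) (inner ℝ x y) := by
    intro x hx y hy
    induction hx using Submodule.span_induction with
    | mem x hx => exact h1 x hx y hy
    | zero => simp
    | add x x' _ _ hx hx' => simpa [inner_add_left] using hx.add hx'
    | smul c x _ hx => simpa [inner_smul_left] using hx.mul_left c
  have hdense : Dense (Submodule.span ℝ D : Set E) := by
    rwa [Submodule.dense_iff_topologicalClosure_eq_top]
  have hq : ∀ (F : Finset ℕ) (x : E), ∑ m ∈ F, T m x x ≤ ‖x‖ ^ 2 := by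
    intro F
    refine hdense.induction (fun x hx => ?_) (isClosed_le (by fun_prop) (by fun_prop))
    rw [← real_inner_self_eq_norm_sq]
    exact sum_le_hasSum F (fun m _ => hpos m x) (h2 x hx x hx)
  have hCS : ∀ (F : Finset ℕ) (u v : E), |∑ m ∈ F, T m u v| ≤ ‖u‖ * ‖v‖ := by
    intro F u v
    let B : LinearMap.BilinForm ℝ E := ∑ m ∈ F, ((ContinuousLinearMap.coeLM ℝ).comp (T m : E →ₗ[ℝ] E →L[ℝ] ℝ))
    have hB : ∀ x y, B x y = ∑ m ∈ F, T m x y := fun x y => by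
      simp [B, LinearMap.sum_apply]
    have h3 : (B u v) ^ 2 ≤ B u u * B v v :=
      LinearMap.BilinForm.apply_sq_le_of_symm B
        (fun x => by rw [hB]; exact Finset.sum_nonneg fun m _ => hpos m x)
        ⟨fun x y => by simp [hB, hsymm]⟩ u v
    rw [hB, hB, hB] at h3
    refine abs_le_of_sq_le_sq ?_ (by positivity)
    rw [mul_pow]
    exact h3.trans (mul_le_mul (hq F u) (hq F v)
      (Finset.sum_nonneg fun m _ => hpos m v) (by positivity))
  have hequi : Equicontinuous fun (F : Finset ℕ) (x : E) => ∑ m ∈ F, T m x x := by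
    intro x
    rw [Metric.equicontinuousAt_iff_right]
    intro ε hε
    have hc : Tendsto (fun y : E => ‖x - y‖ * ‖x + y‖) (𝓝 x) (𝓝 0) := by
      have : Continuous fun y : E => ‖x - y‖ * ‖x + y‖ := by fun_prop
      simpa using this.tendsto x
    filter_upwards [hc.eventually (gt_mem_nhds hε)] with y hy F
    have h4 : ∑ m ∈ F, T m x x - ∑ m ∈ F, T m y y = ∑ m ∈ F, T m (x - y) (x + y) := by
      rw [← Finset.sum_sub_distrib]
      refine Finset.sum_congr rfl fun m _ => ?_
      simp only [map_sub, map_add, sub_apply]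
      rw [hsymm m y x]
      ring
    rw [Real.dist_eq, h4]
    exact (hCS F _ _).trans_lt hy
  have hsq : ∀ x, HasSum (fun m => T m x x) (‖x‖ ^ 2) := by
    have hcl : IsClosed {x : E | Tendsto (fun F : Finset ℕ => ∑ m ∈ F, T m x x) atTop
        (𝓝 (‖x‖ ^ 2))} :=
      hequi.isClosed_setOfPred_tendsto (f := fun x => ‖x‖ ^ 2) (by fun_prop)
    exact hdense.induction (fun x hx => by
      have := h2 x hx x hx
      rwa [real_inner_self_eq_norm_sq] at this) hcl
  have h5 := ((hsq (x + y)).sub (hsq (x - y))).mul_left (1 / 4)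
  have h6 : (1 / 4 : ℝ) * (‖x + y‖ ^ 2 - ‖x - y‖ ^ 2) = inner ℝ x y := by
    rw [norm_add_sq_real, norm_sub_sq_real]
    ring
  rw [h6] at h5
  refine h5.congr_fun fun m => ?_
  simp only [map_sub, map_add, sub_apply, add_apply]
  rw [hsymm m y x]
  ring

end Forms

/-! ### Products under the Husimi transform -/

section HusimiProduct

variable {w : PhaseIdx N → ℝ} {f g : Phase N → ℝ}

lemma IsExpBounded.abs {f : Phase N → ℝ} (hf : IsExpBounded f) : IsExpBounded fun y => |f y| :=
  hf.of_le fun y => by simp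

lemma norm_fderiv_le_sum_pd (f : Phase N → ℝ) (y : Phase N) :
    ‖fderiv ℝ f y‖ ≤ ∑ i, |pd i f y| := by
  refine ContinuousLinearMap.opNorm_le_bound _ (Finset.sum_nonneg fun i _ => abs_nonneg _)
    fun δ => ?_
  rw [fderiv_eq_sum_pd, Finset.sum_mul]
  refine (norm_sum_le _ _).trans (Finset.sum_le_sum fun i _ => ?_)
  rw [norm_mul, mul_comm, Real.norm_eq_abs (pd i f y)]
  exact mul_le_mul_of_nonneg_left (norm_le_pi_norm δ i) (abs_nonneg _)

lemma hasFDerivAt_husimi (hw : ∀ i, 0 < w i) (hf : IsTame f) (z : Phase N) :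
    HasFDerivAt (husimi w f) (∫ y, fderiv ℝ f (y + z) ∂gaussMeasure w) z := by
  have hfun : husimi w f = fun z => ∫ y, f (y + z) ∂gaussMeasure w :=
    funext (husimi_eq_integral hw f)
  have hcd : Continuous (fderiv ℝ f) := hf.1.continuous_fderiv (by simp)
  obtain ⟨C, a, hC, ha, hb⟩ := IsExpBounded.sum Finset.univ fun i _ => (hf.pd i).isExpBounded.abs
  have hexp : IsExpBounded fun y : Phase N => C * Real.exp (a * (‖z‖ + 1)) * Real.exp (a * ‖y‖) := by
    refine (IsExpBounded.const _).mul ⟨1, a, zero_le_one, ha, fun y => ?_⟩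
    rw [one_mul, abs_of_pos (Real.exp_pos _)]
  rw [hfun]
  refine hasFDerivAt_integral_of_dominated_of_fderiv_le (F' := fun z y => fderiv ℝ f (y + z))
    (Metric.ball_mem_nhds z one_pos)
    (Eventually.of_forall fun x => ((hf.shift x).continuous).aestronglyMeasurable)
    ((hf.shift z).integrable hw) (hcd.comp (by fun_prop)).aestronglyMeasurable
    (Eventually.of_forall fun y x hx => ?_) (hexp.integrable (by fun_prop) hw)
    (Eventually.of_forall fun y x _ => ?_)
  · refine (norm_fderiv_le_sum_pd f _).trans ((le_abs_self _).trans ((hb _).trans ?_))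
    rw [mul_assoc, ← Real.exp_add, ← mul_add]
    have h1 : ‖x‖ ≤ ‖z‖ + 1 := by
      rw [mem_ball_iff_norm] at hx
      linarith [norm_le_norm_add_norm_sub' x z]
    gcongr
    linarith [norm_add_le y x]
  · have h2 : HasFDerivAt (fun x => y + x) (ContinuousLinearMap.id ℝ (Phase N)) x :=
      (hasFDerivAt_id x).const_add y
    simpa [Function.comp_def] using (hf.differentiable (y + x)).hasFDerivAt.comp x h2

lemma pd_husimi (hw : ∀ i, 0 < w i) (hf : IsTame f) (i : PhaseIdx N) :
    pd i (husimi w f) = husimi w (pd i f) := by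
  funext z
  have hint : Integrable (fun y => fderiv ℝ f (y + z)) (gaussMeasure w) := by
    have hcd : Continuous (fderiv ℝ f) := hf.1.continuous_fderiv (by simp)
    refine Integrable.mono' (integrable_finsetSum Finset.univ fun i _ =>
      (((hf.pd i).shift z).integrable hw).abs) (hcd.comp (by fun_prop)).aestronglyMeasurable
      (Eventually.of_forall fun y => norm_fderiv_le_sum_pd f _)
  rw [husimi_eq_integral hw]
  simp only [pd]
  rw [(hasFDerivAt_husimi hw hf z).fderiv, ContinuousLinearMap.integral_apply hint]

lemma husimi_shift (hw : ∀ i, 0 < w i) (f : Phase N → ℝ) (z : Phase N) :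
    (fun y => husimi w f (y + z)) = husimi w (fun y => f (y + z)) := by
  funext y
  rw [husimi_eq_integral hw, husimi_eq_integral hw]
  simp only [add_assoc]

lemma husimi_zero_arg (hw : ∀ i, 0 < w i) (f : Phase N → ℝ) :
    husimi w f 0 = ∫ y, f y ∂gaussMeasure w := by
  simp [husimi_eq_integral hw]

lemma husimiPow_succ (m : ℕ) (f g : Phase N → ℝ) (z : Phase N) :
    (husimiStep w)^[m + 1] (fun f g z => f z * g z) f g z
      = ∑ i, w i ^ 2 * (husimiStep w)^[m] (fun f g z => f z * g z) (pd i f) (pd i g) z := by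
  rw [Function.iterate_succ_apply']
  rfl

lemma inner_toLp (hw : ∀ i, 0 < w i) (hf : IsTame f) (hg : IsTame g) :
    inner ℝ ((hf.memLp hw).toLp f) ((hg.memLp hw).toLp g) = ∫ y, f y * g y ∂gaussMeasure w := by
  rw [L2.inner_def]
  refine integral_congr_ae ?_
  filter_upwards [(hf.memLp hw).coeFn_toLp, (hg.memLp hw).coeFn_toLp] with y h1 h2
  rw [h1, h2]
  exact mul_comm _ _

/-- The powers of the Husimi scalar product, evaluated on Husimi transforms, are bounded positive
forms on the `L²` space of the Gaussian measure. -/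
lemma exists_husimiPow_form (hw : ∀ i, 0 < w i) (m : ℕ) (α : List (PhaseIdx N)) :
    ∃ T : Lp ℝ 2 (gaussMeasure w) →L[ℝ] Lp ℝ 2 (gaussMeasure w) →L[ℝ] ℝ,
      (∀ x y, T x y = T y x) ∧ (∀ x, 0 ≤ T x x) ∧
      ∀ f g (hf : IsTame f) (hg : IsTame g),
        (husimiStep w)^[m] (fun f g z => f z * g z) (husimi w (pdList α f))
          (husimi w (pdList α g)) 0 = T ((hf.memLp hw).toLp f) ((hg.memLp hw).toLp g) := by
  induction m generalizing α with
  | zero =>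
    -- For `m = 0` the form is the square of one functional, the Gaussian mean of the derivative.
    -- Integration by parts represents it by an element of `L²`, hence it is bounded; higher powers
    -- are sums with weights `w i ^ 2`.
    obtain ⟨p, hp, h⟩ := exists_integral_pdList_eq hw α
    let ℓ : Lp ℝ 2 (gaussMeasure w) →L[ℝ] ℝ := innerSL ℝ ((hp.memLp hw).toLp p)
    have hℓ : ∀ f (hf : IsTame f), ℓ ((hf.memLp hw).toLp f) = husimi w (pdList α f) 0 := by
      intro f hf
      rw [husimi_zero_arg hw, h f hf]
      show inner ℝ ((hp.memLp hw).toLp p) ((hf.memLp hw).toLp f) = _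
      rw [inner_toLp hw hp hf]
      simp only [mul_comm]
    refine ⟨ContinuousLinearMap.smulRight ℓ ℓ, fun x y => ?_, fun x => ?_, fun f g hf hg => ?_⟩
    · simp [mul_comm]
    · simpa using mul_self_nonneg _
    · show _ = ℓ _ * ℓ _
      rw [hℓ f hf, hℓ g hg]
      rfl
  | succ m ih =>
    choose T hsymm hpos hT using fun i => ih (i :: α)
    refine ⟨∑ i, w i ^ 2 • T i, fun x y => ?_, fun x => ?_, fun f g hf hg => ?_⟩
    · simp only [sum_apply, smul_apply]
      exact Finset.sum_congr rfl fun i _ => by rw [hsymm]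
    · simp only [sum_apply, smul_apply]
      exact Finset.sum_nonneg fun i _ => smul_nonneg (by positivity) (hpos i x)
    · simp only [sum_apply, smul_apply]
      rw [husimiPow_succ]
      refine Finset.sum_congr rfl fun i _ => ?_
      rw [pd_husimi hw (hf.pdList α), pd_husimi hw (hg.pdList α), ← pdList_cons, ← pdList_cons,
        hT i f g hf hg, smul_eq_mul]

lemma husimi_const_mul (c : ℝ) (f : Phase N → ℝ) :
    husimi w (fun y => c * f y) = fun z => c * husimi w f z := by
  funext z
  simp only [husimi, mul_assoc]
  rw [integral_const_mul]

/-- Exponentials are eigenfunctions of all derivatives, so each Husimi factor contributes `∑ i, w i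
^ 2 * a i * b i`. The prefactors `s` and `t` absorb the eigenvalues during the induction. -/
lemma husimiPow_exp (hw : ∀ i, 0 < w i) (a b : Phase N) (m : ℕ) (s t : ℝ) :
    (husimiStep w)^[m] (fun f g z => f z * g z)
        (husimi w fun y => s * Real.exp (∑ i, a i * y i))
        (husimi w fun y => t * Real.exp (∑ i, b i * y i)) 0
      = s * t * (∑ i, w i ^ 2 * a i * b i) ^ m
        * (Real.exp (∑ i, w i ^ 2 * a i ^ 2 / 2) * Real.exp (∑ i, w i ^ 2 * b i ^ 2 / 2)) := by
  induction m generalizing s t with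
  | zero =>
    simp only [Function.iterate_zero, id, husimi_const_mul, husimi_zero_arg hw,
      integral_exp_gaussMeasure hw]
    ring
  | succ m ih =>
    rw [husimiPow_succ, pow_succ, mul_comm (_ ^ m), Finset.sum_mul, Finset.mul_sum,
      Finset.sum_mul]
    refine Finset.sum_congr rfl fun i _ => ?_
    have hp : ∀ (s : ℝ) (a : Phase N), pd i (fun y => s * Real.exp (∑ i, a i * y i))
        = fun y => s * a i * Real.exp (∑ i, a i * y i) := fun s a => by
      funext y
      rw [pd_const_mul ((IsTame.exp_sum a).differentiable y), IsTame.pd_exp_sum]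
      ring
    rw [pd_husimi hw ((IsTame.exp_sum a).const_mul s), pd_husimi hw ((IsTame.exp_sum b).const_mul t),
      hp, hp, ih]
    ring

/-- The exponential function with exponent `a`, as an element of `L²`. -/
def expLp (hw : ∀ i, 0 < w i) (a : Phase N) : Lp ℝ 2 (gaussMeasure w) :=
  ((IsTame.exp_sum a).memLp hw).toLp (fun y => Real.exp (∑ i, a i * y i))

/-- An element orthogonal to the span has vanishing exponential moments and is therefore zero. -/
lemma closure_span_exp (hw : ∀ i, 0 < w i) :
    (Submodule.span ℝ (range (expLp (N := N) hw))).topologicalClosure = ⊤ := by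
  have := isProbabilityMeasure_gaussMeasure hw
  rw [Submodule.topologicalClosure_eq_top_iff, Submodule.eq_bot_iff]
  intro x hx
  have hx' : (x : Phase N → ℝ) =ᵐ[gaussMeasure w] 0 := by
    refine ae_eq_zero_of_exp_moments hw (Lp.memLp x) fun a => ?_
    have h1 : inner ℝ (expLp hw a) x = 0 :=
      (Submodule.mem_orthogonal _ x).1 hx _ (Submodule.subset_span (mem_range_self a))
    rw [L2.inner_def] at h1
    refine Eq.trans (integral_congr_ae ?_) h1
    filter_upwards [((IsTame.exp_sum a).memLp hw).coeFn_toLp] with y h2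
    rw [expLp, h2]
    rfl
  exact (Lp.eq_zero_iff_ae_eq_zero).2 hx'

/-- The right-hand side is an inner product in `L²` and the terms are positive forms, so testing on
exponentials suffices. There the claim is the power series of `exp (∑ i, w i ^ 2 * a i * b i)`, the
cross term in the Gaussian mean of a product of two exponentials. -/
lemma hasSum_husimiPow_zero (hw : ∀ i, 0 < w i) (hf : IsTame f) (hg : IsTame g) :
    HasSum (fun m : ℕ => 1 / (m.factorial : ℝ) *
      (husimiStep w)^[m] (fun f g z => f z * g z) (husimi w f) (husimi w g) 0)
      (∫ y, f y * g y ∂gaussMeasure w) := by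
  choose T hsymm hpos hT using fun m => exists_husimiPow_form hw m []
  have key := hasSum_inner_of_dense_span (T := fun m => (1 / (m.factorial : ℝ)) • T m)
    (fun m x y => by simp [hsymm m x y])
    (fun m x => by
      have := hpos m x
      simp only [smul_apply, smul_eq_mul]
      positivity) (closure_span_exp hw) ?_ ((hf.memLp hw).toLp f) ((hg.memLp hw).toLp g)
  · rw [inner_toLp hw hf hg] at key
    refine key.congr_fun fun m => ?_
    simp only [smul_apply, smul_eq_mul, ← hT m f g hf hg, pdList_nil]
  · rintro _ ⟨a, rfl⟩ _ ⟨b, rfl⟩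
    rw [expLp, expLp, inner_toLp hw (IsTame.exp_sum a) (IsTame.exp_sum b)]
    simp only [smul_apply, smul_eq_mul, ← hT _ _ _ (IsTame.exp_sum a) (IsTame.exp_sum b),
      pdList_nil]
    have h1 : ∀ m : ℕ, (husimiStep w)^[m] (fun f g z => f z * g z)
        (husimi w fun y => Real.exp (∑ i, a i * y i))
        (husimi w fun y => Real.exp (∑ i, b i * y i)) 0
        = (∑ i, w i ^ 2 * a i * b i) ^ m
        * (Real.exp (∑ i, w i ^ 2 * a i ^ 2 / 2) * Real.exp (∑ i, w i ^ 2 * b i ^ 2 / 2)) :=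
      fun m => by simpa only [one_mul] using husimiPow_exp hw a b m 1 1
    have h2 : ∫ y, Real.exp (∑ i, a i * y i) * Real.exp (∑ i, b i * y i) ∂gaussMeasure w
        = Real.exp (∑ i, w i ^ 2 * a i * b i) * (Real.exp (∑ i, w i ^ 2 * a i ^ 2 / 2)
          * Real.exp (∑ i, w i ^ 2 * b i ^ 2 / 2)) := by
      simp only [← Real.exp_add, ← Finset.sum_add_distrib, ← add_mul]
      rw [integral_exp_gaussMeasure hw (fun i => a i + b i)]
      congr 1
      refine Finset.sum_congr rfl fun i _ => ?_
      ring
    rw [h2]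
    have h3 : HasSum (fun m : ℕ => (∑ i, w i ^ 2 * a i * b i) ^ m / (m.factorial : ℝ))
        (Real.exp (∑ i, w i ^ 2 * a i * b i)) := by
      rw [Real.exp_eq_exp_ℝ]
      exact NormedSpace.exp_series_hasSum_exp' (𝕂 := ℝ) _ |>.congr_fun fun m => by
        simp [div_eq_inv_mul]
    refine (h3.mul_right _).congr_fun fun m => ?_
    rw [h1]
    ring

/-- The Husimi scalar product of Husimi transforms is the Husimi transform of the product. -/
lemma hasSum_husimiPow (hw : ∀ i, 0 < w i) (hf : IsTame f) (hg : IsTame g) (z : Phase N) :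
    HasSum (fun m : ℕ => 1 / (m.factorial : ℝ) * biTerm w 0 m (husimi w f) (husimi w g) z)
      (husimi w (fun y => f y * g y) z) := by
  have h := hasSum_husimiPow_zero hw (hf.shift z) (hg.shift z)
  rw [husimi_eq_integral hw]
  refine h.congr_fun fun m => ?_
  rw [← husimi_shift hw, ← husimi_shift hw, ← (isBidiff_husimiPow w m).shift, zero_add]
  rfl

lemma husimi_sum_sub (hw : ∀ i, 0 < w i) {σ : Type*} [Fintype σ] {F G : σ → Phase N → ℝ}
    (hF : ∀ s, IsTame (F s)) (hG : ∀ s, IsTame (G s)) (z : Phase N) :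
    husimi w (fun y => ∑ s, (F s y - G s y)) z = ∑ s, (husimi w (F s) z - husimi w (G s) z) := by
  simp only [husimi_eq_integral hw]
  rw [integral_finsetSum _ fun s _ => (((hF s).sub (hG s)).shift z).integrable hw]
  exact Finset.sum_congr rfl fun s _ => integral_sub (((hF s).shift z).integrable hw)
    (((hG s).shift z).integrable hw)

lemma IsTame.poissonPow (hf : IsTame f) (hg : IsTame g) (k : ℕ) : IsTame (poissonPow k f g) := by
  rw [poissonPow_eq_biTerm (fun _ => 0)]
  exact IsTame.bidiff (isBidiff_biTerm _ k 0) hf hg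

/-- Derivatives commute with the Husimi transform, so each Poisson factor can be passed to `f` and
`g`. -/
lemma hasSum_biTerm_husimi (hw : ∀ i, 0 < w i) (hf : IsTame f) (hg : IsTame g) (k : ℕ)
    (z : Phase N) :
    HasSum (fun m : ℕ => 1 / (m.factorial : ℝ) * biTerm w k m (husimi w f) (husimi w g) z)
      (husimi w (poissonPow k f g) z) := by
  induction k generalizing f g with
  | zero => exact hasSum_husimiPow hw hf hg z
  | succ k ih =>
    have h1 : (SkodjeGauge.poissonPow (k + 1) f g : Phase N → ℝ) = fun y => ∑ n : Fin N,
        (SkodjeGauge.poissonPow k (pd (Sum.inl n) f) (pd (Sum.inr n) g) y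
          - SkodjeGauge.poissonPow k (pd (Sum.inr n) f) (pd (Sum.inl n) g) y) := by
      rw [poissonPow_succ]
      rfl
    rw [h1, husimi_sum_sub hw (fun n => (hf.pd _).poissonPow (hg.pd _) k)
      (fun n => (hf.pd _).poissonPow (hg.pd _) k)]
    have := hasSum_sum fun (n : Fin N) (_ : n ∈ Finset.univ) =>
      (ih (hf.pd (Sum.inl n)) (hg.pd (Sum.inr n))).sub (ih (hf.pd (Sum.inr n)) (hg.pd (Sum.inl n)))
    refine this.congr_fun fun m => ?_
    rw [biTerm_succ]
    simp only [poissonStep, Finset.mul_sum, pd_husimi hw hf, pd_husimi hw hg, mul_sub]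

end HusimiProduct

/-! ### The Liouville equation before the Husimi transformation -/

section InverseHusimi

variable {M : Mechanics} {ħ : ℝ} {w : PhaseIdx N → ℝ} {J : Set ℝ} {H₀ : Phase N → ℝ}
  {P Q : ℝ → Phase N → ℝ}

/-- The right-hand side of the Liouville equation. -/
def moyalField (M : Mechanics) (ħ : ℝ) (f g : Phase N → ℝ) (z : Phase N) : ℝ :=
  ∑' k : ℕ, genCoeff M ħ k * poissonPow (k + 1) f g z

lemma MoyalConverge.exists_bound (hħ : 0 < ħ) (hH : IsTame H₀) (hM : MoyalConverge M ħ J H₀ P)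
    {t : ℝ} (ht : t ∈ J) (hP : IsTame (P t)) :
    ∃ (b : ℕ → ℝ) (W : Phase N → ℝ), Summable b ∧ Continuous W ∧ IsExpBounded W ∧
      ∀ k z, |genCoeff M ħ k * poissonPow (k + 1) H₀ (P t) z| ≤ b k * W z := by
  cases M with
  | classical =>
    refine ⟨fun k => if k = 0 then 1 else 0, fun z => |poissonPow 1 H₀ (P t) z|,
      (hasSum_ite_eq 0 (1 : ℝ)).summable, ((hH.poissonPow hP 1).continuous).abs,
      (hH.poissonPow hP 1).isExpBounded.abs, fun k z => ?_⟩
    by_cases hk : k = 0 <;> simp [genCoeff, hk]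
  | quantum =>
    obtain ⟨r, b, hb, h⟩ := hM t ht
    -- The modulus of the sinc coefficient at `k` is at most `2 / ħ` times the majorant coefficient
    -- at `k + 1`, the order of the Poisson power that it multiplies.
    refine ⟨fun k => 2 / ħ * b (k + 1), fun z => (1 + ‖z‖) ^ r,
      ((summable_nat_add_iff 1).2 hb).mul_left _, by fun_prop,
      IsExpBounded.of_poly (C := 1) (r := r) fun y => by
        rw [one_mul, abs_of_nonneg (by positivity)], fun k z => ?_⟩
    have h1 : |genCoeff Mechanics.quantum ħ k| ≤ 2 / ħ * majCoeff Mechanics.quantum ħ (k + 1) := by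
      have h2 : 2 / ħ * majCoeff Mechanics.quantum ħ (k + 1) = (ħ / 2) ^ k / ((k + 1).factorial : ℝ) := by
        simp only [majCoeff, pow_succ]
        field_simp
      rw [h2]
      simp only [genCoeff]
      split_ifs with he
      · rw [abs_div, abs_mul, abs_pow, abs_neg, abs_one, one_pow, one_mul, abs_pow,
          abs_of_pos (by positivity : 0 < ħ / 2), Nat.abs_cast]
      · rw [abs_zero]; positivity
    rw [abs_mul]
    refine (mul_le_mul_of_nonneg_right h1 (abs_nonneg _)).trans ?_
    rw [mul_assoc, mul_assoc]
    exact mul_le_mul_of_nonneg_left (h (k + 1) z) (by positivity)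

lemma summable_mul_of_bound {b : ℕ → ℝ} (hb : Summable b) {F : ℕ → ℝ} {W : ℝ}
    (h : ∀ k, |F k| ≤ b k * W) : Summable F :=
  Summable.of_norm_bounded (hb.mul_right W) h

lemma continuous_tsum_of_bound {b : ℕ → ℝ} {W : Phase N → ℝ} {F : ℕ → Phase N → ℝ}
    (hb : Summable b) (hW : Continuous W) (hF : ∀ k, Continuous (F k))
    (h : ∀ k z, |F k z| ≤ b k * W z) : Continuous fun z => ∑' k, F k z := by
  refine continuous_iff_continuousAt.2 fun z => ?_
  obtain ⟨C, hC⟩ := (isCompact_closedBall z 1).exists_bound_of_continuousOn hW.continuousOn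
  have hc : ContinuousOn (fun z => ∑' k, F k z) (Metric.closedBall z 1) := by
    refine continuousOn_tsum (fun k => (hF k).continuousOn) (hb.abs.mul_right C) fun k y hy => ?_
    refine (h k y).trans ((le_abs_self _).trans ?_)
    rw [abs_mul]
    exact mul_le_mul_of_nonneg_left (hC y hy) (abs_nonneg _)
  exact hc.continuousAt (Metric.closedBall_mem_nhds z one_pos)

lemma isExpBounded_tsum_of_bound {b : ℕ → ℝ} {W : Phase N → ℝ} {F : ℕ → Phase N → ℝ}
    (hb : Summable b) (hW : IsExpBounded W) (h : ∀ k z, |F k z| ≤ b k * W z) :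
    IsExpBounded fun z => ∑' k, F k z := by
  refine ((IsExpBounded.const (∑' k, b k)).mul hW).of_le fun z => ?_
  exact (tsum_of_norm_bounded (hb.hasSum.mul_right (W z)) (f := fun k => F k z)
    fun k => h k z).trans (le_abs_self _)

lemma hasSum_husimi_of_bound (hw : ∀ i, 0 < w i) {b : ℕ → ℝ} {W : Phase N → ℝ}
    {F : ℕ → Phase N → ℝ} (hb : Summable b) (hW : Continuous W) (hWe : IsExpBounded W)
    (hF : ∀ k, Continuous (F k)) (h : ∀ k z, |F k z| ≤ b k * W z) (z : Phase N) :
    HasSum (fun k => husimi w (F k) z) (husimi w (fun y => ∑' k, F k y) z) := by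
  simp only [husimi_eq_integral hw]
  refine hasSum_integral_of_dominated_convergence (fun k y => b k * W (y + z))
    (fun k => ((hF k).comp (by fun_prop)).aestronglyMeasurable)
    (fun k => Eventually.of_forall fun y => h k _)
    (Eventually.of_forall fun y => hb.mul_right _) ?_
    (Eventually.of_forall fun y => (summable_mul_of_bound hb fun k => h k _).hasSum)
  simp only [tsum_mul_right]
  exact ((hWe.shift z).integrable (hW.comp (by fun_prop)) hw).const_mul _

/-- The Husimi transform of the Liouville field. -/
lemma SeriesConverge.liouvilleField_husimi (hħ : 0 < ħ) (hw : ∀ i, 0 < w i) {H : Phase N → ℝ}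
    (hHQ : SeriesConverge M ħ w J H Q) (hH₀ : IsTame H₀) (hM : MoyalConverge M ħ J H₀ P) {t : ℝ}
    (ht : t ∈ J) (hP : IsTame (P t)) (hH : H = husimi w H₀) (hQ : Q t = husimi w (P t))
    (z : Phase N) :
    liouvilleField M ħ w H (Q t) z = husimi w (moyalField M ħ H₀ (P t)) z := by
  obtain ⟨b, W, hb, hW, hWe, h⟩ := hM.exists_bound hħ hH₀ ht hP
  -- The absolutely convergent double series is summed over the Husimi powers first, which gives
  -- Husimi transforms of Poisson powers; dominated convergence then sums these over `k`.
  have h1 := (hHQ.hasSum_liouvilleField hħ ht z).summable.hasSum.prod_fiberwise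
    (g := fun k => genCoeff M ħ k * husimi w (poissonPow (k + 1) H₀ (P t)) z) fun k => by
      refine ((hasSum_biTerm_husimi hw hH₀ hP (k + 1) z).mul_left (genCoeff M ħ k)).congr_fun
        fun m => ?_
      rw [hH, hQ]
      ring
  have h2 := hasSum_husimi_of_bound (F := fun k y => genCoeff M ħ k * poissonPow (k + 1) H₀ (P t) y)
    hw hb hW hWe (fun k => continuous_const.mul (hH₀.poissonPow hP (k + 1)).continuous) h z
  exact h1.unique (h2.congr_fun fun k => by rw [husimi_const_mul])

/-- The time derivative of the Husimi transform. -/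
lemma hasDerivAt_husimi (hw : ∀ i, 0 < w i) (hJ : IsOpen J) (hP : IsTemperateState J P) {t : ℝ}
    (ht : t ∈ J) (z : Phase N) :
    HasDerivAt (fun s => husimi w (P s) z) (husimi w (fun y => deriv (fun s => P s y) t) z) t := by
  obtain ⟨ε, hε, hεJ⟩ := Metric.nhds_basis_closedBall.mem_iff.1 (hJ.mem_nhds ht)
  obtain ⟨C, r, hC⟩ := hP.2.2.2 _ (isCompact_closedBall t ε) hεJ
  have htame : ∀ s ∈ J, IsTame (P s) := fun s hs => IsTame.of_temperate (hP.1 s hs)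
  have hbound : IsExpBounded fun y : Phase N => |C| * (1 + ‖y‖) ^ r :=
    IsExpBounded.of_poly (C := |C|) (r := r) fun y => by rw [abs_of_nonneg (by positivity)]
  simp only [husimi_eq_integral hw]
  refine (hasDerivAt_integral_of_dominated_loc_of_deriv_le (F := fun s y => P s (y + z))
    (F' := fun s y => deriv (fun s => P s (y + z)) s) (Metric.closedBall_mem_nhds t hε)
    ?_ (((htame t ht).shift z).integrable hw) ((hP.2.2.1 t ht).comp (by fun_prop)).aestronglyMeasurable
    (Eventually.of_forall fun y s hs => ?_)
    ((hbound.shift z).integrable (by fun_prop) hw) (Eventually.of_forall fun y s hs => ?_)).2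
  · filter_upwards [hJ.mem_nhds ht] with s hs
    exact ((htame s hs).shift z).continuous.aestronglyMeasurable
  · refine (hC s hs (y + z)).trans ?_
    gcongr
    exact le_abs_self C
  · exact (hP.2.1 s (hεJ hs) (y + z)).hasDerivAt

/-- The Liouville equation in terms of the Hamilton generator. -/
lemma MoyalConverge.liouville_iff (hħ : 0 < ħ) (hM : MoyalConverge M ħ J H₀ P) :
    Liouville M ħ J H₀ P ↔
      ∀ t ∈ J, ∀ z, deriv (fun s => P s z) t = moyalField M ħ H₀ (P t) z := by
  cases M with
  | classical =>
    refine forall₂_congr fun t ht => forall_congr' fun z => ?_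
    rw [moyalField, tsum_eq_single 0 fun k hk => by simp [genCoeff, hk]]
    simp [genCoeff]
  | quantum =>
    refine forall₂_congr fun t ht => forall_congr' fun z => ?_
    obtain ⟨r, b, hb, h⟩ := hM t ht
    -- The Moyal series is regarded as a double series concentrated at `m = 0`, so that the
    -- commutator computation for the Husimi star product applies.
    let T : ℕ → ℕ → ℝ := fun k m => if m = 0 then poissonPow k H₀ (P t) z else 0
    have hinj : Function.Injective (fun k : ℕ => (k, (0 : ℕ))) := fun a b h => by simpa using h
    have hrange : ∀ km : ℕ × ℕ, km ∉ range (fun k : ℕ => (k, (0 : ℕ))) → T km.1 km.2 = 0 := by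
      rintro ⟨k, m⟩ hkm
      have hm : m ≠ 0 := fun hm => hkm ⟨k, by simp [hm]⟩
      simp [T, hm]
    have hT : Summable fun km : ℕ × ℕ => (ħ / 2) ^ km.1 / (km.1.factorial : ℝ)
        / (km.2.factorial : ℝ) * |T km.1 km.2| := by
      rw [← hinj.summable_iff fun km hkm => by simp [hrange km hkm]]
      refine Summable.of_nonneg_of_le (fun k => by simp only [Function.comp]; positivity) (fun k => ?_)
        (hb.mul_right ((1 + ‖z‖) ^ r))
      simpa [T, majCoeff] using h k z
    have key := commutator_tsum hħ hT
    have hsupp : ∀ c : ℕ × ℕ → ℂ, ∀ S : ℕ × ℕ → ℝ, (∀ km, T km.1 km.2 = 0 → S km = 0) →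
        ∑' km, c km * (S km : ℂ) = ∑' k : ℕ, c (k, 0) * (S (k, 0) : ℂ) := by
      intro c S hS
      refine (hinj.tsum_eq (f := fun km => c km * (S km : ℂ)) fun km hkm => ?_).symm
      by_contra hn
      exact hkm (by simp [hS km (hrange km hn)])
    rw [hsupp _ (fun km => T km.1 km.2) fun km h => h,
      hsupp _ (fun km => (-1) ^ km.1 * T km.1 km.2) fun km h => by rw [h, mul_zero]] at key
    have hR : ∑' km : ℕ × ℕ, genCoeff Mechanics.quantum ħ km.1 / (km.2.factorial : ℝ)
        * T (km.1 + 1) km.2 = moyalField Mechanics.quantum ħ H₀ (P t) z := by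
      rw [moyalField, ← hinj.tsum_eq]
      · simp [T]
      · rintro ⟨k, m⟩ hkm
        by_contra hn
        have hm : m ≠ 0 := fun hm => hn ⟨k, by simp [hm]⟩
        exact hkm (by simp [T, hm])
    have hswap : ∀ k, poissonPow k (P t) H₀ z = (-1) ^ k * poissonPow k H₀ (P t) z := fun k => by
      simpa only [← poissonPow_eq_biTerm] using biTerm_swap (fun _ => 0) k 0 H₀ (P t) z
    rw [hR] at key
    rw [← Complex.ofReal_inj (z := deriv _ _), ← key]
    simp only [moyal, hswap, T, if_true, Nat.factorial_zero, Nat.cast_one, div_one, mul_one]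

/-- Under the Husimi transform the Husimi–Liouville equation becomes the Liouville equation. -/
theorem husimiLiouville_iff_liouville (hħ : 0 < ħ) (hw : ∀ i, 0 < w i) (hJ : IsOpen J)
    {H : Phase N → ℝ} (hHQ : SeriesConverge M ħ w J H Q) (hH₀ : H₀.HasTemperateGrowth)
    (hP : IsTemperateState J P) (hM : MoyalConverge M ħ J H₀ P) (hH : H = husimi w H₀)
    (hQ : ∀ t ∈ J, Q t = husimi w (P t)) :
    HusimiLiouville M ħ w J H Q ↔ Liouville M ħ J H₀ P := by
  have tH : IsTame H₀ := IsTame.of_temperate hH₀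
  rw [hHQ.husimiLiouville_iff hħ, hM.liouville_iff hħ]
  refine forall₂_congr fun t ht => ?_
  have tP : IsTame (P t) := IsTame.of_temperate (hP.1 t ht)
  obtain ⟨b, W, hb, hW, hWe, h⟩ := hM.exists_bound hħ tH ht tP
  have cR : Continuous (moyalField M ħ H₀ (P t)) := continuous_tsum_of_bound hb hW
    (fun k => continuous_const.mul (tH.poissonPow tP (k + 1)).continuous) h
  have eR : IsExpBounded (moyalField M ħ H₀ (P t)) := isExpBounded_tsum_of_bound hb hWe h
  obtain ⟨C, r, hC⟩ := hP.2.2.2 {t} isCompact_singleton (by simpa using ht)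
  have cD := hP.2.2.1 t ht
  have eD : IsExpBounded fun z => deriv (fun s => P s z) t :=
    IsExpBounded.of_poly fun z => hC t rfl z
  have hdQ : ∀ z, deriv (fun s => Q s z) t = husimi w (fun y => deriv (fun s => P s y) t) z := by
    intro z
    have he : (fun s => Q s z) =ᶠ[𝓝 t] fun s => husimi w (P s) z := by
      filter_upwards [hJ.mem_nhds ht] with s hs
      rw [hQ s hs]
    rw [he.deriv_eq]
    exact (hasDerivAt_husimi hw hJ hP ht z).deriv
  simp only [hdQ, hHQ.liouvilleField_husimi hħ hw tH hM ht tP hH (hQ t ht)]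
  constructor
  · intro heq z
    -- The difference of the two sides of the Liouville equation is continuous, of exponential
    -- growth, and has zero Husimi transform.
    have hz := eq_zero_of_husimi_eq_zero hw
      (f := fun y => deriv (fun s => P s y) t + -1 * moyalField M ħ H₀ (P t) y)
      (cD.add (continuous_const.mul cR)) (eD.add ((IsExpBounded.const _).mul eR)) fun z => by
        have h1 := heq z
        rw [husimi_eq_integral hw] at h1 ⊢
        rw [husimi_eq_integral hw] at h1
        rw [integral_add ((eD.shift z).integrable (cD.comp (by fun_prop)) hw)
          (((eR.shift z).integrable (cR.comp (by fun_prop)) hw).const_mul _),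
          integral_const_mul, h1]
        ring
    have := congrFun hz z
    simp only [Pi.zero_apply] at this
    linarith
  · intro heq z
    rw [show (fun y => deriv (fun s => P s y) t) = _ from funext heq]

end InverseHusimi

end SkodjeGauge

end

/-! ### The extended Hamilton variation principle -/

theorem theorem2 {N : ℕ} (M : SkodjeGauge.Mechanics) (ħ : ℝ) (hħ : 0 < ħ)
    (w : SkodjeGauge.PhaseIdx N → ℝ) (hw : ∀ i, 0 < w i)
    (hwħ : ∀ n : Fin N, w (Sum.inr n) * w (Sum.inl n) = ħ / 2)
    (J : Set ℝ) (hJ : IsOpen J)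
    -- Husimi symbol of the Hamiltonian and Husimi state function
    (H : SkodjeGauge.Phase N → ℝ) (hH : ContDiff ℝ (⊤ : ℕ∞) H)
    (Q : ℝ → SkodjeGauge.Phase N → ℝ) (hQ : SkodjeGauge.IsState J Q)
    (hHQ : SkodjeGauge.SeriesConverge M ħ w J H Q)
    -- arbitrary scalar gauge and antisymmetric family of features
    (A : ℝ → SkodjeGauge.Phase N → ℝ) (hA : SkodjeGauge.TwiceDifferentiable J A)
    (Γ : SkodjeGauge.PhaseIdx N → SkodjeGauge.PhaseIdx N → ℝ → SkodjeGauge.Phase N → ℝ)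
    (hΓ : ∀ i j, SkodjeGauge.TwiceDifferentiable J (Γ i j))
    (hΓanti : ∀ i j, ∀ t ∈ J, ∀ z, Γ i j t z = -Γ j i t z) :
    -- the extended Hamilton equations imply the variation principle, and conversely
    (∀ v : ℝ → SkodjeGauge.Phase N → SkodjeGauge.Phase N,
      SkodjeGauge.IsVelocity J v → SkodjeGauge.ContinuityEq J Q v →
        (SkodjeGauge.ExtHamiltonEq M ħ w J H A Γ Q v →
          SkodjeGauge.VariationPrinciple M ħ w J H A Γ Q v) ∧
        (SkodjeGauge.IsRegularVelocity J v →
          SkodjeGauge.VariationPrinciple M ħ w J H A Γ Q v →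
          SkodjeGauge.ExtHamiltonEq M ħ w J H A Γ Q v)) ∧
    -- the gauge terms cancel in the continuity equation
    (∀ v : ℝ → SkodjeGauge.Phase N → SkodjeGauge.Phase N,
      SkodjeGauge.ExtHamiltonEq M ħ w J H A Γ Q v →
        (SkodjeGauge.ContinuityEq J Q v ↔ SkodjeGauge.HusimiLiouville M ħ w J H Q)) ∧
    -- every positive state evolving by the Liouville equation obeys the variation principle
    (SkodjeGauge.HusimiLiouville M ħ w J H Q → (∀ t ∈ J, ∀ z, 0 < Q t z) →
      ∃ v : ℝ → SkodjeGauge.Phase N → SkodjeGauge.Phase N,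
        SkodjeGauge.IsVelocity J v ∧ SkodjeGauge.ContinuityEq J Q v ∧
        SkodjeGauge.ExtHamiltonEq M ħ w J H A Γ Q v ∧
        SkodjeGauge.VariationPrinciple M ħ w J H A Γ Q v) ∧
    -- after the inverse Husimi transformation: the Liouville equation itself
    (∀ (H₀ : SkodjeGauge.Phase N → ℝ) (P : ℝ → SkodjeGauge.Phase N → ℝ),
      H₀.HasTemperateGrowth → SkodjeGauge.IsTemperateState J P →
      SkodjeGauge.MoyalConverge M ħ J H₀ P →
      H = SkodjeGauge.husimi w H₀ → (∀ t ∈ J, Q t = SkodjeGauge.husimi w (P t)) →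
        (SkodjeGauge.HusimiLiouville M ħ w J H Q ↔ SkodjeGauge.Liouville M ħ J H₀ P)) := by
  open SkodjeGauge in
  refine ⟨fun v hv hcont => ⟨fun heq => heq.variationPrinciple hħ hJ hH hQ hHQ hA hΓ hv hcont,
    fun hreg hvar => hvar.extHamiltonEq hħ hJ hH hQ hHQ hA hΓ hreg hcont⟩,
    fun v heq => heq.continuityEq_iff hħ hJ hH hQ hHQ hA hΓ hΓanti, fun hL hpos => ?_, ?_⟩
  · obtain ⟨v, hv, heq⟩ := exists_velocity_of_pos hħ hJ hH hQ hHQ hA hΓ hpos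
    have hcont := (heq.continuityEq_iff hħ hJ hH hQ hHQ hA hΓ hΓanti).2 hL
    exact ⟨v, hv, hcont, heq, heq.variationPrinciple hħ hJ hH hQ hHQ hA hΓ hv hcont⟩
  · exact fun H₀ P hH₀ hP hM hH₀H hQP =>
      husimiLiouville_iff_liouville hħ hw hJ hHQ hH₀ hP hM hH₀H hQP
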